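/- Let $2\le i\le n-1$ and let $\mathfrak g=\mathfrak{sp}(n,\mathbb C)$, realized as the $2n\times 2n$ matrices $\begin{pmatrix}A&B\\ C&-A^{T}\end{pmatrix}$ with $B,C$ symmetric, with Cartan subalgebra $\mathfrak h$ of diagonal matrices $H(h_1,\dots,h_n)=\mathrm{diag}(h,-h)$, weights $\varepsilon_j(H(h))=h_j$, positive roots $\varepsilon_j\pm\varepsilon_k$ $(j<k)$ and $2\varepsilon_j$, and Killing form $\kappa$. Let $H_{\mathfrak q}=H(1,\dots,1,0,\dots,0)$ ($i$ ones), let $\mathfrak g(d)$ be the $d$-eigenspace of $\mathrm{ad}(H_{\mathfrak q})$, and let $\mathfrak q=\mathfrak l\oplus\mathfrak g(1)\oplus\mathfrak g(2)$, $\mathfrak l=\mathfrak g(0)$, be the maximal parabolic subalgebra of type $C_n(i)$; put $\mathfrak z(\mathfrak n)=\mathfrak g(2)$, $\mathfrak z(\bar{\mathfrak n})=\mathfrak g(-2)$, $\bar{\mathfrak n}=\mathfrak g(-1)\oplus\mathfrak g(-2)$, $\lambda_i=\varepsilon_1+\dots+\varepsilon_i$. Let $\mathfrak g_0$ be a real form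 of $\mathfrak g$ with $H_{\mathfrak q}\in\mathfrak g_0$ (so that $\mathfrak q$ and $\bar{\mathfrak n}$ have real forms $\mathfrak q\cap\mathfrak g_0$ and $\bar{\mathfrak n}_0=\bar{\mathfrak n}\cap\mathfrak g_0$). Let $G_0\subset Sp(n,\mathbb C)$ be the analytic subgroup with Lie algebra $\mathfrak g_0$, $Q_0=N_{G_0}(\mathfrak q)$, $\bar N_0=\exp\bar{\mathfrak n}_0$. Let $\chi_{\mathfrak q}$ be the character of $Q_0$ with differential $\lambda_i$ given by the determinant of the upper left $i\times i$ block, and $\chi^s=|\chi_{\mathfrak q}|^s$ for $s\in\mathbb C$. Let $\mathcal L_s$ be the restriction to $\bar N_0\cong\bar N_0Q_0/Q_0$ of the line bundle over $G_0/Q_0$ induced from $\chi^s$. Its smooth sections are identified with $C^\infty(\bar N_0,\mathbb C)$, where $f$ corresponds to $F(\bar nq)=\chi^s(q)^{-1}f(\bar n)$ on $\bar N_0Q_0$. The algebra $\mathfrak g_0$ acts on them by $(X\cdot f)(\bar n)=\frac{d}{dt}\big|_{t=0}F(\exp(-tX)\bar n)$. For $Z\in\bar{\mathfrak n}_0$ let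 $(R(Z)f)(\bar n)=\frac{d}{dt}\big|_{t=0}f(\bar n\exp(tZ))$, and extend $R$ complex linearly to $\bar{\mathfrak n}$ and to $\mathcal U(\bar{\mathfrak n})$. For $X\in\mathfrak g(1)$ let $\tau_2(X)=\tfrac12(\mathrm{ad}(X)^2\otimes\mathrm{Id})\,\omega\in\mathfrak l\otimes\mathfrak z(\mathfrak n)$, where $\omega=\sum_\gamma X_\gamma^*\otimes X_\gamma$, the sum runs over the roots $\gamma$ of $\mathfrak z(\mathfrak n)$, $X_\gamma$ is a root vector and $X_\gamma^*\in\mathfrak g_{-\gamma}$ satisfies $\kappa(X_\gamma^*,X_\gamma)=1$. Let $\mu=\varepsilon_1+\varepsilon_{i+1}$ and $\epsilon_\gamma=\varepsilon_2-\varepsilon_{i+1}$, let $W=V(\mu+\epsilon_\gamma)$ be the irreducible $\mathfrak l$-constituent of $\mathfrak l\otimes\mathfrak z(\mathfrak n)$ with highest weight $\mu+\epsilon_\gamma$ (the Type 3 special constituent), and let $W^*\subset\mathfrak l\otimes\mathfrak z(\bar{\mathfrak n})$ be its dual with respect to the pairing $\kappa\otimes\kappa$. For $Y^*\in W^*$ let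 $\tilde\tau_2(Y^*)$ be the quadratic polynomial $X\mapsto Y^*(\tau_2(X))$ on $\mathfrak g(1)$, regarded as an element of $\mathrm{Sym}^2(\mathfrak g(-1))$ through $\kappa$, and let $\Omega_2(Y^*)=R(\sigma(\tilde\tau_2(Y^*)))$, where $\sigma:\mathrm{Sym}^2(\mathfrak g(-1))\to\mathcal U(\bar{\mathfrak n})$ is the symmetrization, $\sigma(AB)=\tfrac12(AB+BA)$. A list $D_1,\dots,D_m$ of differential operators on $\mathcal L_s$ is called conformally invariant if it is linearly independent at each point of $\bar N_0$ and, for every $X\in\mathfrak g_0$ and every $j$, $[X,D_j]\in\sum_k C^\infty(\bar N_0)D_k$. Then, for every basis $Y_1^*,\dots,Y_m^*$ of $W^*$ and every $s\in\mathbb C$, the system $\Omega_2(Y_1^*),\dots,\Omega_2(Y_m^*)$ is conformally invariant on $\mathcal L_s$ if and only if $s=n-i+1$. -/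

import Mathlib

open scoped TensorProduct ContDiff

attribute [local instance] Matrix.normedAddCommGroup Matrix.normedSpace

noncomputable section

namespace OmegaTwo

/-! ### The Lie algebra of type C, its root vectors and the grading -/

/-- Complex `2n × 2n` matrices; `Sum.inl j` is the index `j`, `Sum.inr j` is the index `j + n`. -/
abbrev Mat (n : ℕ) : Type := Matrix (Fin n ⊕ Fin n) (Fin n ⊕ Fin n) ℂ

/-- The complex simple Lie algebra `𝔤 = 𝔰𝔭(n, ℂ)` of type `C_n`. -/
abbrev Sp (n : ℕ) : Type := LieAlgebra.Symplectic.sp (Fin n) ℂ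

/-- The element `(A, B; C, -Aᵀ)` of `𝔤`, where `B` and `C` are symmetric. -/
def spBlock {n : ℕ} (A B C : Matrix (Fin n) (Fin n) ℂ) (hB : B.IsSymm) (hC : C.IsSymm) : Sp n :=
  ⟨Matrix.fromBlocks A B C (-A.transpose), by
    rw [LieAlgebra.Symplectic.sp, mem_skewAdjointMatricesLieSubalgebra,
      mem_skewAdjointMatricesSubmodule]
    simp only [Matrix.IsSkewAdjoint, Matrix.IsAdjointPair, Matrix.J, Matrix.fromBlocks_transpose,
      Matrix.fromBlocks_multiply, Matrix.fromBlocks_neg]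
    rw [hB.eq, hC.eq]
    simp⟩

/-- The symmetric matrix `E_{jk} + E_{kj}` for `j ≠ k`, and `E_{jj}` for `j = k`. -/
def symUnit {n : ℕ} (j k : Fin n) : Matrix (Fin n) (Fin n) ℂ :=
  if j = k then Matrix.single j j 1 else Matrix.single j k 1 + Matrix.single k j 1

theorem symUnit_isSymm {n : ℕ} (j k : Fin n) : (symUnit j k).IsSymm := by
  unfold symUnit Matrix.IsSymm
  split_ifs
  · simp
  · simp [Matrix.transpose_add, add_comm]

/-- The element `H(h₁, …, h_n)` of the Cartan subalgebra `𝔥` of diagonal matrices. -/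
def cartan {n : ℕ} (h : Fin n → ℂ) : Sp n :=
  spBlock (Matrix.diagonal h) 0 0 Matrix.isSymm_zero Matrix.isSymm_zero

/-- The root vector of `ε_j - ε_k`, for `j ≠ k`. -/
def rootDiff {n : ℕ} (j k : Fin n) : Sp n :=
  spBlock (Matrix.single j k 1) 0 0 Matrix.isSymm_zero Matrix.isSymm_zero

/-- The root vector of `ε_j + ε_k` (of `2 ε_j` for `j = k`). -/
def rootSum {n : ℕ} (j k : Fin n) : Sp n :=
  spBlock 0 (symUnit j k) 0 (symUnit_isSymm j k) Matrix.isSymm_zero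

/-- The root vector of `-(ε_j + ε_k)` (of `-2 ε_j` for `j = k`). -/
def rootNegSum {n : ℕ} (j k : Fin n) : Sp n :=
  spBlock 0 0 (symUnit j k) Matrix.isSymm_zero (symUnit_isSymm j k)

/-- The weight `ε_k`, for `1 ≤ k ≤ n`; a weight `ν` stands for the functional
`H(h) ↦ ∑ ν_j h_j` on `𝔥`. -/
def eps (n k : ℕ) : Fin n → ℂ := fun j => if (j : ℕ) + 1 = k then 1 else 0

/-- The grading element `H_𝔮` of the maximal parabolic subalgebra of type `C_n(i)`: the element
of `𝔥` on which a root `β` takes the value `2⟨λ_i, β⟩ / ‖α_i‖²`, where `λ_i = ε_1 + … + ε_i`. -/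
def gradingElt (n i : ℕ) : Sp n := cartan fun j => if (j : ℕ) < i then 1 else 0

/-- The graded piece `𝔤(d)`: the `d`-eigenspace of `ad H_𝔮`. In particular `𝔤(2) = 𝔷(𝔫)` and
`𝔤(-2) = 𝔷(𝔫̄)`. -/
def gr (n i : ℕ) (d : ℤ) : Submodule ℂ (Sp n) :=
  Module.End.eigenspace (LieAlgebra.ad ℂ (Sp n) (gradingElt n i)) (d : ℂ)

/-- The Levi factor `𝔩 = 𝔤(0)`. -/
def levi (n i : ℕ) : LieSubalgebra ℂ (Sp n) where
  toSubmodule := gr n i 0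
  lie_mem' := by
    intro x y hx hy
    simp only [gr, AddSubsemigroup.mem_carrier, AddSubmonoid.mem_toSubsemigroup,
      Submodule.mem_toAddSubmonoid, Module.End.mem_eigenspace_iff, LieAlgebra.ad_apply,
      Int.cast_zero, zero_smul] at hx hy ⊢
    rw [leibniz_lie, hx, hy, zero_lie, lie_zero, add_zero]

/-- The parabolic subalgebra `𝔮 = 𝔩 ⊕ 𝔤(1) ⊕ 𝔷(𝔫)` of type `C_n(i)`. -/
def parabolic (n i : ℕ) : Submodule ℂ (Sp n) := gr n i 0 ⊔ gr n i 1 ⊔ gr n i 2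

/-- The opposite nilpotent radical `𝔫̄ = 𝔤(-1) ⊕ 𝔷(𝔫̄)`. -/
def oppNil (n i : ℕ) : Submodule ℂ (Sp n) := gr n i (-1) ⊔ gr n i (-2)

/-- The Killing form `κ` of `𝔤`. -/
def kappa (n : ℕ) : LinearMap.BilinForm ℂ (Sp n) := killingForm ℂ (Sp n)

/-- The vector dual to the root vector `x = X_α` with respect to the Killing form, where
`y = X_{-α}`. -/
def dualVec {n : ℕ} (x y : Sp n) : Sp n := (kappa n x y)⁻¹ • y

/-! ### The map `τ₂` and the special constituent -/

/-- `𝔤(d) ⊗ 𝔤(e)` inside `𝔤 ⊗ 𝔤`. -/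
def grTensor (n i : ℕ) (d e : ℤ) : Submodule ℂ (Sp n ⊗[ℂ] Sp n) :=
  Submodule.map₂ (TensorProduct.mk ℂ (Sp n) (Sp n)) (gr n i d) (gr n i e)

/-- `ω = ∑ X_γ^* ⊗ X_γ`, the sum over the roots `γ = ε_j + ε_k`, `j ≤ k ≤ i`, of `𝔷(𝔫)`. -/
def omega (n i : ℕ) : Sp n ⊗[ℂ] Sp n :=
  ∑ p : Fin n × Fin n with p.1 ≤ p.2 ∧ (p.2 : ℕ) < i,
    dualVec (rootSum p.1 p.2) (rootNegSum p.1 p.2) ⊗ₜ[ℂ] rootSum p.1 p.2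

/-- `τ₂(X) = ½ (ad(X)² ⊗ Id) ω`. -/
def tau (n i : ℕ) (X : Sp n) : Sp n ⊗[ℂ] Sp n :=
  (2⁻¹ : ℂ) • TensorProduct.map ((LieAlgebra.ad ℂ (Sp n) X) ^ 2) LinearMap.id (omega n i)

/-- `v` is a highest weight vector of weight `ν` for `𝔩`: a nonzero vector of weight `ν`
annihilated by the root vectors of all positive roots of `𝔩`. -/
structure IsHighestWeightVector (n i : ℕ) (ν : Fin n → ℂ) (v : Sp n ⊗[ℂ] Sp n) : Prop where
  ne_zero : v ≠ 0
  weight : ∀ h : Fin n → ℂ, ⁅cartan h, v⁆ = (∑ j, ν j * h j) • v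
  diff : ∀ j k : Fin n, j < k → rootDiff j k ∈ levi n i → ⁅(rootDiff j k : Sp n), v⁆ = 0
  sum : ∀ j k : Fin n, rootSum j k ∈ levi n i → ⁅(rootSum j k : Sp n), v⁆ = 0

/-- `W` is an irreducible constituent of `𝔩 ⊗ 𝔷(𝔫)` with highest weight `ν`. -/
structure IsConstituent (n i : ℕ) (ν : Fin n → ℂ)
    (W : LieSubmodule ℂ (levi n i) (Sp n ⊗[ℂ] Sp n)) : Prop where
  le : W.toSubmodule ≤ grTensor n i 0 2
  irreducible : LieModule.IsIrreducible ℂ (levi n i) W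
  highest : ∃ v ∈ W, IsHighestWeightVector n i ν v

/-- The pairing `(A ⊗ B, C ⊗ D) ↦ κ(A, C) κ(B, D)`. -/
def pairing (n : ℕ) : LinearMap.BilinForm ℂ (Sp n ⊗[ℂ] Sp n) :=
  LinearMap.BilinForm.tmul (kappa n) (kappa n)

/-- `W'` is the dual of `W` with respect to the Killing form: an `𝔩`-submodule of `𝔩 ⊗ 𝔷(𝔫̄)`
whose pairing with `W` is nondegenerate on both sides. -/
structure IsKillingDual (n i : ℕ) (W W' : LieSubmodule ℂ (levi n i) (Sp n ⊗[ℂ] Sp n)) :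
    Prop where
  le : W'.toSubmodule ≤ grTensor n i 0 (-2)
  left : ∀ y ∈ W', (∀ w ∈ W, pairing n y w = 0) → y = 0
  right : ∀ w ∈ W, (∀ y ∈ W', pairing n y w = 0) → w = 0

/-- The homogeneous quadratic polynomial `τ̃₂(Y^*) : X ↦ Y^*(τ₂(X))` on `𝔤(1)`. -/
def tauTilde (n i : ℕ) (Y : Sp n ⊗[ℂ] Sp n) (X : Sp n) : ℂ := pairing n Y (tau n i X)

/-- The symmetric bilinear form `B` with `B(X, X) = τ̃₂(Y^*)(X)`. -/
def tauPolar (n i : ℕ) (Y : Sp n ⊗[ℂ] Sp n) (X X' : Sp n) : ℂ :=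
  (tauTilde n i Y (X + X') - tauTilde n i Y X - tauTilde n i Y X') / 2

/-! ### The real group, the line bundle and the action of `𝔤₀` -/

/-- A real form `𝔤₀` of `𝔤`, given by its conjugation; `𝔤₀` is the set of fixed points. -/
structure RealForm (n : ℕ) where
  conj : Sp n →ₛₗ[starRingEnd ℂ] Sp n
  conj_conj : ∀ X, conj (conj X) = X
  conj_lie : ∀ X Y, conj ⁅X, Y⁆ = ⁅conj X, conj Y⁆

/-- The analytic subgroup `G₀` with Lie algebra `𝔤₀`: it is generated by `exp 𝔤₀`. -/
def groupG {n : ℕ} (σ : RealForm n) : Subgroup (Mat n)ˣ :=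
  Subgroup.closure {u | ∃ X : Sp n, σ.conj X = X ∧ (u : Mat n) = NormedSpace.exp (X : Mat n)}

/-- `Q₀ = N_{G₀}(𝔮)`. -/
def groupQ {n : ℕ} (σ : RealForm n) (i : ℕ) : Set (Mat n)ˣ :=
  {u | u ∈ groupG σ ∧
    (fun A : Mat n => (u : Mat n) * A * ((u⁻¹ : (Mat n)ˣ) : Mat n)) ''
        {A | ∃ Z ∈ parabolic n i, (Z : Mat n) = A} =
      {A | ∃ Z ∈ parabolic n i, (Z : Mat n) = A}}

/-- The character `χ_𝔮` with differential `λ_i = ε_1 + … + ε_i`: the determinant of the upper left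
`i × i` block. -/
def chi {n : ℕ} (i : ℕ) (u : Mat n) : ℂ :=
  (u.submatrix (fun j : {j : Fin n // (j : ℕ) < i} => Sum.inl j.1)
    (fun j : {j : Fin n // (j : ℕ) < i} => Sum.inl j.1)).det

/-- The real nilpotent Lie algebra `𝔫̄₀ = 𝔫̄ ∩ 𝔤₀`. The group `N̄₀ = exp 𝔫̄₀` is simply connected
and nilpotent, so `exp : 𝔫̄₀ → N̄₀` is a diffeomorphism; it is used as a global coordinate, and a
function `f` on `N̄₀` is written as the function `φ = f ∘ exp` on `𝔫̄₀`. -/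
def oppNilReal {n : ℕ} (σ : RealForm n) (i : ℕ) : Submodule ℝ (Mat n) where
  carrier := {A | ∃ Z ∈ oppNil n i, σ.conj Z = Z ∧ (Z : Mat n) = A}
  zero_mem' := ⟨0, zero_mem _, map_zero _, rfl⟩
  add_mem' := by
    rintro _ _ ⟨Y, hY, hY', rfl⟩ ⟨Z, hZ, hZ', rfl⟩
    exact ⟨Y + Z, add_mem hY hZ, by rw [map_add, hY', hZ'], rfl⟩
  smul_mem' := by
    rintro c _ ⟨Z, hZ, hZ', rfl⟩
    refine ⟨(c : ℂ) • Z, Submodule.smul_mem _ _ hZ, ?_, ?_⟩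
    · rw [LinearMap.map_smulₛₗ, hZ', Complex.conj_ofReal]
    · ext a b
      simp

/-- The section `F` over `N̄₀Q₀ ⊆ G₀` of the line bundle `𝓛_s` with `F(n̄ q) = χ^s(q⁻¹) φ(n̄)`,
where `χ^s = |χ_𝔮|^s`, extended by `0`. -/
def bundleSection {n : ℕ} (σ : RealForm n) (i : ℕ) (s : ℂ) (φ : oppNilReal σ i → ℂ)
    (g : Mat n) : ℂ :=
  open Classical in
  if h : ∃ p : oppNilReal σ i × (Mat n)ˣ,
      p.2 ∈ groupQ σ i ∧ g = NormedSpace.exp (p.1 : Mat n) * (p.2 : Mat n) then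
    ((‖chi i (h.choose.2 : Mat n)‖ : ℝ) : ℂ) ^ (-s) * φ h.choose.1
  else 0

/-- The action of `X ∈ 𝔤₀` on `C^∞(N̄₀, ℂ_{χ^s})`: `(X • F)(n̄) = d/dt F(exp(-tX) n̄)` at `t = 0`. -/
def leftAction {n : ℕ} (σ : RealForm n) (i : ℕ) (s : ℂ) (X : Sp n)
    (φ : oppNilReal σ i → ℂ) : oppNilReal σ i → ℂ := fun Y =>
  deriv (fun t : ℝ => bundleSection σ i s φ
    (NormedSpace.exp (-(t • (X : Mat n))) * NormedSpace.exp (Y : Mat n))) 0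

/-- The right differentiation `(R(Z) F)(n̄) = d/dt F(n̄ exp(tZ))` at `t = 0`, for `Z ∈ 𝔫̄₀`. -/
def rightReal {n : ℕ} (σ : RealForm n) (i : ℕ) (s : ℂ) (Z : Sp n)
    (φ : oppNilReal σ i → ℂ) : oppNilReal σ i → ℂ := fun Y =>
  deriv (fun t : ℝ => bundleSection σ i s φ
    (NormedSpace.exp (Y : Mat n) * NormedSpace.exp (t • (Z : Mat n)))) 0

/-- The complex linear extension of `R` to `𝔫̄`: here `Z = Z₁ + √-1 Z₂` with
`Z₁ = (Z + σ Z) / 2` and `Z₂ = (Z - σ Z) / (2 √-1)` fixed by the conjugation `σ`. -/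
def right {n : ℕ} (σ : RealForm n) (i : ℕ) (s : ℂ) (Z : Sp n)
    (φ : oppNilReal σ i → ℂ) : oppNilReal σ i → ℂ :=
  rightReal σ i s ((2⁻¹ : ℂ) • (Z + σ.conj Z)) φ +
    Complex.I • rightReal σ i s ((2 * Complex.I)⁻¹ • (Z - σ.conj Z)) φ

/-- `R(σ(AB)) = ½ (R(A) R(B) + R(B) R(A))`: right differentiation by the symmetrization of the
element `AB` of `Sym²(𝔤(-1))`. -/
def rightSym {n : ℕ} (σ : RealForm n) (i : ℕ) (s : ℂ) (A B : Sp n)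
    (φ : oppNilReal σ i → ℂ) : oppNilReal σ i → ℂ :=
  (2⁻¹ : ℂ) • (right σ i s A (right σ i s B φ) + right σ i s B (right σ i s A φ))

/-! ### The `Ω₂` system -/

/-- The set `Δ(𝔤(1))` of the roots `ε_j + ε_k` (`true`) and `ε_j - ε_k` (`false`), `j ≤ i < k`. -/
abbrev RootOne (n i : ℕ) : Type :=
  {j : Fin n // (j : ℕ) < i} × {k : Fin n // i ≤ (k : ℕ)} × Bool

/-- The root vector `X_α`, for `α ∈ Δ(𝔤(1))`. -/
def vecOne {n i : ℕ} (α : RootOne n i) : Sp n :=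
  if α.2.2 then rootSum α.1.1 α.2.1.1 else rootDiff α.1.1 α.2.1.1

/-- The root vector `X_{-α}`, for `α ∈ Δ(𝔤(1))`. -/
def vecNegOne {n i : ℕ} (α : RootOne n i) : Sp n :=
  if α.2.2 then rootNegSum α.1.1 α.2.1.1 else rootDiff α.2.1.1 α.1.1

/-- The dual vector `X_α^* ∈ 𝔤(-1)`, for `α ∈ Δ(𝔤(1))`. -/
def dualOne {n i : ℕ} (α : RootOne n i) : Sp n := dualVec (vecOne α) (vecNegOne α)

/-- The differential operator `Ω₂(Y^*) = R(σ(τ̃₂(Y^*)))`. Under `𝓟²(𝔤(1)) ≅ Sym²(𝔤(-1))`, where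
`AB` corresponds to `X ↦ κ(X, A) κ(X, B)`, the quadratic polynomial `τ̃₂(Y^*)` with polar form `B`
is the element `∑ B(X_α, X_β) X_α^* X_β^*`, the sum over `α, β ∈ Δ(𝔤(1))`. -/
def Omega {n : ℕ} (σ : RealForm n) (i : ℕ) (s : ℂ) (Y : Sp n ⊗[ℂ] Sp n)
    (φ : oppNilReal σ i → ℂ) : oppNilReal σ i → ℂ :=
  ∑ α : RootOne n i, ∑ β : RootOne n i,
    tauPolar n i Y (vecOne α) (vecOne β) • rightSym σ i s (dualOne α) (dualOne β) φ

/-- A list of operators `D_j` on `C^∞(N̄₀, ℂ_{χ^s})` is conformally invariant on `𝓛_s`: it is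
linearly independent at each point, and for each `X ∈ 𝔤₀` every commutator `[X, D_j]` is a
combination of the `D_k` with coefficients in `C^∞(N̄₀)`. -/
structure IsConformallyInvariant {n : ℕ} (σ : RealForm n) (i : ℕ) (s : ℂ) {ι : Type*} [Fintype ι]
    (D : ι → (oppNilReal σ i → ℂ) → (oppNilReal σ i → ℂ)) : Prop where
  independent : ∀ (Y : oppNilReal σ i) (c : ι → ℂ),
    (∀ φ : oppNilReal σ i → ℂ, ContDiff ℝ ∞ φ → ∑ j, c j * D j φ Y = 0) → c = 0
  commutator : ∀ X : Sp n, σ.conj X = X → ∀ j : ι, ∃ C : ι → oppNilReal σ i → ℂ,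
    (∀ k, ContDiff ℝ ∞ (C k)) ∧
    ∀ φ : oppNilReal σ i → ℂ, ContDiff ℝ ∞ φ →
      leftAction σ i s X (D j φ) - D j (leftAction σ i s X φ) = ∑ k, C k * D k φ

end OmegaTwo

end

/-! The contraction Z ⊗ U ↦ ZU + UZ is 𝔩-equivariant and identifies W* with the space `antiSub` of
matrices M of degree -2 with theta M = -M, that is, with the skew lower left i × i blocks. This
rests on a multiplicity-one statement: a bilinear form on 𝔩 × 𝔷(𝔫) of the extremal weight attached
to ε_1 + ε_2 that is killed by the lowering operators of 𝔤𝔩(i) is unique up to scale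
(`IsLowest.eq_zero`, `dual_structure`). Under the identification τ̃₂(Y*) becomes a nonzero multiple
of X ↦ tr(M X²) (`tauPolar_eq`), so Ω₂(Y*) is a nonzero multiple of D_M = ∑ R({x_β, M}) R(f_β),
where (x_β), (f_β) are bases of 𝔤(1), 𝔤(-1) dual for the trace form and { , } is the anticommutator
(`Omega_eq`).

At the point exp Y put X' = Ad(exp(-Y)) X, with components X_d of degree d. By `leftAction_eq`, X
acts on sections as -R(X') + s λ_i(X'). Commuting this past D_M gives (`act_Dop_sub`) [X, D_M] =
D_{[X_0, M]} + (n - i + 1 - s) R({X_1, M}). The constant n - i + 1 comes from the identity ∑ [f_β,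
[{x_β, M}, X_1]] = (n - i + 1) {X_1, M} (`sum_lie_lie`); the -s is the sum of two halves produced by
λ_i; the term of order zero vanishes because ∑ f_β ⊗ {x_β, M} is a symmetric tensor.

If s = n - i + 1, only D_{[X_0, M]} remains, and [X_0, M] lies in `antiSub` again, so it is a
combination of the basis with smooth coefficients (`commutator_mem`). Conversely every D_M kills the
linear functions Y ↦ tr(YP) with P of degree 1, whereas R({X_1, M}) does not kill all of them;
invariance therefore forces the scalar to vanish (`special_value`). Products of two such functions
read off the symbol of D_M, which gives independence at each point (`independent_Omega`). -/

noncomputable section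

namespace OmegaTwo

/-! ### The symplectic adjoint and degrees of matrices -/

/-- The symplectic form. -/
abbrev symJ (n : ℕ) : Mat n := Matrix.J (Fin n) ℂ

theorem symJ_mul_symJ (n : ℕ) : symJ n * symJ n = -1 := Matrix.J_squared _ _

/-- The involution of the space of matrices whose fixed points are the elements of `𝔰𝔭`. -/
def theta {n : ℕ} : Mat n →ₗ[ℂ] Mat n where
  toFun A := symJ n * A.transpose * symJ n
  map_add' A B := by simp [Matrix.transpose_add, mul_add, add_mul]
  map_smul' c A := by simp

theorem theta_apply {n : ℕ} (A : Mat n) : theta A = symJ n * A.transpose * symJ n := rfl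

theorem theta_theta {n : ℕ} (A : Mat n) : theta (theta A) = A := by
  have h := symJ_mul_symJ n
  simp only [theta_apply, Matrix.transpose_mul, Matrix.transpose_transpose, Matrix.J_transpose]
  calc symJ n * (-symJ n * (A * -symJ n)) * symJ n
      = (symJ n * symJ n) * A * (symJ n * symJ n) := by noncomm_ring
    _ = A := by rw [h]; noncomm_ring

/-- `-theta` is the adjoint for the symplectic form, an anti-automorphism; the sign comes from J² =
-1. -/
theorem theta_mul {n : ℕ} (A B : Mat n) : theta (A * B) = -(theta B * theta A) := by
  have h := symJ_mul_symJ n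
  simp only [theta_apply, Matrix.transpose_mul]
  calc symJ n * (B.transpose * A.transpose) * symJ n
      = -(symJ n * B.transpose * (-1) * A.transpose * symJ n) := by noncomm_ring
    _ = _ := by rw [← h]; noncomm_ring

theorem theta_one {n : ℕ} : theta (1 : Mat n) = -1 := by
  simp [theta_apply, symJ_mul_symJ]

theorem trace_theta {n : ℕ} (A : Mat n) : (theta A).trace = -A.trace := by
  rw [theta_apply, Matrix.trace_mul_comm, ← mul_assoc, symJ_mul_symJ]
  simp

theorem mem_sp_iff {n : ℕ} {A : Mat n} : A ∈ LieAlgebra.Symplectic.sp (Fin n) ℂ ↔ theta A = A := by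
  have h := symJ_mul_symJ n
  rw [LieAlgebra.Symplectic.sp, mem_skewAdjointMatricesLieSubalgebra,
      mem_skewAdjointMatricesSubmodule]
  simp only [Matrix.IsSkewAdjoint, Matrix.IsAdjointPair, theta_apply]
  constructor
  · intro h1
    rw [mul_assoc, h1, mul_neg, mul_neg, ← mul_assoc, h]
    simp
  · intro h1
    have h2 : symJ n * (symJ n * A.transpose * symJ n) = symJ n * A := by rw [h1]
    rw [← mul_assoc, ← mul_assoc, h] at h2
    rw [mul_neg, ← h2]
    simp

theorem theta_coe {n : ℕ} (Z : Sp n) : theta (Z : Mat n) = Z := mem_sp_iff.1 Z.2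

/-- The element of `𝔰𝔭` given by a fixed point of `theta`. -/
def toSp {n : ℕ} (A : Mat n) (h : theta A = A) : Sp n := ⟨A, mem_sp_iff.2 h⟩

/-- The projection onto `𝔰𝔭`. -/
def projSp {n : ℕ} : Mat n →ₗ[ℂ] Sp n where
  toFun A := toSp ((2⁻¹ : ℂ) • (A + theta A)) (by simp [theta_theta, add_comm])
  map_add' A B := Subtype.ext (by
    change (2⁻¹ : ℂ) • (A + B + theta (A + B)) =
      (2⁻¹ : ℂ) • (A + theta A) + (2⁻¹ : ℂ) • (B + theta B)
    rw [map_add]; module)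
  map_smul' c A := Subtype.ext (by
    change (2⁻¹ : ℂ) • (c • A + theta (c • A)) = c • (2⁻¹ : ℂ) • (A + theta A)
    rw [map_smul]; module)

theorem coe_projSp {n : ℕ} (A : Mat n) : (projSp A : Mat n) = (2⁻¹ : ℂ) • (A + theta A) := rfl

theorem projSp_of_theta {n : ℕ} {A : Mat n} (h : theta A = A) : (projSp A : Mat n) = A := by
  rw [coe_projSp, h, ← two_smul ℂ A, smul_smul]; norm_num

theorem projSp_coe {n : ℕ} (Z : Sp n) : projSp (Z : Mat n) = Z :=
  Subtype.ext (projSp_of_theta (theta_coe Z))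

theorem coe_smul {n : ℕ} (c : ℂ) (X : Sp n) : ((c • X : Sp n) : Mat n) = c • (X : Mat n) := rfl

theorem coe_add {n : ℕ} (X Y : Sp n) : ((X + Y : Sp n) : Mat n) = X + Y := rfl

theorem coe_spBlock {n : ℕ} (A B C : Matrix (Fin n) (Fin n) ℂ) (hB : B.IsSymm) (hC : C.IsSymm) :
    (spBlock A B C hB hC : Mat n) = Matrix.fromBlocks A B C (-A.transpose) := rfl

theorem coe_lie {n : ℕ} (X Y : Sp n) : ((⁅X, Y⁆ : Sp n) : Mat n) = X * Y - Y * X := rfl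

/-- The conjugate index: it exchanges the two summands. -/
abbrev bar {n : ℕ} (p : Fin n ⊕ Fin n) : Fin n ⊕ Fin n := p.swap

/-- The sign of an index: `1` on the first summand and `-1` on the second. -/
def sgn {n : ℕ} : Fin n ⊕ Fin n → ℂ := Sum.elim (fun _ => 1) (fun _ => -1)

theorem theta_entry {n : ℕ} (A : Mat n) (p q : Fin n ⊕ Fin n) :
    theta A p q = -(sgn p * sgn q * A (bar q) (bar p)) := by
  rw [theta_apply, Matrix.mul_apply]
  simp only [Matrix.mul_apply, Matrix.J]
  rcases p with p | p <;> rcases q with q | q <;>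
    simp [Fintype.sum_sum_type, Matrix.one_apply, sgn, bar]

/-- The eigenvalues of the grading element. -/
def dg {n : ℕ} (i : ℕ) : Fin n ⊕ Fin n → ℤ :=
  Sum.elim (fun j => if (j : ℕ) < i then 1 else 0) (fun j => if (j : ℕ) < i then -1 else 0)

theorem dg_bar {n : ℕ} (i : ℕ) (p : Fin n ⊕ Fin n) : dg i (bar p) = -dg i p := by
  rcases p with p | p <;> simp only [dg, bar, Sum.swap_inl, Sum.swap_inr, Sum.elim_inl,
    Sum.elim_inr] <;> split_ifs <;> simp

theorem dg_mem {n : ℕ} (i : ℕ) (p : Fin n ⊕ Fin n) : dg i p = 1 ∨ dg i p = 0 ∨ dg i p = -1 := by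
  rcases p with p | p <;> simp only [dg, Sum.elim_inl, Sum.elim_inr] <;> split_ifs <;> simp

/-- `A` shifts the eigenvalues of the grading element by `d`. -/
def IsDeg {n : ℕ} (i : ℕ) (d : ℤ) (A : Mat n) : Prop := ∀ p q, A p q ≠ 0 → dg i p - dg i q = d

/-- The component of degree `d`. -/
def prDeg {n : ℕ} (i : ℕ) (d : ℤ) : Mat n →ₗ[ℂ] Mat n where
  toFun A := Matrix.of fun p q => if dg i p - dg i q = d then A p q else 0
  map_add' A B := by ext p q; simp only [Matrix.of_apply, Matrix.add_apply]; split_ifs <;> simp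
  map_smul' c A := by
    ext p q; simp only [Matrix.of_apply, Matrix.smul_apply, RingHom.id_apply]; split_ifs <;> simp

theorem prDeg_apply {n i : ℕ} {d : ℤ} (A : Mat n) (p q : Fin n ⊕ Fin n) :
    prDeg i d A p q = if dg i p - dg i q = d then A p q else 0 := rfl

section
variable {n i : ℕ} {d e : ℤ} {A B : Mat n}

theorem isDeg_prDeg (A : Mat n) : IsDeg i d (prDeg i d A) := by
  intro p q h
  rw [prDeg_apply] at h
  by_contra h'
  exact h (if_neg h')

theorem IsDeg.prDeg_eq (h : IsDeg i d A) : prDeg i d A = A := by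
  ext p q
  rw [prDeg_apply]
  split_ifs with h'
  · rfl
  · by_contra h2
    exact h' (h p q (Ne.symm h2))

theorem IsDeg.prDeg_eq_zero (h : IsDeg i d A) (hde : d ≠ e) : prDeg i e A = 0 := by
  ext p q
  rw [prDeg_apply]
  split_ifs with h'
  · by_contra h2
    exact hde ((h p q h2).symm.trans h')
  · rfl

theorem IsDeg.zero : IsDeg i d (0 : Mat n) := fun _ _ h => absurd rfl h

theorem IsDeg.add (hA : IsDeg i d A) (hB : IsDeg i d B) : IsDeg i d (A + B) := by
  rw [← hA.prDeg_eq, ← hB.prDeg_eq, ← map_add]; exact isDeg_prDeg _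

theorem IsDeg.smul (c : ℂ) (hA : IsDeg i d A) : IsDeg i d (c • A) := by
  rw [← hA.prDeg_eq, ← map_smul]; exact isDeg_prDeg _

theorem IsDeg.sub (hA : IsDeg i d A) (hB : IsDeg i d B) : IsDeg i d (A - B) := by
  rw [← hA.prDeg_eq, ← hB.prDeg_eq, ← map_sub]; exact isDeg_prDeg _

theorem IsDeg.mul (hA : IsDeg i d A) (hB : IsDeg i e B) : IsDeg i (d + e) (A * B) := by
  intro p q h
  rw [Matrix.mul_apply] at h
  obtain ⟨r, -, hr⟩ := Finset.exists_ne_zero_of_sum_ne_zero h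
  have h1 := hA p r (left_ne_zero_of_mul hr)
  have h2 := hB r q (right_ne_zero_of_mul hr)
  omega

theorem IsDeg.lie (hA : IsDeg i d A) (hB : IsDeg i e B) : IsDeg i (d + e) (A * B - B * A) :=
  (hA.mul hB).sub (add_comm e d ▸ hB.mul hA)

/-- The grading element has eigenvalues in {-1, 0, 1}, so their differences lie between -2 and 2.
Almost every vanishing product below is an instance of this. -/
theorem IsDeg.eq_zero (hA : IsDeg i d A) (hd : d < -2 ∨ 2 < d) : A = 0 := by
  ext p q
  by_contra h
  have := hA p q h
  rcases dg_mem i p with h1 | h1 | h1 <;> rcases dg_mem i q with h2 | h2 | h2 <;> omega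

theorem IsDeg.mul_eq_zero (hA : IsDeg i d A) (hB : IsDeg i e B)
    (hd : d + e < -2 ∨ 2 < d + e) : A * B = 0 := (hA.mul hB).eq_zero hd

theorem IsDeg.trace_eq_zero (hA : IsDeg i d A) (hd : d ≠ 0) : A.trace = 0 := by
  refine Finset.sum_eq_zero fun p _ => ?_
  by_contra h
  have := hA p p h
  omega

theorem IsDeg.theta (hA : IsDeg i d A) : IsDeg i d (theta A) := by
  intro p q h
  rw [theta_entry] at h
  have := hA (bar q) (bar p) (right_ne_zero_of_mul (neg_ne_zero.1 h))
  rw [dg_bar, dg_bar] at this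
  omega

theorem theta_prDeg (A : Mat n) : theta (prDeg i d A) = prDeg i d (theta A) := by
  ext p q
  rw [theta_entry, prDeg_apply, prDeg_apply, theta_entry, dg_bar, dg_bar]
  by_cases h : dg i p - dg i q = d
  · rw [if_pos h, if_pos (by omega)]
  · rw [if_neg h, if_neg (by omega)]; simp

theorem sum_prDeg (A : Mat n) : prDeg i (-2) A + prDeg i (-1) A + prDeg i 0 A + prDeg i 1 A +
    prDeg i 2 A = A := by
  ext p q
  simp only [Matrix.add_apply, prDeg_apply]
  rcases dg_mem i p with h1 | h1 | h1 <;> rcases dg_mem i q with h2 | h2 | h2 <;>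
    simp [h1, h2]

theorem isDeg_single (p q : Fin n ⊕ Fin n) (c : ℂ) :
    IsDeg i (dg i p - dg i q) (Matrix.single p q c : Mat n) := by
  intro p' q' h
  rw [Matrix.single_apply] at h
  have : p = p' ∧ q = q' := by by_contra h'; simp [h'] at h
  rw [this.1, this.2]

end

theorem coe_gradingElt (n i : ℕ) :
    (gradingElt n i : Mat n) = Matrix.diagonal (fun p => ((dg i p : ℤ) : ℂ)) := by
  ext p q
  rw [gradingElt, cartan, coe_spBlock]
  rcases p with p | p <;> rcases q with q | q
  · by_cases h : p = q
    · subst h; simp [dg, apply_ite]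
    · simp [h]
  · simp
  · simp
  · by_cases h : p = q
    · subst h; simp [dg, apply_ite]
    · simp [h]

theorem mem_gr {n i : ℕ} {d : ℤ} {Z : Sp n} : Z ∈ gr n i d ↔ IsDeg i d (Z : Mat n) := by
  rw [gr, Module.End.mem_eigenspace_iff, LieAlgebra.ad_apply, Subtype.ext_iff, coe_lie,
    coe_gradingElt]
  constructor
  · intro h p q hpq
    have := congrFun (congrFun h p) q
    simp only [Matrix.sub_apply, Matrix.diagonal_mul, Matrix.mul_diagonal] at this
    have h2 : (((dg i p : ℤ) : ℂ) - (dg i q : ℤ) - d) * (Z : Mat n) p q = 0 := by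
      simp only [coe_smul, Matrix.smul_apply, smul_eq_mul] at this
      linear_combination this
    rcases mul_eq_zero.1 h2 with h3 | h3
    · have : ((dg i p - dg i q - d : ℤ) : ℂ) = 0 := by push_cast; exact h3
      rw [Int.cast_eq_zero] at this
      omega
    · exact absurd h3 hpq
  · intro h
    ext p q
    simp only [Matrix.sub_apply, Matrix.diagonal_mul, Matrix.mul_diagonal,
      coe_smul, Matrix.smul_apply, smul_eq_mul]
    by_cases hpq : (Z : Mat n) p q = 0
    · simp [hpq]
    · rw [← h p q hpq]; push_cast; ring

/-! ### The Killing form is a multiple of the trace form -/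

theorem trace_mul_mul {ι : Type*} [Fintype ι] [DecidableEq ι] (f : Matrix ι ι ℂ →ₗ[ℂ] Matrix ι ι ℂ)
    (A B : Matrix ι ι ℂ) (h : ∀ M, f M = A * M * B) :
    LinearMap.trace ℂ _ f = A.trace * B.trace := by
  rw [LinearMap.trace_eq_matrix_trace ℂ (Matrix.stdBasis ℂ ι ι), Matrix.trace,
    Fintype.sum_prod_type, Matrix.trace, Matrix.trace, Finset.sum_mul_sum]
  refine Finset.sum_congr rfl fun p _ => Finset.sum_congr rfl fun q _ => ?_
  rw [Matrix.diag_apply, LinearMap.toMatrix_apply, Matrix.stdBasis_eq_single, h]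
  simp [Matrix.stdBasis, Matrix.mul_apply, Matrix.single_apply, Finset.sum_ite_eq, ite_and]

theorem trace_mul_transpose_mul {ι : Type*} [Fintype ι] [DecidableEq ι]
    (f : Matrix ι ι ℂ →ₗ[ℂ] Matrix ι ι ℂ)
    (A B : Matrix ι ι ℂ) (h : ∀ M, f M = A * M.transpose * B) :
    LinearMap.trace ℂ _ f = (A.transpose * B).trace := by
  rw [LinearMap.trace_eq_matrix_trace ℂ (Matrix.stdBasis ℂ ι ι), Matrix.trace,
    Fintype.sum_prod_type, Matrix.trace, Finset.sum_comm]
  refine Finset.sum_congr rfl fun p _ => ?_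
  rw [Matrix.diag_apply, Matrix.mul_apply]
  refine Finset.sum_congr rfl fun q _ => ?_
  rw [Matrix.diag_apply, LinearMap.toMatrix_apply, Matrix.stdBasis_eq_single, h]
  simp [Matrix.stdBasis, Matrix.mul_apply, Matrix.single_apply, Finset.sum_ite_eq, ite_and]

/-- The operator ad X ∘ ad Y extends to `F` on all matrices, and its trace on the image of the
projection ½(1 + theta) is ½(tr F + tr(F ∘ theta)). The first trace is 4n tr(XY), since X and Y are
traceless; in the second each of the four terms of `F` contributes tr(XY). -/
theorem kappa_eq {n : ℕ} (X Y : Sp n) :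
    kappa n X Y = (2 * n + 2 : ℂ) * ((X : Mat n) * Y).trace := by
  let x : Mat n := X
  let y : Mat n := Y
  have hx : theta x = x := theta_coe X
  have hy : theta y = y := theta_coe Y
  have tx : x.trace = 0 := by have := trace_theta x; rw [hx] at this; linear_combination this / 2
  have ty : y.trace = 0 := by have := trace_theta y; rw [hy] at this; linear_combination this / 2
  have hJ := symJ_mul_symJ n
  let ι : Sp n →ₗ[ℂ] Mat n :=
    { toFun := fun Z => Z, map_add' := fun _ _ => rfl, map_smul' := fun _ _ => rfl }
  let F1 : Mat n →ₗ[ℂ] Mat n := LinearMap.mulLeft ℂ (x * y)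
  let F2 : Mat n →ₗ[ℂ] Mat n := LinearMap.mulLeft ℂ x ∘ₗ LinearMap.mulRight ℂ y
  let F3 : Mat n →ₗ[ℂ] Mat n := LinearMap.mulLeft ℂ y ∘ₗ LinearMap.mulRight ℂ x
  let F4 : Mat n →ₗ[ℂ] Mat n := LinearMap.mulRight ℂ (y * x)
  let F := F1 - F2 - F3 + F4
  have h1 : LieAlgebra.ad ℂ (Sp n) X ∘ₗ LieAlgebra.ad ℂ (Sp n) Y = projSp ∘ₗ (F ∘ₗ ι) := by
    ext1 Z
    have hF : (F ∘ₗ ι) Z = ((⁅X, ⁅Y, Z⁆⁆ : Sp n) : Mat n) := by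
      rw [coe_lie, coe_lie]
      change x * y * Z - x * (Z * y) - y * (Z * x) + Z * (y * x)
        = x * (y * Z - Z * y) - (y * Z - Z * y) * x
      noncomm_ring
    rw [LinearMap.comp_apply, LinearMap.comp_apply, hF, projSp_coe]
    rfl
  have h2 : (F ∘ₗ ι) ∘ₗ projSp = (2⁻¹ : ℂ) • (F + F ∘ₗ theta) := by
    ext1 Z
    change F (projSp Z : Mat n) = _
    rw [coe_projSp, map_smul, map_add]; rfl
  rw [kappa, killingForm_apply_apply, h1, LinearMap.trace_comp_comm', h2, map_smul, map_add]
  have e : F ∘ₗ theta = F1 ∘ₗ theta - F2 ∘ₗ theta - F3 ∘ₗ theta + F4 ∘ₗ theta := rfl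
  rw [e]
  simp only [F, map_add, map_sub]
  have hc : (1 : Mat n).trace = 2 * n := by
    rw [Matrix.trace_one]; simp; ring
  have t1 : LinearMap.trace ℂ _ F1 = (x * y).trace * (1 : Mat n).trace :=
    trace_mul_mul _ _ _ fun M => by simp [F1, mul_assoc]
  have t2 : LinearMap.trace ℂ _ F2 = x.trace * y.trace :=
    trace_mul_mul _ _ _ fun M => by simp [F2, mul_assoc]
  have t3 : LinearMap.trace ℂ _ F3 = y.trace * x.trace :=
    trace_mul_mul _ _ _ fun M => by simp [F3, mul_assoc]
  have t4 : LinearMap.trace ℂ _ F4 = (1 : Mat n).trace * (y * x).trace :=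
    trace_mul_mul _ _ _ fun M => by simp [F4, mul_assoc]
  have s1 : LinearMap.trace ℂ _ (F1 ∘ₗ theta) = ((x * y * symJ n).transpose * symJ n).trace :=
    trace_mul_transpose_mul _ _ _ fun M => by simp [F1, theta_apply, mul_assoc]
  have s2 : LinearMap.trace ℂ _ (F2 ∘ₗ theta) = ((x * symJ n).transpose * (symJ n * y)).trace :=
    trace_mul_transpose_mul _ _ _ fun M => by simp [F2, theta_apply, mul_assoc]
  have s3 : LinearMap.trace ℂ _ (F3 ∘ₗ theta) = ((y * symJ n).transpose * (symJ n * x)).trace :=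
    trace_mul_transpose_mul _ _ _ fun M => by simp [F3, theta_apply, mul_assoc]
  have s4 : LinearMap.trace ℂ _ (F4 ∘ₗ theta) = ((symJ n).transpose * (symJ n * (y * x))).trace :=
    trace_mul_transpose_mul _ _ _ fun M => by simp [F4, theta_apply, mul_assoc]
  have u2 : ∀ a b : Mat n, theta a = a →
      ((a * symJ n).transpose * (symJ n * b)).trace = -(a * b).trace := by
    intro a b ha
    rw [Matrix.transpose_mul, Matrix.J_transpose]
    nth_rewrite 2 [← ha]
    rw [theta_apply]
    simp [mul_assoc]
  have u1 : ((x * y * symJ n).transpose * symJ n).trace = (x * y).trace := by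
    rw [Matrix.transpose_mul, Matrix.J_transpose]
    have h3 := trace_theta (x * y)
    rw [theta_apply] at h3
    rw [neg_mul, neg_mul, Matrix.trace_neg, h3, neg_neg]
  have u4 : ((symJ n).transpose * (symJ n * (y * x))).trace = (x * y).trace := by
    rw [Matrix.J_transpose, ← mul_assoc, neg_mul, hJ, neg_neg, one_mul, Matrix.trace_mul_comm]
  rw [t1, t2, t3, t4, s1, s2, s3, s4, u2 x y hx, u2 y x hy, u1, u4, Matrix.trace_mul_comm y x, hc,
    tx, ty, smul_eq_mul]
  ring

theorem killing_const_ne_zero (n : ℕ) : (2 * n + 2 : ℂ) ≠ 0 := by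
  norm_cast

/-! ### Root vectors -/

/-- The projection of twice a matrix unit to `𝔰𝔭`. -/
def unitSp {n : ℕ} (p q : Fin n ⊕ Fin n) : Mat n :=
  Matrix.single p q 1 + theta (Matrix.single p q 1)

theorem theta_unitSp {n : ℕ} (p q : Fin n ⊕ Fin n) : theta (unitSp p q) = unitSp p q := by
  rw [unitSp, map_add, theta_theta, add_comm]

theorem isDeg_unitSp {n i : ℕ} (p q : Fin n ⊕ Fin n) :
    IsDeg i (dg i p - dg i q) (unitSp p q) := (isDeg_single p q 1).add (isDeg_single p q 1).theta

theorem theta_single {n : ℕ} (p q : Fin n ⊕ Fin n) :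
    theta (Matrix.single p q 1) = -(sgn p * sgn q) • Matrix.single (bar q) (bar p) (1 : ℂ) := by
  ext r s
  rw [theta_entry]
  simp only [Matrix.smul_apply, Matrix.single_apply, smul_eq_mul]
  have e1 : (p = bar s ∧ q = bar r) ↔ (bar q = r ∧ bar p = s) := by
    constructor
    · rintro ⟨rfl, rfl⟩; simp [bar]
    · rintro ⟨rfl, rfl⟩; simp [bar]
  simp only [e1]
  split_ifs with h
  · obtain ⟨rfl, rfl⟩ := h
    rcases p with p | p <;> rcases q with q | q <;> simp [sgn, bar]
  · simp

theorem coe_rootDiff {n : ℕ} (j k : Fin n) :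
    (rootDiff j k : Mat n) = unitSp (Sum.inl j) (Sum.inl k) := by
  rw [unitSp, theta_single, rootDiff, coe_spBlock]
  ext p q
  rcases p with p | p <;> rcases q with q | q <;>
    simp [sgn, bar, Matrix.single_apply]

theorem coe_rootSum {n : ℕ} {j k : Fin n} (h : j ≠ k) :
    (rootSum j k : Mat n) = unitSp (Sum.inl j) (Sum.inr k) := by
  rw [unitSp, theta_single, rootSum, coe_spBlock, symUnit, if_neg h]
  ext p q
  rcases p with p | p <;> rcases q with q | q <;>
    simp [sgn, bar, Matrix.single_apply]

theorem coe_rootSum_self {n : ℕ} (j : Fin n) :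
    (rootSum j j : Mat n) = (2⁻¹ : ℂ) • unitSp (Sum.inl j) (Sum.inr j) := by
  rw [unitSp, theta_single, rootSum, coe_spBlock, symUnit, if_pos rfl]
  ext p q
  rcases p with p | p <;> rcases q with q | q <;>
    simp [sgn, bar, Matrix.single_apply]
  split_ifs <;> norm_num

theorem coe_rootNegSum {n : ℕ} {j k : Fin n} (h : j ≠ k) :
    (rootNegSum j k : Mat n) = unitSp (Sum.inr k) (Sum.inl j) := by
  rw [unitSp, theta_single, rootNegSum, coe_spBlock, symUnit, if_neg h]
  ext p q
  rcases p with p | p <;> rcases q with q | q <;>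
    simp [sgn, bar, Matrix.single_apply, add_comm]

theorem coe_rootNegSum_self {n : ℕ} (j : Fin n) :
    (rootNegSum j j : Mat n) = (2⁻¹ : ℂ) • unitSp (Sum.inr j) (Sum.inl j) := by
  rw [unitSp, theta_single, rootNegSum, coe_spBlock, symUnit, if_pos rfl]
  ext p q
  rcases p with p | p <;> rcases q with q | q <;>
    simp [sgn, bar, Matrix.single_apply]
  split_ifs <;> norm_num

/-- `theta` negates traces and reverses products with a sign, so both halves of `unitSp` contribute
the same amount. Pairing with a root vector thus reads off a single entry. -/
theorem trace_unitSp_mul {n : ℕ} (p q : Fin n ⊕ Fin n) {A : Mat n} (hA : theta A = A) :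
    (unitSp p q * A).trace = 2 * A q p := by
  have h1 : (Matrix.single p q 1 * A).trace = A q p := by
    rw [Matrix.trace_single_mul]; simp
  have h2 : (theta (Matrix.single p q 1) * A).trace = (Matrix.single p q 1 * A).trace := by
    nth_rewrite 1 [← hA]
    have := theta_mul A (Matrix.single p q 1)
    rw [← neg_eq_iff_eq_neg] at this
    rw [← this, Matrix.trace_neg, trace_theta, neg_neg, Matrix.trace_mul_comm]
  rw [unitSp, add_mul, Matrix.trace_add, h2, h1]; ring

/-- The second index of a root of `𝔤(1)`. -/
def RootOne.snd {n i : ℕ} (α : RootOne n i) : Fin n ⊕ Fin n :=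
  if α.2.2 then Sum.inr α.2.1.1 else Sum.inl α.2.1.1

theorem RootOne.ne {n i : ℕ} (α : RootOne n i) : α.1.1 ≠ α.2.1.1 := by
  intro h
  have h1 := α.1.2
  have h2 := α.2.1.2
  rw [h] at h1
  omega

theorem RootOne.dg_fst {n i : ℕ} (α : RootOne n i) : dg i (Sum.inl α.1.1 : Fin n ⊕ Fin n) = 1 := by
  simp [dg, α.1.2]

theorem RootOne.dg_snd {n i : ℕ} (α : RootOne n i) : dg i α.snd = 0 := by
  have := α.2.1.2
  unfold RootOne.snd
  split_ifs <;> simp [dg, this]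

theorem coe_vecOne {n i : ℕ} (α : RootOne n i) :
    (vecOne α : Mat n) = unitSp (Sum.inl α.1.1) α.snd := by
  unfold vecOne RootOne.snd
  split_ifs
  · exact coe_rootSum α.ne
  · exact coe_rootDiff _ _

theorem coe_vecNegOne {n i : ℕ} (α : RootOne n i) :
    (vecNegOne α : Mat n) = unitSp α.snd (Sum.inl α.1.1) := by
  unfold vecNegOne RootOne.snd
  split_ifs
  · exact coe_rootNegSum α.ne
  · exact coe_rootDiff _ _

/-- The root vector `X_α`, as a matrix. -/
def xv {n i : ℕ} (α : RootOne n i) : Mat n := unitSp (Sum.inl α.1.1) α.snd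

/-- The vector dual to `X_α` for the trace form. -/
def fv {n i : ℕ} (α : RootOne n i) : Mat n := (2⁻¹ : ℂ) • unitSp α.snd (Sum.inl α.1.1)

section
variable {n i : ℕ}

theorem theta_xv (α : RootOne n i) : theta (xv α) = xv α := theta_unitSp _ _

theorem theta_fv (α : RootOne n i) : theta (fv α) = fv α := by
  rw [fv, map_smul, theta_unitSp]

theorem isDeg_xv (α : RootOne n i) : IsDeg i 1 (xv α) := by
  have := isDeg_unitSp (i := i) (Sum.inl α.1.1) α.snd
  rwa [α.dg_fst, α.dg_snd] at this

theorem isDeg_fv (α : RootOne n i) : IsDeg i (-1) (fv α) := by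
  have := isDeg_unitSp (i := i) α.snd (Sum.inl α.1.1)
  rw [α.dg_fst, α.dg_snd] at this
  exact this.smul _

theorem coe_dualOne (α : RootOne n i) :
    (dualOne α : Mat n) = (2 * n + 2 : ℂ)⁻¹ • fv α := by
  have hc := killing_const_ne_zero n
  rw [dualOne, dualVec, coe_smul, kappa_eq, coe_vecOne, coe_vecNegOne, fv,
    trace_unitSp_mul _ _ (theta_unitSp _ _), smul_smul]
  congr 1
  have : unitSp α.snd (Sum.inl α.1.1) α.snd (Sum.inl α.1.1) = 1 := by
    rw [unitSp, theta_single]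
    have h3 : Sum.inr α.1.1 ≠ α.snd := by
      intro h
      have := congrArg (dg i) h
      rw [α.dg_snd] at this
      simp [dg, α.1.2] at this
    simp [bar, h3]
  rw [this]
  field_simp

/-- The roots ε_j + ε_k and ε_j - ε_k are treated together by letting the second index run over both
halves; `dg` then selects the admissible pairs. -/
theorem sum_rootOne {M : Type*} [AddCommMonoid M] (F : Fin n ⊕ Fin n → Fin n ⊕ Fin n → M) :
    ∑ α : RootOne n i, F (Sum.inl α.1.1) α.snd =
      ∑ p, ∑ q, if dg i p = 1 ∧ dg i q = 0 then F p q else 0 := by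
  have h1 : ∀ p : Fin n ⊕ Fin n, (∑ q, if dg i p = 1 ∧ dg i q = 0 then F p q else 0) =
      if dg i p = 1 then ∑ q, if dg i q = 0 then F p q else 0 else 0 := by
    intro p
    split_ifs with h <;> simp [h]
  have h2 : ∀ k : Fin n, ((if (k : ℕ) < i then (1 : ℤ) else 0) = 0) ↔ i ≤ (k : ℕ) := by
    intro k; split_ifs <;> simp <;> omega
  have h3 : ∀ k : Fin n, ((if (k : ℕ) < i then (-1 : ℤ) else 0) = 0) ↔ i ≤ (k : ℕ) := by
    intro k; split_ifs <;> simp <;> omega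
  have h4 : ∀ k : Fin n, ((if (k : ℕ) < i then (1 : ℤ) else 0) = 1) ↔ (k : ℕ) < i := by
    intro k; split_ifs <;> simp <;> omega
  have h5 : ∀ k : Fin n, ((if (k : ℕ) < i then (-1 : ℤ) else 0) = 1) ↔ False := by
    intro k; split_ifs <;> simp
  simp only [h1]
  rw [Fintype.sum_prod_type, Fintype.sum_sum_type]
  simp only [dg, Sum.elim_inl, Sum.elim_inr, h4, h5, if_false, Finset.sum_const_zero, add_zero,
    Fintype.sum_sum_type, h2, h3, Fintype.sum_prod_type]
  rw [← Finset.sum_filter, Finset.sum_subtype _ (p := fun j : Fin n => (j : ℕ) < i) (by simp)]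
  refine Finset.sum_congr rfl fun j _ => ?_
  rw [← Finset.sum_filter, ← Finset.sum_filter, ← Finset.sum_add_distrib,
    Finset.sum_subtype _ (p := fun j : Fin n => i ≤ (j : ℕ)) (by simp)]
  refine Finset.sum_congr rfl fun k _ => ?_
  simp [RootOne.snd, add_comm]

/-- Expansion in dual bases. The coefficients produce the block `T` of P from eigenvalue 0 to
eigenvalue 1; the only other block of degree 1, from -1 to 0, is its image under `theta`. -/
theorem sum_trace_fv_mul {P : Mat n} (hP : theta P = P) (hd : IsDeg i 1 P) :
    ∑ α : RootOne n i, (fv α * P).trace • xv α = P := by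
  let T : Mat n := ∑ α : RootOne n i, P (Sum.inl α.1.1) α.snd • Matrix.single (Sum.inl α.1.1) α.snd 1
  have h1 : ∑ α : RootOne n i, (fv α * P).trace • xv α = T + theta T := by
    simp only [T]
    rw [map_sum, ← Finset.sum_add_distrib]
    refine Finset.sum_congr rfl fun α _ => ?_
    rw [fv, Matrix.smul_mul, Matrix.trace_smul, trace_unitSp_mul _ _ hP, xv, unitSp, map_smul,
      smul_add, smul_eq_mul, ← mul_assoc]
    norm_num
  have h2 : ∀ p q, T p q = if dg i p = 1 ∧ dg i q = 0 then P p q else 0 := by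
    intro p q
    simp only [T]
    rw [sum_rootOne (fun a b => P a b • Matrix.single a b (1 : ℂ)), Matrix.sum_apply]
    simp only [Matrix.sum_apply]
    rw [Finset.sum_eq_single p, Finset.sum_eq_single q]
    · split_ifs <;> simp
    · intro b _ hb
      split_ifs <;> simp [hb]
    · simp
    · intro a _ ha
      refine Finset.sum_eq_zero fun b _ => ?_
      split_ifs <;> simp [ha]
    · simp
  rw [h1]
  ext p q
  have h3 : P p q = theta P p q := by rw [hP]
  rw [Matrix.add_apply, theta_entry, h2, h2, dg_bar, dg_bar]
  rw [theta_entry] at h3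
  by_cases h : P p q = 0
  · have h5 : sgn p * sgn q * P (bar q) (bar p) = 0 := by rw [h] at h3; linear_combination h3
    simp only [h, mul_ite, h5, mul_zero, ite_self, neg_zero, add_zero]
  · have h4 := hd p q h
    rcases dg_mem i p with h1 | h1 | h1 <;> rcases dg_mem i q with h2 | h2 | h2 <;>
      simp only [h1, h2] at h4 ⊢ <;> first | omega | skip
    · simp
    · simp only [neg_neg, neg_zero]; simp; linear_combination -h3

theorem sum_trace_mul_xv {A : Mat n} (hA : theta A = A) (hd : IsDeg i (-1) A) :
    ∑ α : RootOne n i, (A * xv α).trace • fv α = A := by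
  let T : Mat n := ∑ α : RootOne n i, A α.snd (Sum.inl α.1.1) • Matrix.single α.snd (Sum.inl α.1.1) 1
  have h1 : ∑ α : RootOne n i, (A * xv α).trace • fv α = T + theta T := by
    simp only [T]
    rw [map_sum, ← Finset.sum_add_distrib]
    refine Finset.sum_congr rfl fun α _ => ?_
    rw [fv, Matrix.trace_mul_comm, xv, trace_unitSp_mul _ _ hA, unitSp, map_smul,
      ← smul_add, smul_smul, mul_comm (2 : ℂ), mul_assoc]
    norm_num
  have h2 : ∀ p q, T p q = if dg i q = 1 ∧ dg i p = 0 then A p q else 0 := by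
    intro p q
    simp only [T]
    rw [sum_rootOne (fun a b => A b a • Matrix.single b a (1 : ℂ)), Matrix.sum_apply]
    simp only [Matrix.sum_apply]
    rw [Finset.sum_eq_single q, Finset.sum_eq_single p]
    · split_ifs <;> simp
    · intro b _ hb
      split_ifs <;> simp [hb]
    · simp
    · intro a _ ha
      refine Finset.sum_eq_zero fun b _ => ?_
      split_ifs <;> simp [ha]
    · simp
  rw [h1]
  ext p q
  have h3 : A p q = theta A p q := by rw [hA]
  rw [Matrix.add_apply, theta_entry, h2, h2, dg_bar, dg_bar]
  rw [theta_entry] at h3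
  by_cases h : A p q = 0
  · have h5 : sgn p * sgn q * A (bar q) (bar p) = 0 := by rw [h] at h3; linear_combination h3
    simp only [h, mul_ite, h5, mul_zero, ite_self, neg_zero, add_zero]
  · have h4 := hd p q h
    rcases dg_mem i p with h1 | h1 | h1 <;> rcases dg_mem i q with h2 | h2 | h2 <;>
      simp only [h1, h2] at h4 ⊢ <;> first | omega | skip
    · simp
    · simp only [neg_neg, neg_zero]; simp; linear_combination -h3

end

/-! ### Contractions with the Casimir tensor of `𝔤(1) × 𝔤(-1)` -/

/-- The projection onto the eigenspace of the grading element of eigenvalue `k`. -/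
def eigProj (n i : ℕ) (k : ℤ) : Mat n := Matrix.diagonal fun p => if dg i p = k then 1 else 0

section
variable {n i : ℕ} {d : ℤ} {A : Mat n}

theorem IsDeg.eigProj_mul (hA : IsDeg i d A) (k : ℤ) :
    eigProj n i k * A = A * eigProj n i (k - d) := by
  ext p q
  rw [eigProj, eigProj, Matrix.diagonal_mul, Matrix.mul_diagonal]
  by_cases h : A p q = 0
  · simp [h]
  · have := hA p q h
    by_cases h2 : dg i p = k
    · rw [if_pos h2, if_pos (by omega)]; ring
    · rw [if_neg h2, if_neg (by omega)]; ring

theorem eigProj_eq_zero {k : ℤ} (h : k < -1 ∨ 1 < k) : eigProj n i k = 0 := by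
  ext p q
  rw [eigProj, Matrix.diagonal_apply]
  split_ifs with h1 h2
  · rcases dg_mem i p with h3 | h3 | h3 <;> omega
  · rfl
  · rfl

theorem eigProj_add : eigProj n i (-1) + eigProj n i 0 + eigProj n i 1 = 1 := by
  ext p q
  simp only [eigProj, Matrix.add_apply, Matrix.diagonal_apply, Matrix.one_apply]
  split_ifs with h1 h2 h3 h4 h5 <;> first | omega | simp
  rcases dg_mem i p with h6 | h6 | h6 <;> omega

theorem eigProj_mul_eigProj {k l : ℤ} (h : k ≠ l) : eigProj n i k * eigProj n i l = 0 := by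
  rw [eigProj, eigProj, Matrix.diagonal_mul_diagonal]
  ext p q
  rw [Matrix.diagonal_apply]
  split_ifs with h1 h2 h3 <;> first | omega | simp

theorem eigProj_mul_self (k : ℤ) : eigProj n i k * eigProj n i k = eigProj n i k := by
  rw [eigProj, Matrix.diagonal_mul_diagonal]
  congr 1
  ext p
  split_ifs <;> simp

theorem isDeg_eigProj (k : ℤ) : IsDeg i 0 (eigProj n i k) := by
  intro p q h
  have : p = q := by by_contra h'; exact h (Matrix.diagonal_apply_ne _ h')
  rw [this]; simp

theorem trace_eigProj_mul (k : ℤ) (A : Mat n) :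
    (eigProj n i k * A).trace = ∑ p, if dg i p = k then A p p else 0 := by
  refine Finset.sum_congr rfl fun p _ => ?_
  rw [Matrix.diag_apply, eigProj, Matrix.diagonal_mul]
  split_ifs <;> simp

theorem eigProj_mul_mul_apply (k l : ℤ) (A : Mat n) (r s : Fin n ⊕ Fin n) :
    (eigProj n i k * A * eigProj n i l) r s = if dg i r = k ∧ dg i s = l then A r s else 0 := by
  rw [eigProj, eigProj, Matrix.mul_diagonal, Matrix.diagonal_mul]
  by_cases h1 : dg i r = k <;> by_cases h2 : dg i s = l <;> simp [h1, h2]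

theorem sum_bar {M : Type*} [AddCommMonoid M] (F : Fin n ⊕ Fin n → M) : ∑ p, F (bar p) = ∑ p, F p :=
  (Equiv.sumComm (Fin n) (Fin n)).sum_comp F

theorem trace_eigProj_one : (eigProj n i 0 : Mat n).trace = 2 * ((n - i : ℕ) : ℂ) := by
  have h : ∀ c : ℤ, ∀ k : Fin n, (c ≠ 0) → (((if (k : ℕ) < i then c else 0) = 0) ↔ ¬ (k : ℕ) < i) := by
    intro c k hc; split_ifs <;> simp_all
  have h2 : (Finset.univ.filter fun k : Fin n => ¬ (k : ℕ) < i).card = n - i := by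
    rw [← Finset.card_map Fin.valEmbedding]
    have : (Finset.univ.filter fun k : Fin n => ¬ (k : ℕ) < i).map Fin.valEmbedding
        = Finset.Ico i n := by
      ext a
      simp only [Finset.mem_map, Finset.mem_filter, Finset.mem_univ, true_and, Finset.mem_Ico,
        Fin.valEmbedding_apply]
      constructor
      · rintro ⟨k, hk, rfl⟩; exact ⟨by omega, k.2⟩
      · rintro ⟨h1, h2⟩; exact ⟨⟨a, h2⟩, by simpa using h1, rfl⟩
    rw [this, Nat.card_Ico]
  rw [eigProj, Matrix.trace_diagonal, Fintype.sum_sum_type]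
  simp only [dg, Sum.elim_inl, Sum.elim_inr, h 1 _ (by norm_num), h (-1) _ (by norm_num)]
  rw [Finset.sum_boole, h2]
  ring

/-- Each product f_α A x_α is a combination of four matrix units, from the two halves of either root
vector. In the sum over the roots, the two direct terms give traces times spectral projections, and
the two crossed terms give blocks of `theta A`. -/
theorem sum_fv_mul_mul_xv (A : Mat n) :
    ∑ α : RootOne n i, fv α * A * xv α = (2⁻¹ : ℂ) •
      ((eigProj n i 1 * A).trace • eigProj n i 0 + (eigProj n i 0 * A).trace • eigProj n i (-1)
        - eigProj n i 0 * theta A * eigProj n i (-1)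
        - eigProj n i (-1) * theta A * eigProj n i 0) := by
  have h1 : ∀ p q : Fin n ⊕ Fin n, unitSp q p * A * unitSp p q =
      A p p • Matrix.single q q 1 - (sgn p * sgn q * A p (bar q)) • Matrix.single q (bar p) 1
        - (sgn p * sgn q * A (bar q) p) • Matrix.single (bar p) q 1
        + A (bar q) (bar q) • Matrix.single (bar p) (bar p) 1 := by
    intro p q
    have hs : ∀ a : Fin n ⊕ Fin n, sgn a * sgn a = 1 := by
      rintro (a | a) <;> simp [sgn]
    have h2 : ∀ a b c d : Fin n ⊕ Fin n, Matrix.single a b (1 : ℂ) * A * Matrix.single c d 1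
        = A b c • Matrix.single a d 1 := by
      intro a b c d
      rw [Matrix.single_mul_mul_single]; simp
    have h3 : (sgn q * sgn p) * (sgn p * sgn q) = 1 := by
      linear_combination sgn q * sgn q * hs p + hs q
    simp only [unitSp, theta_single, mul_add, add_mul, neg_smul, neg_mul, mul_neg, smul_mul_assoc,
      mul_smul_comm, h2, smul_smul]
    have h4 : sgn p * sgn q * (sgn q * sgn p * A (bar q) (bar q)) = A (bar q) (bar q) := by
      linear_combination A (bar q) (bar q) * h3
    rw [smul_add, smul_neg, smul_smul, smul_smul, h4, mul_comm (sgn q) (sgn p)]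
    module
  have h2 : ∀ α : RootOne n i, fv α * A * xv α = (2⁻¹ : ℂ) •
      (unitSp α.snd (Sum.inl α.1.1) * A * unitSp (Sum.inl α.1.1) α.snd) := by
    intro α; rw [fv, xv, smul_mul_assoc, smul_mul_assoc]
  simp only [h2]
  rw [← Finset.smul_sum, sum_rootOne (fun p q => unitSp q p * A * unitSp p q)]
  congr 1
  simp only [h1]
  ext r s
  simp only [Matrix.sum_apply, Matrix.sub_apply, Matrix.add_apply, Matrix.smul_apply,
    eigProj_mul_mul_apply, trace_eigProj_mul, smul_eq_mul]
  have e1 : ∑ p, ∑ q, (if dg i p = 1 ∧ dg i q = 0 then A p p * Matrix.single q q (1 : ℂ) r s else 0)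
      = (∑ p, if dg i p = 1 then A p p else 0) * eigProj n i 0 r s := by
    rw [Finset.sum_mul]
    refine Finset.sum_congr rfl fun p _ => ?_
    rw [Finset.sum_eq_single r]
    · rw [eigProj, Matrix.diagonal_apply, Matrix.single_apply]
      by_cases ha : dg i p = 1 <;> by_cases hb : dg i r = 0 <;> simp [ha, hb]
    · intro b _ hb
      simp [hb]
    · simp
  have e2 : ∑ p, ∑ q, (if dg i p = 1 ∧ dg i q = 0 then
        sgn p * sgn q * A p (bar q) * Matrix.single q (bar p) (1 : ℂ) r s else 0)
      = if dg i r = 0 ∧ dg i s = -1 then theta A r s else 0 := by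
    rw [Finset.sum_eq_single (bar s), Finset.sum_eq_single r]
    · rw [dg_bar, theta_entry]
      have : (-dg i s = 1 ∧ dg i r = 0) ↔ (dg i r = 0 ∧ dg i s = -1) := by omega
      simp only [this]
      split_ifs
      · rcases s with s | s <;> simp [sgn, bar]
      · rfl
    · intro b _ hb; simp [hb]
    · simp
    · intro a _ ha
      refine Finset.sum_eq_zero fun b _ => ?_
      have : bar a ≠ s := by rintro rfl; simp [bar] at ha
      simp [this]
    · simp
  have e3 : ∑ p, ∑ q, (if dg i p = 1 ∧ dg i q = 0 then
        sgn p * sgn q * A (bar q) p * Matrix.single (bar p) q (1 : ℂ) r s else 0)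
      = if dg i r = -1 ∧ dg i s = 0 then theta A r s else 0 := by
    rw [Finset.sum_eq_single (bar r), Finset.sum_eq_single s]
    · rw [dg_bar, theta_entry]
      have : (-dg i r = 1 ∧ dg i s = 0) ↔ (dg i r = -1 ∧ dg i s = 0) := by omega
      simp only [this]
      split_ifs
      · rcases r with r | r <;> simp [sgn, bar]
      · rfl
    · intro b _ hb; simp [hb]
    · simp
    · intro a _ ha
      refine Finset.sum_eq_zero fun b _ => ?_
      have : bar a ≠ r := by rintro rfl; simp [bar] at ha
      simp [this]
    · simp
  have e4 : ∑ p, ∑ q, (if dg i p = 1 ∧ dg i q = 0 then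
        A (bar q) (bar q) * Matrix.single (bar p) (bar p) (1 : ℂ) r s else 0)
      = (∑ p, if dg i p = 0 then A p p else 0) * eigProj n i (-1) r s := by
    rw [Finset.sum_comm, Finset.sum_mul, ← sum_bar]
    refine Finset.sum_congr rfl fun q _ => ?_
    rw [Finset.sum_eq_single (bar r)]
    · rw [eigProj, Matrix.diagonal_apply, Matrix.single_apply, dg_bar, dg_bar]
      have : -dg i r = 1 ↔ dg i r = -1 := by omega
      by_cases ha : dg i q = 0 <;> by_cases hb : dg i r = -1 <;> simp [ha, hb, this, bar]
    · intro b _ hb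
      have : bar b ≠ r := by rintro rfl; simp [bar] at hb
      simp [this]
    · simp
  rw [← e1, ← e2, ← e3, ← e4]
  simp only [← Finset.sum_add_distrib, ← Finset.sum_sub_distrib]
  refine Finset.sum_congr rfl fun p _ => Finset.sum_congr rfl fun q _ => ?_
  split_ifs
  · simp only [Matrix.sub_apply, Matrix.add_apply, Matrix.smul_apply, smul_eq_mul]; ring
  · simp

theorem theta_eigProj (k : ℤ) : theta (eigProj n i k) = -eigProj n i (-k) := by
  ext r s
  rw [theta_entry, eigProj, eigProj, Matrix.neg_apply, Matrix.diagonal_apply, Matrix.diagonal_apply]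
  by_cases h : r = s
  · subst h
    rw [if_pos rfl, if_pos rfl, dg_bar]
    have : -dg i r = k ↔ dg i r = -k := by omega
    rcases r with r | r <;> simp [this, sgn]
  · have : bar s ≠ bar r := by
      intro h'; exact h (by simpa [bar] using (congrArg bar h').symm)
    simp [h, this]

/-- This is the image under `theta` of `sum_fv_mul_mul_xv` taken at `theta A`: products are reversed
and the projections for k and -k are exchanged. -/
theorem sum_xv_mul_mul_fv (A : Mat n) :
    ∑ α : RootOne n i, xv α * A * fv α = (2⁻¹ : ℂ) •
      ((eigProj n i 0 * A).trace • eigProj n i 1 + (eigProj n i (-1) * A).trace • eigProj n i 0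
        - eigProj n i 1 * theta A * eigProj n i 0
        - eigProj n i 0 * theta A * eigProj n i 1) := by
  have h1 := congrArg theta (sum_fv_mul_mul_xv (i := i) (theta A))
  have h2 : ∀ k, (eigProj n i k * theta A).trace = (eigProj n i (-k) * A).trace * (-1) := by
    intro k
    have := trace_theta (theta A * eigProj n i k)
    rw [theta_mul, theta_theta, theta_eigProj, Matrix.trace_neg] at this
    rw [Matrix.trace_mul_comm, ← neg_eq_iff_eq_neg.2 this]
    simp
  simp only [map_sum, theta_mul, theta_theta, theta_xv, theta_fv, map_smul, map_sub, map_add, h2,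
    theta_eigProj, neg_neg, neg_zero] at h1
  rw [Finset.sum_congr rfl fun α _ => (mul_assoc (xv α) A (fv α))]
  convert h1 using 1
  · refine Finset.sum_congr rfl fun α _ => by noncomm_ring
  · congr 1
    simp only [mul_neg, neg_mul, smul_neg, neg_neg, mul_one, mul_assoc, neg_smul]
    rw [add_comm]

end

/-! ### Skew matrices of degree -2 and the constant n - i + 1 -/

/-- The space of matrices `M` of degree `-2` with `theta M = -M`. -/
def antiSub (n i : ℕ) : Submodule ℂ (Mat n) where
  carrier := {M | theta M = -M ∧ IsDeg i (-2) M}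
  zero_mem' := ⟨by simp, IsDeg.zero⟩
  add_mem' := fun ha hb => ⟨by rw [map_add, ha.1, hb.1, neg_add], ha.2.add hb.2⟩
  smul_mem' := fun c _ ha => ⟨by rw [map_smul, ha.1, smul_neg], ha.2.smul c⟩

/-- The anticommutator. -/
def anti {n : ℕ} (A B : Mat n) : Mat n := A * B + B * A

section
variable {n i : ℕ} {M X : Mat n}

theorem theta_anti (hM : theta M = -M) (hX : theta X = X) : theta (anti X M) = anti X M := by
  rw [anti, map_add, theta_mul, theta_mul, hM, hX]; noncomm_ring

theorem isDeg_anti (hM : IsDeg i (-2) M) (hX : IsDeg i 1 X) : IsDeg i (-1) (anti X M) :=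
  (hX.mul hM).add (hM.mul hX)

/-- The origin of the special value. In the expanded double bracket the products of f_α with M have
degree -3 and vanish; the six remaining terms are contractions with ∑ f_α ⊗ x_α. The two that have 1
in the middle give n - i, half the trace 2(n - i) of `eigProj n i 0`. The other four give ½ XM or ½
MX, twice each, which accounts for the additional 1. -/
theorem sum_lie_lie (hin : i ≤ n) (hM : M ∈ antiSub n i) (hX : theta X = X) (hd : IsDeg i 1 X) :
    ∑ α : RootOne n i, ⁅fv α, ⁅anti (xv α) M, X⁆⁆ = ((n : ℂ) - i + 1) • anti X M := by
  obtain ⟨hM1, hM2⟩ := hM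
  have z1 : ∀ α : RootOne n i, fv α * M = 0 := fun α =>
    (isDeg_fv α).mul_eq_zero hM2 (by norm_num)
  have z2 : ∀ α : RootOne n i, M * fv α = 0 := fun α =>
    hM2.mul_eq_zero (isDeg_fv α) (by norm_num)
  have h1 : ∀ α : RootOne n i, ⁅fv α, ⁅anti (xv α) M, X⁆⁆ =
      fv α * 1 * xv α * (M * X) - fv α * X * xv α * M - fv α * (X * M) * xv α
      - xv α * (M * X) * fv α - M * (xv α * X * fv α) + X * M * (xv α * 1 * fv α) := by
    intro α
    have := z1 α
    have h2 := z2 α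
    rw [Ring.lie_def, Ring.lie_def, anti]
    calc _ = fv α * 1 * xv α * (M * X) - fv α * X * xv α * M - fv α * (X * M) * xv α
      - xv α * (M * X) * fv α - M * (xv α * X * fv α) + X * M * (xv α * 1 * fv α)
      + (fv α * M) * xv α * X + X * xv α * (M * fv α) := by noncomm_ring
      _ = _ := by rw [this, h2]; simp
  have hMX : IsDeg i (-1) (M * X) := hM2.mul hd
  have hXM : IsDeg i (-1) (X * M) := hd.mul hM2
  have t1 : ∀ k, (eigProj n i k * X).trace = 0 := fun k =>
    ((isDeg_eigProj k).mul hd).trace_eq_zero (by norm_num)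
  have t2 : ∀ k, (eigProj n i k * (X * M)).trace = 0 := fun k =>
    ((isDeg_eigProj k).mul hXM).trace_eq_zero (by norm_num)
  have t3 : ∀ k, (eigProj n i k * (M * X)).trace = 0 := fun k =>
    ((isDeg_eigProj k).mul hMX).trace_eq_zero (by norm_num)
  have th1 : theta (X * M) = M * X := by rw [theta_mul, hM1, hX]; simp
  have th2 : theta (M * X) = X * M := by rw [theta_mul, hM1, hX]; simp
  -- M consists of a single block, from eigenvalue 1 to eigenvalue -1, so it absorbs one projection
  -- on either side and is killed by the others.
  have p0 : eigProj n i 0 * M = 0 := by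
    rw [hM2.eigProj_mul, eigProj_eq_zero (by norm_num), mul_zero]
  have p1 : eigProj n i 1 * M = 0 := by
    rw [hM2.eigProj_mul, eigProj_eq_zero (by norm_num), mul_zero]
  have pm : eigProj n i (-1) * M = M := by
    have := congrArg (· * M) (eigProj_add (n := n) (i := i))
    simpa [add_mul, p0, p1] using this
  have q1 : M * eigProj n i 1 = M := by
    rw [← pm]; nth_rewrite 1 [pm]
    have := hM2.eigProj_mul (-1)
    norm_num at this; exact this.symm
  have q0 : M * eigProj n i 0 = 0 := by
    rw [← q1, mul_assoc, eigProj_mul_eigProj (by norm_num), mul_zero]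
  have qm : M * eigProj n i (-1) = 0 := by
    rw [← q1, mul_assoc, eigProj_mul_eigProj (by norm_num), mul_zero]
  have x1 : eigProj n i 1 * X = X * eigProj n i 0 := by simpa using hd.eigProj_mul 1
  have x0 : eigProj n i 0 * X = X * eigProj n i (-1) := by simpa using hd.eigProj_mul 0
  have xm : eigProj n i (-1) * X = 0 := by
    rw [hd.eigProj_mul, eigProj_eq_zero (by norm_num), mul_zero]
  have xp : X * eigProj n i 1 = 0 := by
    have := hd.eigProj_mul 2
    rw [eigProj_eq_zero (by norm_num), zero_mul] at this
    norm_num at this; exact this.symm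
  have y1 : M * X * eigProj n i 0 = M * X := by rw [mul_assoc, ← x1, ← mul_assoc, q1]
  have y2 : eigProj n i 0 * (X * M) = X * M := by rw [← mul_assoc, x0, mul_assoc, pm]
  have s1 : eigProj n i 0 * (X * M) * eigProj n i 1 = X * M := by rw [y2, mul_assoc, q1]
  have s2 : eigProj n i 1 * (X * M) * eigProj n i 0 = 0 := by
    rw [mul_assoc, mul_assoc, q0, mul_zero, mul_zero]
  have s3 : eigProj n i 0 * (M * X) * eigProj n i (-1) = 0 := by
    rw [← mul_assoc, p0, zero_mul, zero_mul]
  have s4 : eigProj n i (-1) * (M * X) * eigProj n i 0 = M * X := by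
    rw [← mul_assoc, pm, y1]
  have s5 : eigProj n i 0 * X * eigProj n i (-1) * M = X * M := by rw [mul_assoc, pm, mul_assoc, y2]
  have s6 : M * (eigProj n i 1 * X * eigProj n i 0) = M * X := by
    rw [mul_assoc, ← mul_assoc, q1, ← mul_assoc, y1]
  have c0 : (eigProj n i 0 * 1 : Mat n).trace = 2 * ((n : ℂ) - i) := by
    rw [mul_one, trace_eigProj_one, Nat.cast_sub hin]
  have f1 : (∑ α : RootOne n i, fv α * 1 * xv α) * (M * X) = ((n : ℂ) - i) • (M * X) := by
    rw [sum_fv_mul_mul_xv, c0, theta_one, smul_mul_assoc, sub_mul, sub_mul, add_mul,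
      smul_mul_assoc, smul_mul_assoc, ← mul_assoc (eigProj n i 0) M, p0,
      ← mul_assoc (eigProj n i (-1)) M, pm]
    simp only [mul_neg, mul_one, neg_mul, eigProj_mul_eigProj (n := n) (i := i)
      (show (0 : ℤ) ≠ -1 by norm_num), eigProj_mul_eigProj (n := n) (i := i)
      (show (-1 : ℤ) ≠ 0 by norm_num), zero_mul, smul_zero]
    module
  have f2 : (∑ α : RootOne n i, fv α * X * xv α) * M = -(2⁻¹ : ℂ) • (X * M) := by
    rw [sum_fv_mul_mul_xv, t1, t1, hX, xm, smul_mul_assoc, sub_mul, sub_mul, s5]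
    simp
  have f3 : (∑ α : RootOne n i, fv α * (X * M) * xv α) = -(2⁻¹ : ℂ) • (M * X) := by
    rw [sum_fv_mul_mul_xv, t2, t2, th1, s3, s4]
    simp
  have f4 : (∑ α : RootOne n i, xv α * (M * X) * fv α) = -(2⁻¹ : ℂ) • (X * M) := by
    rw [sum_xv_mul_mul_fv, t3, t3, th2, s1, s2]
    simp
  have f5 : M * (∑ α : RootOne n i, xv α * X * fv α) = -(2⁻¹ : ℂ) • (M * X) := by
    rw [sum_xv_mul_mul_fv, t1, t1, hX, mul_assoc (eigProj n i 0), xp, mul_smul_comm, mul_sub,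
      mul_sub, s6]
    simp
  have f6 : X * M * (∑ α : RootOne n i, xv α * 1 * fv α) = ((n : ℂ) - i) • (X * M) := by
    rw [sum_xv_mul_mul_fv, c0, theta_one, mul_smul_comm, mul_sub, mul_sub, mul_add,
      mul_smul_comm, mul_smul_comm, mul_assoc X M, q1, mul_assoc X M, q0]
    simp only [mul_neg, mul_one, neg_mul, eigProj_mul_eigProj (n := n) (i := i)
      (show (0 : ℤ) ≠ 1 by norm_num), eigProj_mul_eigProj (n := n) (i := i)
      (show (1 : ℤ) ≠ 0 by norm_num), mul_zero, smul_zero]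
    module
  simp only [h1, Finset.sum_add_distrib, Finset.sum_sub_distrib]
  rw [← Finset.sum_mul, ← Finset.sum_mul, ← Finset.mul_sum, ← Finset.mul_sum, f1, f2, f3, f4, f5,
    f6, anti]
  module

end

/-! ### Brackets of root vectors -/

/-- `unitSp` as an element of `𝔰𝔭`. -/
def uSp {n : ℕ} (p q : Fin n ⊕ Fin n) : Sp n := toSp (unitSp p q) (theta_unitSp p q)

theorem coe_uSp {n : ℕ} (p q : Fin n ⊕ Fin n) : (uSp p q : Mat n) = unitSp p q := rfl

theorem sgn_mul_self {n : ℕ} (a : Fin n ⊕ Fin n) : sgn a * sgn a = 1 := by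
  rcases a with a | a <;> simp [sgn]

theorem sgn_bar {n : ℕ} (a : Fin n ⊕ Fin n) : sgn (bar a) = -sgn a := by
  rcases a with a | a <;> simp [sgn]

theorem bar_bar {n : ℕ} (a : Fin n ⊕ Fin n) : bar (bar a) = a := by
  rcases a with a | a <;> simp [bar]

theorem unitSp_bar {n : ℕ} (p q : Fin n ⊕ Fin n) :
    unitSp (bar p) (bar q) = -(sgn p * sgn q) • unitSp q p := by
  have h : (sgn p * sgn q) * (sgn q * sgn p) = 1 := by
    linear_combination sgn q * sgn q * sgn_mul_self p + sgn_mul_self q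
  simp only [unitSp, theta_single, bar_bar, sgn_bar, smul_add, smul_smul, neg_mul_neg, h]
  module

theorem lie_unitSp {n : ℕ} (p q r s : Fin n ⊕ Fin n) :
    unitSp p q * unitSp r s - unitSp r s * unitSp p q =
      (if q = r then unitSp p s else 0) - (if s = p then unitSp r q else 0)
      - (sgn p * sgn q) • ((if bar p = r then unitSp (bar q) s else 0)
        - (if s = bar q then unitSp r (bar p) else 0)) := by
  have h1 : ∀ A B : Mat n, theta A = A → A * (B + theta B) - (B + theta B) * A =
      (A * B - B * A) + theta (A * B - B * A) := by
    intro A B hA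
    rw [map_sub, theta_mul, theta_mul, hA]; noncomm_ring
  have h3 : ∀ a b c d : Fin n ⊕ Fin n, Matrix.single a b (1 : ℂ) * Matrix.single c d 1
        = if b = c then Matrix.single a d 1 else 0 := by
    intro a b c d
    split_ifs with h
    · subst h; simp
    · rw [Matrix.single_mul_single_of_ne _ _ _ _ h]
  have h4 : unitSp p q * Matrix.single r s 1 - Matrix.single r s 1 * unitSp p q =
      (if q = r then Matrix.single p s 1 else 0) - (if s = p then Matrix.single r q 1 else 0)
      - (sgn p * sgn q) • ((if bar p = r then Matrix.single (bar q) s 1 else 0)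
        - (if s = bar q then Matrix.single r (bar p) (1 : ℂ) else 0)) := by
    rw [unitSp, theta_single, add_mul, mul_add, smul_mul_assoc, mul_smul_comm]
    simp only [h3]
    module
  have h2 := h1 (unitSp p q) (Matrix.single r s 1) (theta_unitSp p q)
  rw [h4] at h2
  rw [show unitSp r s = Matrix.single r s 1 + theta (Matrix.single r s 1) from rfl, h2]
  simp only [map_sub, map_smul, apply_ite theta, map_zero, unitSp]
  split_ifs <;> module

theorem lie_uSp_inl_inl {n : ℕ} (p q j k : Fin n) :
    ⁅uSp (Sum.inl q) (Sum.inl p), uSp (Sum.inl j) (Sum.inl k)⁆ =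
      (if p = j then uSp (Sum.inl q) (Sum.inl k) else 0)
        - (if k = q then uSp (Sum.inl j) (Sum.inl p) else 0) := by
  apply Subtype.ext
  rw [coe_lie, coe_uSp, coe_uSp, lie_unitSp]
  simp only [Sum.inl.injEq, bar, Sum.swap_inl, reduceCtorEq, if_false, sub_zero, smul_zero]
  split_ifs <;> rfl

theorem lie_uSp_inl_inr {n : ℕ} (p q a b : Fin n) :
    ⁅uSp (Sum.inl q) (Sum.inl p), uSp (Sum.inl a) (Sum.inr b)⁆ =
      (if p = a then uSp (Sum.inl q) (Sum.inr b) else 0)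
        + (if p = b then uSp (Sum.inl a) (Sum.inr q) else 0) := by
  apply Subtype.ext
  rw [coe_lie, coe_uSp, coe_uSp, lie_unitSp]
  simp only [Sum.inl.injEq, Sum.inr.injEq, bar, Sum.swap_inl, reduceCtorEq, if_false, sub_zero,
    zero_sub, sgn, Sum.elim_inl, mul_one, one_smul, sub_neg_eq_add, eq_comm (a := b)]
  split_ifs <;> rfl

theorem uSp_inl_inr_comm {n : ℕ} (a b : Fin n) :
    uSp (Sum.inl a) (Sum.inr b) = uSp (Sum.inl b) (Sum.inr a) := by
  apply Subtype.ext
  have := unitSp_bar (Sum.inr a) (Sum.inl b)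
  rw [coe_uSp, coe_uSp]
  simpa [bar, sgn] using this

theorem lie_cartan_uSp {n : ℕ} (h : Fin n → ℂ) (p q : Fin n ⊕ Fin n) :
    ⁅cartan h, uSp p q⁆ = (Sum.elim h (-h) p - Sum.elim h (-h) q) • uSp p q := by
  have hc : (cartan h : Mat n) = Matrix.diagonal (Sum.elim h (-h)) := by
    rw [cartan, coe_spBlock]
    ext r s
    rcases r with r | r <;> rcases s with s | s <;>
      simp [Matrix.diagonal_apply]
  have hb : ∀ r : Fin n ⊕ Fin n, Sum.elim h (-h) (bar r) = -Sum.elim h (-h) r := by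
    rintro (r | r) <;> simp [bar]
  apply Subtype.ext
  rw [coe_lie, coe_smul, coe_uSp, hc]
  ext r s
  rw [Matrix.sub_apply, Matrix.diagonal_mul, Matrix.mul_diagonal, Matrix.smul_apply, smul_eq_mul,
    unitSp, theta_single, Matrix.add_apply, Matrix.smul_apply, smul_eq_mul, Matrix.single_apply,
    Matrix.single_apply]
  by_cases h1 : p = r ∧ q = s <;> by_cases h2 : bar q = r ∧ bar p = s
  · rw [if_pos h1, if_pos h2, h1.1, h1.2]; ring
  · rw [if_pos h1, if_neg h2, h1.1, h1.2]; ring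
  · rw [if_neg h1, if_pos h2, ← h2.1, ← h2.2, hb, hb]; ring
  · rw [if_neg h1, if_neg h2]; ring

theorem eq_sum_uSp {n : ℕ} (Z : Sp n) :
    Z = ∑ p, ∑ q, ((2⁻¹ : ℂ) * (Z : Mat n) p q) • uSp p q := by
  have h0 : ∑ p, ∑ q, (Z : Mat n) p q • Matrix.single p q (1 : ℂ) = (Z : Mat n) := by
    simp only [Matrix.smul_single, smul_eq_mul, mul_one]
    exact (Matrix.matrix_eq_sum_single _).symm
  have h1 : ∑ p, ∑ q, ((2⁻¹ : ℂ) * (Z : Mat n) p q) • uSp p q =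
      projSp (∑ p, ∑ q, (Z : Mat n) p q • Matrix.single p q (1 : ℂ)) := by
    simp only [map_sum, map_smul]
    refine Finset.sum_congr rfl fun p _ => Finset.sum_congr rfl fun q _ => ?_
    rw [mul_comm, ← smul_smul]
    rfl
  rw [h1, h0, projSp_coe]

/-! ### Uniqueness of the lowest weight functional -/

section
variable {n i : ℕ}

theorem uSp_mem_gr {d : ℤ} {p q : Fin n ⊕ Fin n} (h : dg i p - dg i q = d) :
    uSp p q ∈ gr n i d := mem_gr.2 (h ▸ isDeg_unitSp p q)

theorem dg_inl_eq (a : Fin n) (h : (a : ℕ) < i) : dg i (Sum.inl a : Fin n ⊕ Fin n) = 1 := by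
  simp [dg, h]

theorem dg_inr_eq (a : Fin n) (h : (a : ℕ) < i) : dg i (Sum.inr a : Fin n ⊕ Fin n) = -1 := by
  simp [dg, h]

/-- A bilinear form on `𝔩 × 𝔷(𝔫)` whose weight is `-(ε_a + ε_b)`, which is killed by the lowering
operators of `𝔤𝔩(i)`, with `a`, `b` the first two indices. -/
structure IsLowest (i : ℕ) (a b : Fin n) (ℓ : Sp n →ₗ[ℂ] Sp n →ₗ[ℂ] ℂ) : Prop where
  weight : ∀ h : Fin n → ℂ, ∀ Z ∈ gr n i 0, ∀ U ∈ gr n i 2,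
    ℓ ⁅cartan h, Z⁆ U + ℓ Z ⁅cartan h, U⁆ = (h a + h b) * ℓ Z U
  lower : ∀ p q : Fin n, p < q → (q : ℕ) < i → ∀ Z ∈ gr n i 0, ∀ U ∈ gr n i 2,
    ℓ ⁅rootDiff q p, Z⁆ U + ℓ Z ⁅rootDiff q p, U⁆ = 0

theorem rootDiff_eq (j k : Fin n) : rootDiff j k = uSp (Sum.inl j) (Sum.inl k) :=
  Subtype.ext (coe_rootDiff j k)

theorem IsLowest.weight_uSp {a b : Fin n} {ℓ : Sp n →ₗ[ℂ] Sp n →ₗ[ℂ] ℂ} (H : IsLowest i a b ℓ)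
    {p q r s : Fin n ⊕ Fin n} (h0 : dg i p = dg i q) (h2 : dg i r = 1) (h3 : dg i s = -1)
    (hne : ℓ (uSp p q) (uSp r s) ≠ 0) (h : Fin n → ℂ) :
    Sum.elim h (-h) p - Sum.elim h (-h) q + Sum.elim h (-h) r - Sum.elim h (-h) s = h a + h b := by
  have := H.weight h (uSp p q) (uSp_mem_gr (by omega)) (uSp r s) (uSp_mem_gr (by omega))
  rw [lie_cartan_uSp, lie_cartan_uSp, map_smul, map_smul, LinearMap.smul_apply, smul_eq_mul,
    smul_eq_mul, ← add_mul] at this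
  have := mul_right_cancel₀ hne this
  linear_combination this

/-- By weight, the only coefficients that can survive are, up to the symmetry in the last two
places, L k k a b, L b a a a, L a b b b, L a k b k and L b k a k. The lowering relations tie each of
them to L a a a b, from which vanishing spreads. For k different from a and b, the relation that
lowers a to b reads 2 L k k a b = 0, whether or not k lies in the first block. -/
theorem lowest_coeff_eq_zero {a b : Fin n} (hab : a < b) (hb : (b : ℕ) < i)
    (hmin : ∀ k : Fin n, k ≠ a → k ≠ b → b < k) {L : Fin n → Fin n → Fin n → Fin n → ℂ}
    (hsym : ∀ j k c d, L j k c d = L j k d c)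
    (hlow : ∀ p q j k c d : Fin n, p < q → (q : ℕ) < i → ((j : ℕ) < i ↔ (k : ℕ) < i) →
      (c : ℕ) < i → (d : ℕ) < i →
      (if p = j then L q k c d else 0) - (if k = q then L j p c d else 0)
        + ((if p = c then L j k q d else 0) + (if p = d then L j k c q else 0)) = 0)
    (hweight : ∀ j k c d : Fin n, ((j : ℕ) < i ↔ (k : ℕ) < i) → (c : ℕ) < i → (d : ℕ) < i →
      L j k c d ≠ 0 → ∀ m : Fin n, ((if m = j then 1 else 0) - (if m = k then 1 else 0)
        + (if m = c then 1 else 0) + (if m = d then 1 else 0) : ℤ)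
        = (if m = a then 1 else 0) + (if m = b then 1 else 0))
    (hzero : L a a a b = 0) (j k c d : Fin n) (hjk : (j : ℕ) < i ↔ (k : ℕ) < i)
    (hc : (c : ℕ) < i) (hd : (d : ℕ) < i) : L j k c d = 0 := by
  have ha : (a : ℕ) < i := lt_trans hab hb
  have hne : a ≠ b := hab.ne
  have l0 : L a a a b = 0 := hzero
  have l0' : L a a b a = 0 := (hsym _ _ _ _).trans l0
  have l1 : L b a a a = 0 := by
    have := hlow a b a a a a hab hb Iff.rfl ha ha
    simpa [hne, l0, l0'] using this
  have l2 : L b b a b = 0 := by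
    have := hlow a b b b a a hab hb Iff.rfl ha ha
    simpa [hne, hne.symm, l1, hsym b b b a] using this
  have l3 : L a b b b = 0 := by
    have := hlow a b a b a b hab hb (by simp [ha, hb]) ha hb
    simpa [hne, l0, l2] using this
  have l4 : ∀ k, k ≠ a → k ≠ b → L k k a b = 0 := by
    intro k hka hkb
    have := hlow a b k k a a hab hb Iff.rfl ha ha
    simpa [hka.symm, hkb, hsym k k b a] using this
  have l5 : ∀ k : Fin n, (k : ℕ) < i → k ≠ a → k ≠ b → L a k b k = 0 := by
    intro k hk hka hkb
    have := hlow b k a k b b (hmin k hka hkb) hk (by simp [ha, hk]) hb hb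
    simpa [hne.symm, l3, hsym a k k b] using this
  have l6 : ∀ k : Fin n, (k : ℕ) < i → k ≠ a → k ≠ b → L b k a k = 0 := by
    intro k hk hka hkb
    have := hlow a k b k a a (hab.trans (hmin k hka hkb)) hk (by simp [hb, hk]) ha ha
    simpa [hne, l1, hsym b k k a] using this
  by_contra hL
  have hw := hweight j k c d hjk hc hd hL
  have wa := hw a
  have wb := hw b
  have wj := hw j
  have wk := hw k
  have wc := hw c
  have wd := hw d
  simp only [if_true, if_neg hne, if_neg hne.symm] at wa wb wj wk wc wd
  -- For a diagonal element of 𝔩 the weight forces {c, d} = {a, b}. Off the diagonal, j must be a or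
  -- b, and k either is the other one of these or is cancelled by c or d.
  by_cases hjk' : j = k
  · subst hjk'
    have hcd : (c = a ∧ d = b) ∨ (c = b ∧ d = a) := by
      by_cases c1 : c = a
      · subst c1
        left; refine ⟨rfl, ?_⟩
        by_contra hd'
        simp only [if_neg hne.symm, if_neg (Ne.symm hd')] at wb
        omega
      · by_cases c2 : c = b
        · subst c2
          right; refine ⟨rfl, ?_⟩
          by_contra hd'
          simp only [if_neg hne, if_neg (Ne.symm hd')] at wa
          omega
        · exfalso
          simp only [if_neg c1, if_neg c2] at wc
          split_ifs at wc <;> omega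
    have hL' : L j j c d = L j j a b := by
      rcases hcd with ⟨rfl, rfl⟩ | ⟨rfl, rfl⟩
      · rfl
      · exact hsym _ _ _ _
    rw [hL'] at hL
    by_cases j1 : j = a
    · subst j1; exact hL l0
    · by_cases j2 : j = b
      · subst j2; exact hL l2
      · exact hL (l4 j j1 j2)
  · simp only [if_neg hjk'] at wj
    have hj : j = a ∨ j = b := by
      by_contra hcon
      push Not at hcon
      simp only [if_neg hcon.1, if_neg hcon.2] at wj
      split_ifs at wj <;> omega
    rcases hj with rfl | rfl
    · have hcj : j ≠ c := by
        rintro rfl; simp only [if_true, if_neg hne] at wj; split_ifs at wj <;> omega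
      have hdj : j ≠ d := by
        rintro rfl; simp only [if_true, if_neg hne] at wj; split_ifs at wj <;> omega
      by_cases kb : k = b
      · subst kb
        have c1 : k = c := by
          by_contra hc'; simp only [if_true, if_neg hc', if_neg hne.symm] at wk
          split_ifs at wk <;> omega
        have d1 : k = d := by
          by_contra hd'; simp only [if_true, if_neg hd', if_neg hne.symm] at wk
          split_ifs at wk <;> omega
        subst c1; subst d1; exact hL l3
      · have kb' := Ne.symm kb
        have kj := Ne.symm hjk'
        simp only [if_neg kb, if_neg kj] at wk
        simp only [if_neg kb', if_neg hne.symm] at wb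
        have : (c = b ∧ d = k) ∨ (c = k ∧ d = b) := by
          by_cases c1 : b = c
          · subst c1
            left; refine ⟨rfl, ?_⟩
            by_contra hd'
            simp only [if_neg (Ne.symm hd'), if_neg kb] at wk
            omega
          · have d1 : b = d := by
              by_contra hd'; simp only [if_neg c1, if_neg hd'] at wb; omega
            subst d1
            right; refine ⟨?_, rfl⟩
            by_contra hc'
            simp only [if_neg (Ne.symm hc'), if_neg kb] at wk
            omega
        rcases this with ⟨rfl, rfl⟩ | ⟨rfl, rfl⟩
        · exact hL (l5 d hd kj kb)
        · exact hL ((hsym _ _ _ _).trans (l5 c hc kj kb))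
    · have hcj : j ≠ c := by
        rintro rfl; simp only [if_true, if_neg hne.symm] at wj; split_ifs at wj <;> omega
      have hdj : j ≠ d := by
        rintro rfl; simp only [if_true, if_neg hne.symm] at wj; split_ifs at wj <;> omega
      by_cases ka : k = a
      · subst ka
        have c1 : k = c := by
          by_contra hc'; simp only [if_true, if_neg hc', if_neg hne] at wk
          split_ifs at wk <;> omega
        have d1 : k = d := by
          by_contra hd'; simp only [if_true, if_neg hd', if_neg hne] at wk
          split_ifs at wk <;> omega
        subst c1; subst d1; exact hL l1
      · have ka' := Ne.symm ka
        have kj := Ne.symm hjk'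
        simp only [if_neg ka, if_neg kj] at wk
        simp only [if_neg ka', if_neg hne] at wa
        have : (c = a ∧ d = k) ∨ (c = k ∧ d = a) := by
          by_cases c1 : a = c
          · subst c1
            left; refine ⟨rfl, ?_⟩
            by_contra hd'
            simp only [if_neg (Ne.symm hd'), if_neg ka] at wk
            omega
          · have d1 : a = d := by
              by_contra hd'; simp only [if_neg c1, if_neg hd'] at wa; omega
            subst d1
            right; refine ⟨?_, rfl⟩
            by_contra hc'
            simp only [if_neg (Ne.symm hc'), if_neg ka] at wk
            omega
        rcases this with ⟨rfl, rfl⟩ | ⟨rfl, rfl⟩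
        · exact hL (l6 d hd ka kj)
        · exact hL ((hsym _ _ _ _).trans (l6 c hc ka kj))

theorem exists_of_dg_eq_one {r : Fin n ⊕ Fin n} (hr : dg i r = 1) :
    ∃ c : Fin n, (c : ℕ) < i ∧ r = Sum.inl c := by
  rcases r with c | c <;> simp only [dg, Sum.elim_inl, Sum.elim_inr] at hr <;>
    split_ifs at hr with h <;> first | omega | skip
  exact ⟨c, h, rfl⟩

theorem exists_of_dg_eq_neg_one {r : Fin n ⊕ Fin n} (hr : dg i r = -1) :
    ∃ c : Fin n, (c : ℕ) < i ∧ r = Sum.inr c := by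
  rcases r with c | c <;> simp only [dg, Sum.elim_inl, Sum.elim_inr] at hr <;>
    split_ifs at hr with h
  exact ⟨c, h, rfl⟩

theorem lt_iff_of_dg_inl_eq {j k : Fin n}
    (h : dg i (Sum.inl j : Fin n ⊕ Fin n) = dg i (Sum.inl k : Fin n ⊕ Fin n)) :
    (j : ℕ) < i ↔ (k : ℕ) < i := by
  simp only [dg, Sum.elim_inl] at h
  split_ifs at h <;> omega

theorem lt_iff_of_dg_inr_eq {j k : Fin n}
    (h : dg i (Sum.inr j : Fin n ⊕ Fin n) = dg i (Sum.inr k : Fin n ⊕ Fin n)) :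
    (j : ℕ) < i ↔ (k : ℕ) < i := by
  simp only [dg, Sum.elim_inr] at h
  split_ifs at h <;> omega

/-- Multiplicity one: such a form is determined by one value. The elements of 𝔩 in the off-diagonal
blocks have weights ±(ε_j + ε_k) with j, k outside the first block, which no weight of 𝔷(𝔫) can
cancel, so only the 𝔤𝔩 part remains and `lowest_coeff_eq_zero` settles it. -/
theorem IsLowest.eq_zero {a b : Fin n} (hab : a < b) (hb : (b : ℕ) < i)
    (hmin : ∀ k : Fin n, k ≠ a → k ≠ b → b < k)
    {ℓ : Sp n →ₗ[ℂ] Sp n →ₗ[ℂ] ℂ} (H : IsLowest i a b ℓ)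
    (hzero : ℓ (uSp (Sum.inl a) (Sum.inl a)) (uSp (Sum.inl a) (Sum.inr b)) = 0)
    {Z U : Sp n} (hZ : Z ∈ gr n i 0) (hU : U ∈ gr n i 2) : ℓ Z U = 0 := by
  have ha : (a : ℕ) < i := lt_trans hab hb
  have hne : a ≠ b := hab.ne
  let L : Fin n → Fin n → Fin n → Fin n → ℂ := fun j k c d =>
    ℓ (uSp (Sum.inl j) (Sum.inl k)) (uSp (Sum.inl c) (Sum.inr d))
  have hsym : ∀ j k c d, L j k c d = L j k d c := fun j k c d => by
    simp only [L]; rw [uSp_inl_inr_comm]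
  have hlow : ∀ p q j k c d : Fin n, p < q → (q : ℕ) < i → ((j : ℕ) < i ↔ (k : ℕ) < i) →
      (c : ℕ) < i → (d : ℕ) < i →
      (if p = j then L q k c d else 0) - (if k = q then L j p c d else 0)
        + ((if p = c then L j k q d else 0) + (if p = d then L j k c q else 0)) = 0 := by
    intro p q j k c d hpq hq hjk hc hd
    have h1 : dg i (Sum.inl j : Fin n ⊕ Fin n) = dg i (Sum.inl k : Fin n ⊕ Fin n) := by
      simp only [dg, Sum.elim_inl, hjk]
    have h2 := H.lower p q hpq hq (uSp (Sum.inl j) (Sum.inl k)) (uSp_mem_gr (by omega))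
      (uSp (Sum.inl c) (Sum.inr d)) (uSp_mem_gr (by rw [dg_inl_eq c hc, dg_inr_eq d hd]; norm_num))
    rw [rootDiff_eq, lie_uSp_inl_inl, lie_uSp_inl_inr, map_add, map_sub, LinearMap.sub_apply] at h2
    have i1 : ∀ (P : Prop) [Decidable P] (x y : Sp n), ℓ (if P then x else 0) y =
        if P then ℓ x y else 0 := by intro P _ x y; split_ifs <;> simp
    have i2 : ∀ (P : Prop) [Decidable P] (x y : Sp n), ℓ x (if P then y else 0) =
        if P then ℓ x y else 0 := by intro P _ x y; split_ifs <;> simp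
    simp only [i1, i2] at h2
    exact h2
  have hweight : ∀ j k c d : Fin n, ((j : ℕ) < i ↔ (k : ℕ) < i) → (c : ℕ) < i → (d : ℕ) < i →
      L j k c d ≠ 0 → ∀ m : Fin n, ((if m = j then 1 else 0) - (if m = k then 1 else 0)
        + (if m = c then 1 else 0) + (if m = d then 1 else 0) : ℤ)
        = (if m = a then 1 else 0) + (if m = b then 1 else 0) := by
    intro j k c d hjk hc hd hL m
    have h1 : dg i (Sum.inl j : Fin n ⊕ Fin n) = dg i (Sum.inl k : Fin n ⊕ Fin n) := by
      simp only [dg, Sum.elim_inl, hjk]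
    have := H.weight_uSp h1 (dg_inl_eq c hc) (dg_inr_eq d hd) hL (fun x => if m = x then 1 else 0)
    simp only [Sum.elim_inl, Sum.elim_inr, Pi.neg_apply, sub_neg_eq_add] at this
    exact_mod_cast this
  have key := lowest_coeff_eq_zero hab hb hmin hsym hlow hweight hzero
  have full : ∀ p q r s : Fin n ⊕ Fin n, dg i p = dg i q → dg i r = 1 → dg i s = -1 →
      ℓ (uSp p q) (uSp r s) = 0 := by
    intro p q r s hpq hr hs
    obtain ⟨c, hc, rfl⟩ := exists_of_dg_eq_one hr
    obtain ⟨d, hd, rfl⟩ := exists_of_dg_eq_neg_one hs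
    have mixed : ∀ j k : Fin n, (p = Sum.inl j ∧ q = Sum.inr k) ∨ (p = Sum.inr j ∧ q = Sum.inl k) →
        ℓ (uSp p q) (uSp (Sum.inl c) (Sum.inr d)) = 0 := by
      intro j k hh
      by_contra hL
      have := H.weight_uSp hpq hr hs hL (fun x => if j = x then 1 else 0)
      have hj : ¬ (j : ℕ) < i := by
        rcases hh with ⟨rfl, rfl⟩ | ⟨rfl, rfl⟩ <;>
          simp only [dg, Sum.elim_inl, Sum.elim_inr] at hpq <;> split_ifs at hpq <;> omega
      have ja : j ≠ a := by rintro rfl; exact hj ha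
      have jb : j ≠ b := by rintro rfl; exact hj hb
      have jc : j ≠ c := by rintro rfl; exact hj hc
      have jd : j ≠ d := by rintro rfl; exact hj hd
      rcases hh with ⟨rfl, rfl⟩ | ⟨rfl, rfl⟩ <;>
        simp only [Sum.elim_inl, Sum.elim_inr, Pi.neg_apply, if_true, if_neg ja, if_neg jb,
          if_neg jc, if_neg jd] at this <;> split_ifs at this <;> norm_num at this
    rcases p with j | j <;> rcases q with k | k
    · exact key j k c d (lt_iff_of_dg_inl_eq hpq) hc hd
    · exact mixed j k (Or.inl ⟨rfl, rfl⟩)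
    · exact mixed j k (Or.inr ⟨rfl, rfl⟩)
    · have e : uSp (Sum.inr j) (Sum.inr k) = -uSp (Sum.inl k) (Sum.inl j) := by
        apply Subtype.ext
        have := unitSp_bar (Sum.inl j) (Sum.inl k)
        simp only [bar, Sum.swap_inl, sgn, Sum.elim_inl, mul_one, neg_smul, one_smul] at this
        exact this
      rw [e, map_neg, LinearMap.neg_apply, neg_eq_zero]
      exact key k j c d (lt_iff_of_dg_inr_eq hpq).symm hc hd
  rw [eq_sum_uSp Z, eq_sum_uSp U]
  simp only [map_sum, LinearMap.sum_apply, map_smul, LinearMap.smul_apply]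
  refine Finset.sum_eq_zero fun r _ => Finset.sum_eq_zero fun s _ => ?_
  rw [smul_eq_mul, mul_eq_zero, or_iff_not_imp_left]
  intro hrs
  have h4 := mem_gr.1 hU r s (right_ne_zero_of_mul hrs)
  refine Finset.sum_eq_zero fun p _ => Finset.sum_eq_zero fun q _ => ?_
  rw [smul_eq_mul, mul_eq_zero, or_iff_not_imp_left]
  intro hpq
  have h5 := mem_gr.1 hZ p q (right_ne_zero_of_mul hpq)
  have h6 := dg_mem i r
  have h7 := dg_mem i s
  exact full p q r s (by omega) (by omega) (by omega)

end

/-! ### The anticommutator as an equivariant contraction -/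

/-- The contraction `Z ⊗ U ↦ ZU + UZ`. -/
def contr (n : ℕ) : Sp n ⊗[ℂ] Sp n →ₗ[ℂ] Mat n :=
  TensorProduct.lift (LinearMap.mk₂ ℂ (fun Z U : Sp n => anti (Z : Mat n) U)
    (fun a b c => by simp only [anti, coe_add]; noncomm_ring)
    (fun t a c => by simp only [anti, coe_smul]; rw [smul_add]; simp)
    (fun a b c => by simp only [anti, coe_add]; noncomm_ring)
    (fun t a c => by simp only [anti, coe_smul]; rw [smul_add]; simp))

theorem contr_tmul {n : ℕ} (Z U : Sp n) : contr n (Z ⊗ₜ U) = anti (Z : Mat n) U := rfl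

theorem pairing_tmul {n : ℕ} (a b c d : Sp n) :
    pairing n (a ⊗ₜ b) (c ⊗ₜ d) = kappa n b d * kappa n a c := by
  simp [pairing]

theorem lie_tmul {n : ℕ} (x a b : Sp n) : ⁅x, a ⊗ₜ[ℂ] b⁆ = ⁅x, a⁆ ⊗ₜ b + a ⊗ₜ ⁅x, b⁆ :=
  TensorProduct.LieModule.lie_tmul_right x a b

theorem contr_lie {n : ℕ} (X : Sp n) (t : Sp n ⊗[ℂ] Sp n) :
    contr n ⁅X, t⁆ = (X : Mat n) * contr n t - contr n t * X := by
  induction t using TensorProduct.induction_on with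
  | zero => simp
  | tmul a b =>
    rw [lie_tmul, map_add, contr_tmul, contr_tmul, contr_tmul, coe_lie, coe_lie]
    simp only [anti]; noncomm_ring
  | add x y hx hy => rw [lie_add, map_add, hx, hy, map_add]; noncomm_ring

theorem kappa_lie {n : ℕ} (X a c : Sp n) : kappa n ⁅X, a⁆ c = -kappa n a ⁅X, c⁆ := by
  rw [kappa_eq, kappa_eq, coe_lie, coe_lie, sub_mul, mul_sub, Matrix.trace_sub, Matrix.trace_sub,
    mul_assoc (X : Mat n), Matrix.trace_mul_comm (X : Mat n), mul_assoc, mul_assoc]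
  ring

theorem pairing_lie {n : ℕ} (X : Sp n) (y t : Sp n ⊗[ℂ] Sp n) :
    pairing n ⁅X, y⁆ t = -pairing n y ⁅X, t⁆ := by
  induction y using TensorProduct.induction_on with
  | zero => simp
  | tmul a b =>
    induction t using TensorProduct.induction_on with
    | zero => simp
    | tmul c d =>
      rw [lie_tmul, lie_tmul, map_add, LinearMap.add_apply, map_add, pairing_tmul, pairing_tmul,
        pairing_tmul, pairing_tmul, kappa_lie, kappa_lie]
      ring
    | add x y hx hy => rw [lie_add, map_add, hx, hy, map_add]; ring
  | add x y hx hy =>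
    rw [lie_add, map_add, LinearMap.add_apply, hx, hy, map_add, LinearMap.add_apply]; ring

theorem theta_contr {n : ℕ} (t : Sp n ⊗[ℂ] Sp n) : theta (contr n t) = -contr n t := by
  induction t using TensorProduct.induction_on with
  | zero => simp
  | tmul a b =>
    rw [contr_tmul, anti, map_add, theta_mul, theta_mul, theta_coe, theta_coe]; abel
  | add x y hx hy => rw [map_add, map_add, hx, hy]; abel

theorem contr_mem_antiSub {n i : ℕ} {t : Sp n ⊗[ℂ] Sp n} (ht : t ∈ grTensor n i 0 (-2)) :
    contr n t ∈ antiSub n i := by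
  have : grTensor n i 0 (-2) ≤ (antiSub n i).comap (contr n) := by
    refine Submodule.map₂_le.2 fun a ha b hb => ?_
    refine ⟨theta_contr _, ?_⟩
    have h1 := (mem_gr.1 ha).mul (mem_gr.1 hb)
    have h2 := (mem_gr.1 hb).mul (mem_gr.1 ha)
    exact h1.add h2
  exact this ht

/-! ### Transposition -/

/-- Transposition on `𝔰𝔭`. -/
def trSp {n : ℕ} : Sp n →ₗ[ℂ] Sp n where
  toFun Z := toSp (Z : Mat n).transpose (by
    have h := congrArg Matrix.transpose (theta_coe Z)
    rw [theta_apply] at h ⊢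
    simpa [mul_assoc] using h)
  map_add' _ _ := rfl
  map_smul' _ _ := rfl

theorem coe_trSp {n : ℕ} (Z : Sp n) : (trSp Z : Mat n) = (Z : Mat n).transpose := rfl

theorem trSp_trSp {n : ℕ} (Z : Sp n) : trSp (trSp Z) = Z := rfl

/-- Up to sign, transposition is an automorphism that fixes 𝔥 pointwise, exchanges 𝔤(d) with 𝔤(-d)
and raising with lowering operators. It serves to turn a highest weight vector of W into a form on 𝔩
× 𝔷(𝔫) satisfying `IsLowest`. -/
theorem trSp_lie {n : ℕ} (X Z : Sp n) : trSp ⁅X, Z⁆ = -⁅trSp X, trSp Z⁆ := by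
  apply Subtype.ext
  change (X * Z - Z * X : Mat n).transpose =
    -((X : Mat n).transpose * (Z : Mat n).transpose - (Z : Mat n).transpose * (X : Mat n).transpose)
  simp

theorem trSp_cartan {n : ℕ} (h : Fin n → ℂ) : trSp (cartan h) = cartan h := by
  apply Subtype.ext
  rw [coe_trSp, cartan, coe_spBlock, Matrix.fromBlocks_transpose]
  simp

theorem trSp_rootDiff {n : ℕ} (j k : Fin n) : trSp (rootDiff j k) = rootDiff k j := by
  apply Subtype.ext
  rw [coe_trSp, rootDiff, rootDiff, coe_spBlock, coe_spBlock, Matrix.fromBlocks_transpose]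
  simp

theorem trSp_mem_gr {n i : ℕ} {d e : ℤ} {Z : Sp n} (hZ : Z ∈ gr n i d) (h : e = -d) :
    trSp Z ∈ gr n i e := by
  rw [mem_gr] at hZ ⊢
  intro p q hpq
  have := hZ q p hpq
  omega

theorem anti_transpose {n : ℕ} (A B : Mat n) :
    anti A.transpose B.transpose = (anti A B).transpose := by
  simp [anti, add_comm]

/-! ### The dual of the special constituent -/

section
variable {n i : ℕ}

/-- The matrix unit entry of the contraction, as a bilinear form. -/
def contrEntry (p q : Fin n ⊕ Fin n) : Sp n →ₗ[ℂ] Sp n →ₗ[ℂ] ℂ :=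
  (TensorProduct.mk ℂ (Sp n) (Sp n)).compr₂
    ((LinearMap.proj q ∘ₗ LinearMap.proj (φ := fun _ => Fin n ⊕ Fin n → ℂ) p) ∘ₗ
      (Matrix.ofLinearEquiv ℂ).symm.toLinearMap ∘ₗ contr n)

theorem contrEntry_apply (p q : Fin n ⊕ Fin n) (Z U : Sp n) :
    contrEntry p q Z U = contr n (Z ⊗ₜ U) p q := rfl

theorem contrEntry_lie (p q : Fin n ⊕ Fin n) (X Z U : Sp n) :
    contrEntry p q ⁅X, Z⁆ U + contrEntry p q Z ⁅X, U⁆ =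
      ((X : Mat n) * contr n (Z ⊗ₜ U) - contr n (Z ⊗ₜ U) * X) p q := by
  rw [contrEntry_apply, contrEntry_apply, ← contr_lie, lie_tmul, map_add, Matrix.add_apply]

theorem coe_cartan (h : Fin n → ℂ) : (cartan h : Mat n) = Matrix.diagonal (Sum.elim h (-h)) := by
  rw [cartan, coe_spBlock]
  ext r s
  rcases r with r | r <;> rcases s with s | s <;>
    simp [Matrix.diagonal_apply]

/-- Since a and b are the first two indices, a lowering operator can reach the entry (a, b̄) only
for p = a and q = b. It then brings in the entry (a, ā), which vanishes because the contraction is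
anti-invariant under `theta`. -/
theorem isLowest_contrEntry {a b : Fin n} (hab : a < b)
    (hmin : ∀ k : Fin n, k ≠ a → k ≠ b → b < k) :
    IsLowest i a b (contrEntry (n := n) (Sum.inl a) (Sum.inr b)) where
  weight h Z _ U _ := by
    rw [contrEntry_lie, coe_cartan, Matrix.sub_apply, Matrix.diagonal_mul, Matrix.mul_diagonal,
      contrEntry_apply]
    simp only [Sum.elim_inl, Sum.elim_inr, Pi.neg_apply]
    ring
  lower p q hpq _ Z _ U _ := by
    have hC := theta_contr (Z ⊗ₜ[ℂ] U)
    rw [contrEntry_lie, coe_rootDiff, unitSp, theta_single, Matrix.sub_apply]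
    have hqa : q ≠ a := by
      rintro rfl
      have := hmin p hpq.ne (hpq.trans hab).ne
      exact absurd (hpq.trans hab) this.asymm
    have h1 : ((Matrix.single (Sum.inl q) (Sum.inl p) 1 + -(sgn (Sum.inl q) * sgn (Sum.inl p)) •
        Matrix.single (bar (Sum.inl p)) (bar (Sum.inl q)) (1 : ℂ)) * contr n (Z ⊗ₜ U) : Mat n)
        (Sum.inl a) (Sum.inr b) = 0 := by
      rw [Matrix.mul_apply]
      refine Finset.sum_eq_zero fun r _ => ?_
      simp [hqa, bar]
    have h2 : (contr n (Z ⊗ₜ U) * (Matrix.single (Sum.inl q) (Sum.inl p) 1 +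
        -(sgn (Sum.inl q) * sgn (Sum.inl p)) •
        Matrix.single (bar (Sum.inl p)) (bar (Sum.inl q)) (1 : ℂ)) : Mat n)
        (Sum.inl a) (Sum.inr b) = 0 := by
      rw [Matrix.mul_apply]
      refine Finset.sum_eq_zero fun r _ => ?_
      by_cases hqb : q = b
      · subst hqb
        have hpa : p = a := by
          by_contra hpa
          exact absurd hpq (hmin p hpa hpq.ne).asymm
        subst hpa
        by_cases hr : r = Sum.inr p
        · subst hr
          have := congrFun (congrFun hC (Sum.inl p)) (Sum.inr p)
          rw [theta_entry, Matrix.neg_apply] at this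
          simp only [sgn, Sum.elim_inl, Sum.elim_inr, bar, Sum.swap_inl, Sum.swap_inr] at this
          have : contr n (Z ⊗ₜ U) (Sum.inl p) (Sum.inr p) = 0 := by linear_combination this / 2
          rw [this, zero_mul]
        · simp [bar, Ne.symm hr]
      · simp [bar, hqb]
    rw [h1, h2, sub_zero]

theorem IsLowest.sub_smul {a b : Fin n} {ℓ ℓ' : Sp n →ₗ[ℂ] Sp n →ₗ[ℂ] ℂ} (H : IsLowest i a b ℓ)
    (H' : IsLowest i a b ℓ') (c : ℂ) : IsLowest i a b (ℓ - c • ℓ') where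
  weight h Z hZ U hU := by
    simp only [LinearMap.sub_apply, LinearMap.smul_apply, smul_eq_mul]
    linear_combination H.weight h Z hZ U hU - c * H'.weight h Z hZ U hU
  lower p q hpq hq Z hZ U hU := by
    simp only [LinearMap.sub_apply, LinearMap.smul_apply, smul_eq_mul]
    linear_combination H.lower p q hpq hq Z hZ U hU - c * H'.lower p q hpq hq Z hZ U hU

/-- The entry form takes the value 1 at the test pair, so a suitable multiple of it can be
subtracted to make `IsLowest.eq_zero` applicable. -/
theorem IsLowest.exists_eq {a b : Fin n} (hab : a < b) (hb : (b : ℕ) < i)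
    (hmin : ∀ k : Fin n, k ≠ a → k ≠ b → b < k)
    {ℓ : Sp n →ₗ[ℂ] Sp n →ₗ[ℂ] ℂ} (H : IsLowest i a b ℓ) :
    ∃ c : ℂ, ∀ Z ∈ gr n i 0, ∀ U ∈ gr n i 2,
      ℓ Z U = c * anti (Z : Mat n) U (Sum.inl a) (Sum.inr b) := by
  have h0 : contrEntry (n := n) (Sum.inl a) (Sum.inr b) (uSp (Sum.inl a) (Sum.inl a))
      (uSp (Sum.inl a) (Sum.inr b)) = 1 := by
    rw [contrEntry_apply, contr_tmul, coe_uSp, coe_uSp, anti, unitSp, unitSp, theta_single,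
      theta_single]
    simp [bar, sgn, add_mul, mul_add, Matrix.single_mul_single_of_ne, hab.ne, hab.ne']
  refine ⟨ℓ (uSp (Sum.inl a) (Sum.inl a)) (uSp (Sum.inl a) (Sum.inr b)), fun Z hZ U hU => ?_⟩
  have h1 := (H.sub_smul (isLowest_contrEntry hab hmin)
    (ℓ (uSp (Sum.inl a) (Sum.inl a)) (uSp (Sum.inl a) (Sum.inr b)))).eq_zero hab hb hmin
    (by simp [h0]) hZ hU
  rw [LinearMap.sub_apply, LinearMap.sub_apply, LinearMap.smul_apply, LinearMap.smul_apply,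
    sub_eq_zero, contrEntry_apply, contr_tmul, smul_eq_mul] at h1
  exact h1

/-! ### Irreducibility of the space of antisymmetric matrices -/

/-- The antisymmetric matrix unit of degree `-2`. -/
def antiUnit (b a : Fin n) : Mat n :=
  Matrix.single (Sum.inr b) (Sum.inl a) 1 - Matrix.single (Sum.inr a) (Sum.inl b) 1

theorem antiUnit_swap (a b : Fin n) : antiUnit b a = -antiUnit a b := by
  rw [antiUnit, antiUnit, neg_sub]

theorem antiUnit_self (a : Fin n) : antiUnit a a = 0 := sub_self _

theorem lie_antiUnit (p q a b : Fin n) :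
    unitSp (Sum.inl p) (Sum.inl q) * antiUnit b a - antiUnit b a * unitSp (Sum.inl p) (Sum.inl q) =
      -(if p = b then antiUnit q a else 0) - (if p = a then antiUnit b q else 0) := by
  have h3 : ∀ a b c d : Fin n ⊕ Fin n, Matrix.single a b (1 : ℂ) * Matrix.single c d 1
        = if b = c then Matrix.single a d 1 else 0 := by
    intro a b c d
    split_ifs with h
    · subst h; simp
    · rw [Matrix.single_mul_single_of_ne _ _ _ _ h]
  rw [unitSp, theta_single, antiUnit, add_mul, mul_add]
  simp only [mul_sub, sub_mul, smul_mul_assoc, mul_smul_comm, h3, bar, Sum.swap_inl, reduceCtorEq,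
    if_false, Sum.inr.injEq, Sum.inl.injEq, sgn, Sum.elim_inl, mul_one, antiUnit,
    eq_comm (a := b) (b := p), eq_comm (a := a) (b := p)]
  split_ifs <;> module

theorem antiUnit_mem {a b : Fin n} (ha : (a : ℕ) < i) (hb : (b : ℕ) < i) :
    antiUnit b a ∈ antiSub n i := by
  constructor
  · rw [antiUnit, map_sub, theta_single, theta_single]
    simp [bar, sgn]
  · have h1 := isDeg_single (i := i) (Sum.inr b : Fin n ⊕ Fin n) (Sum.inl a) 1
    have h2 := isDeg_single (i := i) (Sum.inr a : Fin n ⊕ Fin n) (Sum.inl b) 1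
    rw [dg_inl_eq _ ha, dg_inr_eq _ hb] at h1
    rw [dg_inl_eq _ hb, dg_inr_eq _ ha] at h2
    exact h1.sub h2

theorem antiSub_entry {M : Mat n} (hM : M ∈ antiSub n i) (a b : Fin n) :
    M (Sum.inr a) (Sum.inl b) = -M (Sum.inr b) (Sum.inl a) := by
  have := congrFun (congrFun hM.1 (Sum.inr a)) (Sum.inl b)
  rw [theta_entry, Matrix.neg_apply] at this
  simp only [sgn, Sum.elim_inl, Sum.elim_inr, bar, Sum.swap_inl, Sum.swap_inr] at this
  linear_combination this

theorem exists_of_dg_sub {r s : Fin n ⊕ Fin n} (h : dg i r - dg i s = -2) :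
    ∃ b a : Fin n, (b : ℕ) < i ∧ (a : ℕ) < i ∧ r = Sum.inr b ∧ s = Sum.inl a := by
  have h1 := dg_mem i r
  have h2 := dg_mem i s
  obtain ⟨b, hb, rfl⟩ := exists_of_dg_eq_neg_one (show dg i r = -1 by omega)
  obtain ⟨a, ha, rfl⟩ := exists_of_dg_eq_one (show dg i s = 1 by omega)
  exact ⟨b, a, hb, ha, rfl, rfl⟩

theorem eq_sum_antiUnit {M : Mat n} (hM : M ∈ antiSub n i) :
    M = ∑ b, ∑ a, ((2⁻¹ : ℂ) * M (Sum.inr b) (Sum.inl a)) • antiUnit b a := by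
  ext r s
  simp only [Matrix.sum_apply, Matrix.smul_apply, antiUnit, Matrix.sub_apply, smul_eq_mul, mul_sub,
    Finset.sum_sub_distrib]
  by_cases h : M r s = 0
  · rw [h]
    rcases r with b | b <;> rcases s with a | a <;>
      simp [Matrix.single_apply, ite_and]
    rw [h, antiSub_entry hM, h]; simp
  · obtain ⟨b, a, hb, ha, rfl, rfl⟩ := exists_of_dg_sub (hM.2 r s h)
    simp [Matrix.single_apply, ite_and]
    rw [antiSub_entry hM a b]; ring

/-- Irreducibility under 𝔤𝔩(i). If the entry (b̄, a) of M is nonzero, the diagonal generators of a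
and b, applied in turn, retain only that entry and its mirror image, so `antiUnit b a` lies in N.
Root vectors then replace its indices one at a time. -/
theorem antiSub_le {N : Submodule ℂ (Mat n)} (hN : N ≤ antiSub n i) (hne : N ≠ ⊥)
    (hstab : ∀ p q : Fin n, (p : ℕ) < i → (q : ℕ) < i → ∀ M ∈ N,
      unitSp (Sum.inl p) (Sum.inl q) * M - M * unitSp (Sum.inl p) (Sum.inl q) ∈ N) :
    antiSub n i ≤ N := by
  obtain ⟨M, hMN, hM0⟩ := Submodule.exists_mem_ne_zero_of_ne_bot hne
  have hM := hN hMN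
  obtain ⟨r, s, hrs⟩ : ∃ r s, M r s ≠ 0 := by
    by_contra hcon
    push Not at hcon
    exact hM0 (by ext r s; exact hcon r s)
  obtain ⟨b, a, hb, ha, rfl, rfl⟩ := exists_of_dg_sub (hM.2 r s hrs)
  have hab : a ≠ b := by
    rintro rfl
    have := antiSub_entry hM a a
    exact hrs (by linear_combination this / 2)
  have hdiag : ∀ c : Fin n, ∀ M' ∈ antiSub n i, ∀ r s : Fin n,
      (unitSp (Sum.inl c) (Sum.inl c) * M' - M' * unitSp (Sum.inl c) (Sum.inl c))
        (Sum.inr r) (Sum.inl s) =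
      -((if c = r then 1 else 0) + (if c = s then 1 else 0)) * M' (Sum.inr r) (Sum.inl s) := by
    intro c M' _ r s
    have hd : unitSp (Sum.inl c) (Sum.inl c) =
        Matrix.diagonal (Sum.elim (Pi.single c (1 : ℂ)) (-Pi.single c 1)) := by
      rw [unitSp, theta_single]
      ext x y
      rcases x with x | x <;> rcases y with y | y <;>
        simp [Matrix.diagonal_apply, Matrix.single_apply, sgn, bar, Pi.single_apply]
      · by_cases h1 : c = x <;> by_cases h2 : x = y <;> simp_all [eq_comm]
      · by_cases h1 : c = x <;> by_cases h2 : x = y <;> simp_all [eq_comm]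
    rw [hd, Matrix.sub_apply, Matrix.diagonal_mul, Matrix.mul_diagonal]
    simp only [Sum.elim_inl, Sum.elim_inr, Pi.neg_apply, Pi.single_apply, eq_comm (b := c)]
    ring
  have hba : antiUnit b a ∈ N := by
    have h1 := hstab a a ha ha M hMN
    have h2 := hstab b b hb hb _ h1
    have h3 : unitSp (Sum.inl b) (Sum.inl b) * (unitSp (Sum.inl a) (Sum.inl a) * M - M *
        unitSp (Sum.inl a) (Sum.inl a)) - (unitSp (Sum.inl a) (Sum.inl a) * M - M *
        unitSp (Sum.inl a) (Sum.inl a)) * unitSp (Sum.inl b) (Sum.inl b)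
        = M (Sum.inr b) (Sum.inl a) • antiUnit b a := by
      rw [eq_sum_antiUnit (hN h2)]
      simp only [hdiag b _ (hN h1), hdiag a _ hM]
      rw [← Finset.sum_product', Finset.sum_eq_add (b, a) (a, b) (by simp [hab.symm])]
      · rw [antiUnit_swap b a, antiSub_entry hM a b]
        simp [hab, hab.symm]
        module
      · rintro ⟨x, y⟩ - ⟨h4, h5⟩
        by_cases hx : b = x
        · subst hx
          by_cases hy : a = y
          · subst hy; simp at h4
          · by_cases hz : b = y
            · subst hz; rw [antiUnit_self, smul_zero]
            · simp [hab, hy]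
        · by_cases hy : b = y
          · subst hy
            by_cases hz : a = x
            · subst hz; simp at h5
            · simp [hab, hz]
          · simp [hx, hy]
      · simp
      · simp
    rw [h3] at h2
    have := N.smul_mem (M (Sum.inr b) (Sum.inl a))⁻¹ h2
    rwa [smul_smul, inv_mul_cancel₀ hrs, one_smul] at this
  have hstep : ∀ a b c : Fin n, (a : ℕ) < i → (c : ℕ) < i → a ≠ b →
      antiUnit b a ∈ N → antiUnit b c ∈ N := by
    intro a b c ha hc hab h
    have := hstab a c ha hc _ h
    rw [lie_antiUnit, if_neg hab, if_pos rfl, neg_zero, zero_sub] at this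
    exact (N.neg_mem_iff).1 this
  have hall : ∀ c d : Fin n, (c : ℕ) < i → (d : ℕ) < i → antiUnit c d ∈ N := by
    intro c d hc hd
    have h1 : antiUnit b c ∈ N := hstep a b c ha hc hab hba
    by_cases hcb : c = b
    · subst hcb; exact hstep a c d ha hd hab hba
    · have h2 : antiUnit c b ∈ N := by rw [antiUnit_swap]; exact N.neg_mem h1
      exact hstep b c d hb hd (Ne.symm hcb) h2
  intro M' hM'
  rw [eq_sum_antiUnit hM']
  refine N.sum_mem fun c _ => N.sum_mem fun d _ => ?_
  by_cases h : M' (Sum.inr c) (Sum.inl d) = 0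
  · rw [h, mul_zero, zero_smul]; exact N.zero_mem
  · obtain ⟨c', d', hc, hd, e1, e2⟩ := exists_of_dg_sub (hM'.2 _ _ h)
    rw [Sum.inr.inj e1, Sum.inl.inj e2]
    exact N.smul_mem _ (hall c' d' hc hd)

end

/-! ### The constituent W, its Killing dual, and the trace formula for the pairing -/

section
variable {n i : ℕ}

theorem mem_levi {Z : Sp n} : Z ∈ levi n i ↔ Z ∈ gr n i 0 := Iff.rfl

theorem cartan_mem_levi (h : Fin n → ℂ) : cartan h ∈ levi n i := by
  rw [mem_levi, mem_gr, coe_cartan]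
  intro p q hpq
  have : p = q := by by_contra h'; exact hpq (Matrix.diagonal_apply_ne _ h')
  rw [this, sub_self]

theorem rootDiff_mem_levi {p q : Fin n} (hp : (p : ℕ) < i) (hq : (q : ℕ) < i) :
    rootDiff p q ∈ levi n i := by
  rw [mem_levi, rootDiff_eq]
  exact uSp_mem_gr (by rw [dg_inl_eq p hp, dg_inl_eq q hq]; norm_num)

theorem lie_mem_of_mem_levi {W : LieSubmodule ℂ (levi n i) (Sp n ⊗[ℂ] Sp n)} {X : Sp n}
    (hX : X ∈ levi n i) {t : Sp n ⊗[ℂ] Sp n} (ht : t ∈ W) : ⁅X, t⁆ ∈ W :=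
  W.lie_mem (x := (⟨X, hX⟩ : levi n i)) ht

theorem lie_mem_grTensor {d e : ℤ} {X : Sp n} (hX : X ∈ levi n i) {t : Sp n ⊗[ℂ] Sp n}
    (ht : t ∈ grTensor n i d e) : ⁅X, t⁆ ∈ grTensor n i d e := by
  have hX' := mem_gr.1 (mem_levi.1 hX)
  have : grTensor n i d e ≤ (grTensor n i d e).comap
      (LieModule.toEnd ℂ (Sp n) (Sp n ⊗[ℂ] Sp n) X : Module.End ℂ (Sp n ⊗[ℂ] Sp n)) := by
    refine Submodule.map₂_le.2 fun a ha b hb => ?_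
    rw [Submodule.mem_comap, LieModule.toEnd_apply_apply, TensorProduct.mk_apply, lie_tmul]
    refine Submodule.add_mem _ (Submodule.apply_mem_map₂ _ ?_ hb)
      (Submodule.apply_mem_map₂ _ ha ?_)
    · rw [mem_gr, coe_lie]
      exact zero_add d ▸ hX'.lie (mem_gr.1 ha)
    · rw [mem_gr, coe_lie]
      exact zero_add e ▸ hX'.lie (mem_gr.1 hb)
  exact this ht

/-- Once the contraction is known to be injective on W', eigenvector equations there can be checked
on matrices. -/
theorem lie_zero_of_contr {W' : LieSubmodule ℂ (levi n i) (Sp n ⊗[ℂ] Sp n)}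
    (hinj : ∀ y ∈ W', contr n y = 0 → y = 0) {y : Sp n ⊗[ℂ] Sp n} (hy : y ∈ W') {X : Sp n}
    (hX : X ∈ levi n i) {c : ℂ} (h : (X : Mat n) * contr n y - contr n y * X = c • contr n y) :
    ⁅X, y⁆ = c • y := by
  rw [← sub_eq_zero]
  refine hinj _ (W'.sub_mem (lie_mem_of_mem_levi hX hy) (W'.smul_mem c hy)) ?_
  rw [map_sub, contr_lie, map_smul, h, sub_self]

/-- For the highest weight vector v, the functional y ↦ ⟨y, v⟩ composed with transposition satisfies
`IsLowest`, hence is a multiple of one entry of the contraction. The vectors whose pairing factors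
through the contraction form an 𝔩-submodule containing v; by irreducibility it contains W. -/
theorem IsConstituent.exists_pairing_eq (hi : 2 ≤ i) (hin : i < n)
    {W : LieSubmodule ℂ (levi n i) (Sp n ⊗[ℂ] Sp n)}
    (hW : IsConstituent n i ((eps n 1 + eps n (i + 1)) + (eps n 2 - eps n (i + 1))) W)
    {w : Sp n ⊗[ℂ] Sp n} (hw : w ∈ W) :
    ∃ M : Mat n, ∀ y ∈ grTensor n i 0 (-2), pairing n y w = (M * contr n y).trace := by
  obtain ⟨v, hvW, hv⟩ := hW.highest
  let a : Fin n := ⟨0, by omega⟩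
  let b : Fin n := ⟨1, by omega⟩
  have hab : a < b := by simp [a, b, Fin.lt_def]
  have hb : (b : ℕ) < i := by simp only [b]; omega
  have hmin : ∀ k : Fin n, k ≠ a → k ≠ b → b < k := by
    intro k hka hkb
    simp only [a, b, ne_eq, Fin.ext_iff, Fin.lt_def] at *
    omega
  -- The two occurrences of ε_{i+1} cancel, and the highest weight is ε_1 + ε_2.
  have hsum : ∀ h : Fin n → ℂ,
      (∑ j, ((eps n 1 + eps n (i + 1)) + (eps n 2 - eps n (i + 1))) j * h j) = h a + h b := by
    intro h
    have e1 : ∀ j : Fin n, ((eps n 1 + eps n (i + 1)) + (eps n 2 - eps n (i + 1))) j * h j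
        = (if a = j then h j else 0) + (if b = j then h j else 0) := by
      intro j
      have c1 : ((j : ℕ) + 1 = 1) ↔ a = j := by simp only [a, Fin.ext_iff]; omega
      have c2 : ((j : ℕ) + 1 = 2) ↔ b = j := by simp only [b, Fin.ext_iff]; omega
      simp only [eps, Pi.add_apply, Pi.sub_apply, c1, c2]
      split_ifs <;> ring
    simp only [e1, Finset.sum_add_distrib]
    simp
  let ℓ : Sp n →ₗ[ℂ] Sp n →ₗ[ℂ] ℂ :=
    ((TensorProduct.mk ℂ (Sp n) (Sp n)).compl₁₂ trSp trSp).compr₂ ((pairing n).flip v)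
  have hℓ : ∀ Z U, ℓ Z U = pairing n (trSp Z ⊗ₜ trSp U) v := fun Z U => rfl
  have hlie : ∀ X Z U : Sp n, ℓ ⁅X, Z⁆ U + ℓ Z ⁅X, U⁆ =
      pairing n (trSp Z ⊗ₜ trSp U) ⁅trSp X, v⁆ := by
    intro X Z U
    have := pairing_lie (trSp X) (trSp Z ⊗ₜ trSp U) v
    rw [lie_tmul, map_add, LinearMap.add_apply] at this
    rw [hℓ, hℓ, trSp_lie, trSp_lie, TensorProduct.neg_tmul, TensorProduct.tmul_neg, map_neg,
      map_neg, LinearMap.neg_apply, LinearMap.neg_apply]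
    linear_combination -this
  have hlow : IsLowest i a b ℓ :=
    { weight := by
        intro h Z _ U _
        rw [hlie, trSp_cartan, hv.weight, hsum, map_smul, smul_eq_mul, hℓ]
      lower := by
        intro p q hpq hq Z _ U _
        rw [hlie, trSp_rootDiff, hv.diff p q hpq (rootDiff_mem_levi (by
          have := Fin.lt_def.1 hpq; omega) hq), map_zero] }
  obtain ⟨c, hc⟩ := hlow.exists_eq hab hb hmin
  have hv' : ∀ y ∈ grTensor n i 0 (-2), pairing n y v =
      ((c • Matrix.single (Sum.inl a) (Sum.inr b) 1 : Mat n) * contr n y).trace := by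
    have : grTensor n i 0 (-2) ≤ LinearMap.ker ((pairing n).flip v -
        (Matrix.traceLinearMap (Fin n ⊕ Fin n) ℂ ℂ ∘ₗ
          LinearMap.mulLeft ℂ (c • Matrix.single (Sum.inl a) (Sum.inr b) 1 : Mat n)) ∘ₗ
          contr n) := by
      refine Submodule.map₂_le.2 fun A hA B hB => ?_
      rw [LinearMap.mem_ker, LinearMap.sub_apply, sub_eq_zero]
      change pairing n (A ⊗ₜ B) v =
        ((c • Matrix.single (Sum.inl a) (Sum.inr b) 1 : Mat n) * contr n (A ⊗ₜ B)).trace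
      have h1 := hc (trSp A) (trSp_mem_gr hA (by norm_num)) (trSp B) (trSp_mem_gr hB (by norm_num))
      rw [hℓ, trSp_trSp, trSp_trSp, coe_trSp, coe_trSp, anti_transpose] at h1
      rw [h1, contr_tmul, Matrix.smul_mul, Matrix.trace_smul, Matrix.trace_single_mul]
      simp
    intro y hy
    have := this hy
    rw [LinearMap.mem_ker, LinearMap.sub_apply, sub_eq_zero] at this
    exact this
  let N : LieSubmodule ℂ (levi n i) (Sp n ⊗[ℂ] Sp n) :=
    { carrier := {w | ∃ M : Mat n, ∀ y ∈ grTensor n i 0 (-2),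
        pairing n y w = (M * contr n y).trace}
      zero_mem' := ⟨0, fun y _ => by simp⟩
      add_mem' := by
        rintro w1 w2 ⟨M1, h1⟩ ⟨M2, h2⟩
        exact ⟨M1 + M2, fun y hy => by rw [map_add, h1 y hy, h2 y hy, add_mul, Matrix.trace_add]⟩
      smul_mem' := by
        rintro t w ⟨M, h⟩
        exact ⟨t • M, fun y hy => by rw [map_smul, h y hy]; simp⟩
      lie_mem := by
        rintro ⟨X, hX⟩ w ⟨M, h⟩
        refine ⟨(X : Mat n) * M - M * X, fun y hy => ?_⟩
        have h1 := pairing_lie X y w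
        rw [h _ (lie_mem_grTensor hX hy), contr_lie] at h1
        change pairing n y ⁅X, w⁆ = _
        rw [eq_neg_iff_add_eq_zero, add_comm, ← eq_neg_iff_add_eq_zero] at h1
        rw [h1, sub_mul, mul_sub, Matrix.trace_sub, Matrix.trace_sub, mul_assoc (X : Mat n),
          Matrix.trace_mul_comm (X : Mat n), mul_assoc, mul_assoc]
        ring }
  have hirr := hW.irreducible
  rcases eq_bot_or_eq_top (N.comap W.incl) with hN | hN
  · exfalso
    have : (⟨v, hvW⟩ : W) ∈ N.comap W.incl := ⟨_, hv'⟩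
    rw [hN, LieSubmodule.mem_bot] at this
    exact hv.ne_zero (congrArg Subtype.val this)
  · have : (⟨w, hw⟩ : W) ∈ N.comap W.incl := by rw [hN]; trivial
    exact this

/-- A y with zero contraction pairs to zero with W, so it vanishes. The image of W' is then a
nonzero stable space of skew matrices, hence all of them. The preimage y₀ of `antiUnit b a` is an
extremal vector, and the form it defines on 𝔩 ⊗ 𝔷(𝔫) is fixed up to a constant; this is the trace
formula at y₀, and irreducibility carries it to all of W'. The formula holds against the whole of 𝔩
⊗ 𝔷(𝔫), so τ₂(X) need not be projected to W. -/
theorem dual_structure (hi : 2 ≤ i) (hin : i < n)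
    {W W' : LieSubmodule ℂ (levi n i) (Sp n ⊗[ℂ] Sp n)}
    (hW : IsConstituent n i ((eps n 1 + eps n (i + 1)) + (eps n 2 - eps n (i + 1))) W)
    (hW' : IsKillingDual n i W W') :
    (∀ y ∈ W', contr n y = 0 → y = 0) ∧ (∀ M ∈ antiSub n i, ∃ y ∈ W', contr n y = M) ∧
    ∃ k : ℂ, k ≠ 0 ∧ ∀ y ∈ W', ∀ T ∈ grTensor n i 0 2,
      pairing n y T = k * (contr n y * contr n T).trace := by
  have hinj : ∀ y ∈ W', contr n y = 0 → y = 0 := by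
    intro y hy h0
    refine hW'.left y hy fun w hw => ?_
    obtain ⟨M, hM⟩ := hW.exists_pairing_eq hi hin hw
    rw [hM y (hW'.le hy), h0, mul_zero, Matrix.trace_zero]
  obtain ⟨v, hvW, hv⟩ := hW.highest
  have hstab : ∀ N : Submodule ℂ (Sp n ⊗[ℂ] Sp n), N ≤ W'.toSubmodule →
      (∃ y ∈ N, y ≠ 0) → (∀ X ∈ levi n i, ∀ y ∈ N, ⁅X, y⁆ ∈ N) →
      antiSub n i ≤ N.map (contr n) := by
    intro N hN hne hst
    refine antiSub_le ?_ ?_ ?_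
    · rintro _ ⟨y, hy, rfl⟩
      exact contr_mem_antiSub (hW'.le (hN hy))
    · obtain ⟨y, hy, hy0⟩ := hne
      rw [Ne, Submodule.eq_bot_iff]
      intro hcon
      exact hy0 (hinj y (hN hy) (hcon _ ⟨y, hy, rfl⟩))
    · rintro p q hp hq _ ⟨y, hy, rfl⟩
      refine ⟨_, hst _ (rootDiff_mem_levi hp hq) y hy, ?_⟩
      rw [contr_lie, coe_rootDiff]
  have hsurj : ∀ M ∈ antiSub n i, ∃ y ∈ W', contr n y = M := by
    refine hstab W'.toSubmodule le_rfl ?_ fun X hX y hy => lie_mem_of_mem_levi hX hy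
    by_contra hcon
    push Not at hcon
    exact hv.ne_zero (hW'.right v hvW fun y hy => by rw [hcon y hy]; simp)
  refine ⟨hinj, hsurj, ?_⟩
  let a : Fin n := ⟨0, by omega⟩
  let b : Fin n := ⟨1, by omega⟩
  have hab : a < b := by simp [a, b, Fin.lt_def]
  have ha : (a : ℕ) < i := by simp only [a]; omega
  have hb : (b : ℕ) < i := by simp only [b]; omega
  have hmin : ∀ k : Fin n, k ≠ a → k ≠ b → b < k := by
    intro k hka hkb
    simp only [a, b, ne_eq, Fin.ext_iff, Fin.lt_def] at *
    omega
  obtain ⟨y₀, hy₀, hc₀⟩ := hsurj (antiUnit b a) (antiUnit_mem ha hb)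
  have hne : antiUnit b a ≠ (0 : Mat n) := by
    intro h
    have := congrFun (congrFun h (Sum.inr b)) (Sum.inl a)
    simp [antiUnit, hab.ne] at this
  have hy₀0 : y₀ ≠ 0 := by
    rintro rfl
    rw [map_zero] at hc₀
    exact hne hc₀.symm
  let ℓ : Sp n →ₗ[ℂ] Sp n →ₗ[ℂ] ℂ := (TensorProduct.mk ℂ (Sp n) (Sp n)).compr₂ (pairing n y₀)
  have hlie : ∀ X Z U : Sp n, ℓ ⁅X, Z⁆ U + ℓ Z ⁅X, U⁆ = -pairing n ⁅X, y₀⁆ (Z ⊗ₜ U) := by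
    intro X Z U
    rw [pairing_lie, lie_tmul, map_add, neg_neg]
    rfl
  have hlow : IsLowest i a b ℓ :=
    { weight := by
        intro h Z _ U _
        have h1 : ⁅cartan h, y₀⁆ = (-(h a + h b)) • y₀ := by
          refine lie_zero_of_contr hinj hy₀ (cartan_mem_levi h) ?_
          rw [hc₀, coe_cartan, antiUnit, mul_sub, sub_mul]
          ext r s
          simp only [Matrix.sub_apply, Matrix.diagonal_mul, Matrix.mul_diagonal, Matrix.smul_apply,
            Matrix.single_apply, smul_eq_mul]
          rcases r with r | r <;> rcases s with s | s <;> simp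
          by_cases c1 : b = r ∧ a = s <;> by_cases c2 : a = r ∧ b = s
          · exact absurd (c1.1.trans c2.1.symm) hab.ne'
          · simp only [if_pos c1, if_neg c2]; rw [← c1.1, ← c1.2]; ring
          · simp only [if_neg c1, if_pos c2]; rw [← c2.1, ← c2.2]; ring
          · simp only [if_neg c1, if_neg c2]; ring
        rw [hlie, h1, map_smul, LinearMap.smul_apply, smul_eq_mul, neg_mul, neg_neg]
        rfl
      lower := by
        intro p q hpq hq Z _ U _
        have hp : (p : ℕ) < i := by have := Fin.lt_def.1 hpq; omega
        have h1 : ⁅rootDiff q p, y₀⁆ = (0 : ℂ) • y₀ := by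
          refine lie_zero_of_contr hinj hy₀ (rootDiff_mem_levi hq hp) ?_
          rw [hc₀, coe_rootDiff, lie_antiUnit, zero_smul]
          have hqa : q ≠ a := by
            rintro h
            have := Fin.lt_def.1 hpq
            rw [h] at this
            simp [a] at this
          rw [if_neg hqa]
          split_ifs with hqb
          · have : p = a := by
              have := Fin.lt_def.1 hpq
              rw [hqb] at this
              simp only [b] at this
              apply Fin.ext
              simp only [a]; omega
            rw [this, antiUnit_self]; simp
          · simp
        rw [hlie, h1]; simp }
  obtain ⟨c, hc⟩ := hlow.exists_eq hab hb hmin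
  -- `antiUnit b a` has two nonzero entries and the contraction of T is skew, so the trace counts
  -- the entry (a, b̄) twice; hence c / 2.
  have hy₀' : ∀ T ∈ grTensor n i 0 2, pairing n y₀ T = c / 2 * (contr n y₀ * contr n T).trace := by
    have : grTensor n i 0 2 ≤ LinearMap.ker (pairing n y₀ - (c / 2) •
        ((Matrix.traceLinearMap (Fin n ⊕ Fin n) ℂ ℂ ∘ₗ
          LinearMap.mulLeft ℂ (contr n y₀)) ∘ₗ contr n)) := by
      refine Submodule.map₂_le.2 fun A hA B hB => ?_
      rw [LinearMap.mem_ker, LinearMap.sub_apply, sub_eq_zero]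
      change pairing n y₀ (A ⊗ₜ B) = c / 2 * (contr n y₀ * contr n (A ⊗ₜ B)).trace
      have h1 := hc A hA B hB
      change pairing n y₀ (A ⊗ₜ B) = _ at h1
      have h2 := congrFun (congrFun (theta_contr (A ⊗ₜ[ℂ] B)) (Sum.inl b)) (Sum.inr a)
      rw [theta_entry, Matrix.neg_apply] at h2
      simp only [sgn, Sum.elim_inl, Sum.elim_inr, bar, Sum.swap_inl, Sum.swap_inr] at h2
      rw [h1, hc₀, antiUnit, sub_mul, Matrix.trace_sub, Matrix.trace_single_mul,
        Matrix.trace_single_mul, ← contr_tmul]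
      simp only [smul_eq_mul, one_mul]
      linear_combination (c / 2) * h2
    intro T hT
    have := this hT
    rw [LinearMap.mem_ker, LinearMap.sub_apply, sub_eq_zero] at this
    exact this
  refine ⟨c / 2, ?_, ?_⟩
  · intro h0
    refine hy₀0 (hW'.left y₀ hy₀ fun w hw => ?_)
    rw [hy₀' w (hW.le hw), h0, zero_mul]
  let N : Submodule ℂ (Sp n ⊗[ℂ] Sp n) :=
    { carrier := {y | y ∈ W' ∧ ∀ T ∈ grTensor n i 0 2,
        pairing n y T = c / 2 * (contr n y * contr n T).trace}
      zero_mem' := ⟨W'.zero_mem, fun T _ => by simp⟩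
      add_mem' := by
        rintro y1 y2 ⟨h1, h1'⟩ ⟨h2, h2'⟩
        refine ⟨W'.add_mem h1 h2, fun T hT => ?_⟩
        rw [map_add, LinearMap.add_apply, h1' T hT, h2' T hT, map_add, add_mul, Matrix.trace_add]
        ring
      smul_mem' := by
        rintro t y ⟨h, h'⟩
        refine ⟨W'.smul_mem t h, fun T hT => ?_⟩
        rw [map_smul, LinearMap.smul_apply, h' T hT, map_smul, Matrix.smul_mul, Matrix.trace_smul,
          smul_eq_mul, smul_eq_mul]
        ring }
  have hN : antiSub n i ≤ N.map (contr n) := by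
    refine hstab N (fun y hy => hy.1) ⟨y₀, ⟨hy₀, hy₀'⟩, hy₀0⟩ ?_
    rintro X hX y ⟨hy, hy'⟩
    refine ⟨lie_mem_of_mem_levi hX hy, fun T hT => ?_⟩
    rw [pairing_lie, hy' _ (lie_mem_grTensor hX hT), contr_lie, contr_lie, sub_mul, mul_sub,
      Matrix.trace_sub, Matrix.trace_sub, mul_assoc (X : Mat n), Matrix.trace_mul_comm (X : Mat n),
      mul_assoc, mul_assoc]
    ring
  intro y hy T hT
  obtain ⟨y', hy', he⟩ := hN (contr_mem_antiSub (hW'.le hy))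
  have : y = y' := by
    rw [← sub_eq_zero]
    refine hinj _ (W'.sub_mem hy hy'.1) ?_
    rw [map_sub, he, sub_self]
  rw [this]
  exact hy'.2 T hT

/-! ### The quadratic polynomials `τ̃₂(Y^*)` -/

theorem sum_symmetric {M : Type*} [AddCommGroup M] [Module ℂ M] (F : Fin n → Fin n → M)
    (hF : ∀ a b, F a b = F b a) :
    ∑ p : Fin n × Fin n with p.1 ≤ p.2 ∧ (p.2 : ℕ) < i,
      (if p.1 = p.2 then F p.1 p.2 else (2 : ℂ) • F p.1 p.2) =
    ∑ a : Fin n, ∑ b : Fin n, if (a : ℕ) < i ∧ (b : ℕ) < i then F a b else 0 := by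
  rw [Finset.sum_filter, Fintype.sum_prod_type]
  have h1 : ∀ a b : Fin n, (if a ≤ b ∧ (b : ℕ) < i then
      (if a = b then F a b else (2 : ℂ) • F a b) else 0) =
      (if a ≤ b ∧ (b : ℕ) < i then F a b else 0) + (if a < b ∧ (b : ℕ) < i then F b a else 0) := by
    intro a b
    rw [← hF a b]
    by_cases h : a = b
    · subst h; simp
    · have : a ≤ b ↔ a < b := ⟨fun h' => lt_of_le_of_ne h' h, le_of_lt⟩
      simp only [this, if_neg h]
      split_ifs
      · rw [two_smul]
      · simp
  simp only [h1, Finset.sum_add_distrib]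
  rw [Finset.sum_comm (f := fun a b : Fin n => if a < b ∧ (b : ℕ) < i then F b a else 0)]
  rw [← Finset.sum_add_distrib]
  refine Finset.sum_congr rfl fun a _ => ?_
  rw [← Finset.sum_add_distrib]
  refine Finset.sum_congr rfl fun b _ => ?_
  have : a ≤ b ↔ (a : ℕ) ≤ b := Iff.rfl
  have h2 : b < a ↔ (b : ℕ) < a := Iff.rfl
  simp only [this, h2]
  by_cases c1 : (a : ℕ) ≤ b <;> by_cases c2 : (b : ℕ) < i <;> by_cases c3 : (a : ℕ) < i <;>
    simp [c1, c2, c3] <;> intros <;> omega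

/-- The root vectors of ±2ε_a are half of `uSp`. With this normalization a root with a < b weighs
twice as much as one with a = b, so the sum over roots becomes a sum over all ordered pairs with a
single constant. -/
theorem omega_eq : omega n i = (4 * (2 * n + 2) : ℂ)⁻¹ •
    ∑ a : Fin n, ∑ b : Fin n, if (a : ℕ) < i ∧ (b : ℕ) < i then
      uSp (Sum.inr b) (Sum.inl a) ⊗ₜ[ℂ] uSp (Sum.inl a) (Sum.inr b) else 0 := by
  have hn := killing_const_ne_zero n
  let F : Fin n → Fin n → Sp n ⊗[ℂ] Sp n := fun a b =>
    uSp (Sum.inr b) (Sum.inl a) ⊗ₜ[ℂ] uSp (Sum.inl a) (Sum.inr b)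
  have hF : ∀ a b, F a b = F b a := by
    intro a b
    have : uSp (Sum.inr b) (Sum.inl a) = uSp (Sum.inr a) (Sum.inl b) := by
      apply Subtype.ext
      have := unitSp_bar (Sum.inl b) (Sum.inr a)
      simpa [bar, sgn, coe_uSp] using this
    simp only [F]
    rw [this, uSp_inl_inr_comm]
  have hself : ∀ a b : Fin n, unitSp (Sum.inr b) (Sum.inl a) (Sum.inr b) (Sum.inl a) =
      if a = b then 2 else 1 := by
    intro a b
    rw [unitSp, theta_single]
    by_cases h : a = b
    · subst h; simp [bar, sgn]; norm_num
    · simp [bar, sgn, h]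
  have hterm : ∀ a b : Fin n, dualVec (rootSum a b) (rootNegSum a b) ⊗ₜ[ℂ] rootSum a b =
      (4 * (2 * n + 2) : ℂ)⁻¹ • if a = b then F a b else (2 : ℂ) • F a b := by
    intro a b
    split_ifs with h
    · subst h
      have e1 : rootSum a a = (2⁻¹ : ℂ) • uSp (Sum.inl a) (Sum.inr a) :=
        Subtype.ext (coe_rootSum_self a)
      have e2 : rootNegSum a a = (2⁻¹ : ℂ) • uSp (Sum.inr a) (Sum.inl a) :=
        Subtype.ext (coe_rootNegSum_self a)
      have e3 : kappa n (rootSum a a) (rootNegSum a a) = (2 * n + 2 : ℂ) := by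
        rw [kappa_eq, e1, e2, coe_smul, coe_smul, smul_mul_smul_comm, Matrix.trace_smul, coe_uSp,
          coe_uSp, trace_unitSp_mul _ _ (theta_unitSp _ _), hself, if_pos rfl, smul_eq_mul]
        ring
      rw [dualVec, e3, e1, e2, smul_smul, TensorProduct.smul_tmul_smul]
      congr 1
      field_simp; norm_num
    · have e1 : rootSum a b = uSp (Sum.inl a) (Sum.inr b) := Subtype.ext (coe_rootSum h)
      have e2 : rootNegSum a b = uSp (Sum.inr b) (Sum.inl a) := Subtype.ext (coe_rootNegSum h)
      have e3 : kappa n (rootSum a b) (rootNegSum a b) = 2 * (2 * n + 2 : ℂ) := by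
        rw [kappa_eq, e1, e2, coe_uSp,
          coe_uSp, trace_unitSp_mul _ _ (theta_unitSp _ _), hself, if_neg h]
        ring
      rw [dualVec, e3, e1, e2, ← TensorProduct.smul_tmul', smul_smul]
      congr 1
      field_simp; norm_num
  rw [omega]
  simp only [hterm]
  rw [← Finset.smul_sum, sum_symmetric F hF]

theorem sum_single_inr : (∑ a : Fin n, if (a : ℕ) < i then
    (Matrix.single (Sum.inr a) (Sum.inr a) 1 : Mat n) else 0) = eigProj n i (-1) := by
  ext p q
  rw [Matrix.sum_apply, eigProj, Matrix.diagonal_apply]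
  rcases p with p | p
  · have : dg i (Sum.inl p) ≠ -1 := by simp only [dg, Sum.elim_inl]; split_ifs <;> norm_num
    rw [Finset.sum_eq_zero, if_neg this, ite_self]
    intro a _
    split_ifs <;> simp
  · rw [Finset.sum_eq_single p]
    · have : (dg i (Sum.inr p) = -1) ↔ (p : ℕ) < i := by
        simp only [dg, Sum.elim_inr]; split_ifs <;> simp_all
      simp only [this]
      by_cases h1 : (p : ℕ) < i <;> by_cases h2 : Sum.inr p = q <;>
        simp [h1, h2]
    · intro a _ ha
      split_ifs <;> simp [ha]
    · simp

theorem sum_ite_lt (hin : i ≤ n) {M : Type*} [AddCommGroup M] [Module ℂ M] (v : M) :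
    (∑ a : Fin n, if (a : ℕ) < i then v else 0) = (i : ℂ) • v := by
  rw [← Finset.sum_filter, Finset.sum_const, ← Nat.cast_smul_eq_nsmul ℂ]
  congr 2
  rw [← Finset.card_map Fin.valEmbedding]
  have : (Finset.univ.filter fun a : Fin n => (a : ℕ) < i).map Fin.valEmbedding =
      Finset.range i := by
    ext k
    simp only [Finset.mem_map, Finset.mem_filter, Finset.mem_univ, true_and,
      Fin.valEmbedding_apply, Finset.mem_range]
    exact ⟨by rintro ⟨a, h, rfl⟩; exact h, fun h => ⟨⟨k, by omega⟩, h, rfl⟩⟩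
  rw [this, Finset.card_range]

/-- Each product is E_a + E_b for distinct indices and 4 E_a for equal ones. The two summands
contribute i each and the excess on the diagonal contributes 2. -/
theorem sum_unitSp_mul_unitSp (hin : i ≤ n) :
    (∑ a : Fin n, ∑ b : Fin n, if (a : ℕ) < i ∧ (b : ℕ) < i then
      unitSp (Sum.inr b) (Sum.inl a) * unitSp (Sum.inl a) (Sum.inr b) else 0) =
      (2 * i + 2 : ℂ) • eigProj n i (-1) := by
  let E : Fin n → Mat n := fun a => Matrix.single (Sum.inr a) (Sum.inr a) 1
  have hterm : ∀ a b : Fin n, (if (a : ℕ) < i ∧ (b : ℕ) < i then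
      unitSp (Sum.inr b) (Sum.inl a) * unitSp (Sum.inl a) (Sum.inr b) else 0) =
      (if (a : ℕ) < i then (if (b : ℕ) < i then E b else 0) else 0) +
      (if (b : ℕ) < i then (if (a : ℕ) < i then E a else 0) else 0) +
      if a = b then (2 : ℂ) • (if (a : ℕ) < i then E a else 0) else 0 := by
    intro a b
    have h : (unitSp (Sum.inr b) (Sum.inl a) * unitSp (Sum.inl a) (Sum.inr b) : Mat n) =
        E b + E a + if a = b then (2 : ℂ) • E a else 0 := by
      rw [unitSp, unitSp, theta_single, theta_single]
      simp only [sgn, bar, Sum.elim_inl, Sum.elim_inr, Sum.swap_inl, Sum.swap_inr, E]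
      by_cases hab : a = b
      · subst hab
        simp only [mul_add, add_mul, Matrix.smul_mul, Matrix.mul_smul,
          Matrix.single_mul_single_same, if_true, mul_one]
        module
      · simp [mul_add, add_mul, hab, Ne.symm hab]
    rw [h]
    by_cases c1 : (a : ℕ) < i <;> by_cases c2 : (b : ℕ) < i <;>
      simp only [c1, c2, and_self, and_false, false_and, if_true, if_false, add_zero, smul_zero,
        ite_self]
    rw [if_neg (fun h : a = b => c2 (h ▸ c1)), add_zero]
  simp only [hterm, Finset.sum_add_distrib]
  have e1 : (∑ a : Fin n, ∑ b : Fin n,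
      if (a : ℕ) < i then (if (b : ℕ) < i then E b else 0) else 0) =
      (i : ℂ) • eigProj n i (-1) := by
    rw [← sum_single_inr, ← sum_ite_lt hin]
    refine Finset.sum_congr rfl fun a _ => ?_
    split_ifs <;> simp [E]
  have e2 : (∑ a : Fin n, ∑ b : Fin n,
      if (b : ℕ) < i then (if (a : ℕ) < i then E a else 0) else 0) =
      (i : ℂ) • eigProj n i (-1) := by
    rw [Finset.sum_comm]; exact e1
  rw [e1, e2]
  simp only [Finset.sum_ite_eq, Finset.mem_univ, if_true]
  rw [← Finset.smul_sum, sum_single_inr]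
  module

theorem sum_unitSp_mul_unitSp' (hin : i ≤ n) :
    (∑ a : Fin n, ∑ b : Fin n, if (a : ℕ) < i ∧ (b : ℕ) < i then
      unitSp (Sum.inl a) (Sum.inr b) * unitSp (Sum.inr b) (Sum.inl a) else 0) =
      (2 * i + 2 : ℂ) • eigProj n i 1 := by
  have h := congrArg theta (sum_unitSp_mul_unitSp (n := n) hin)
  rw [map_smul, theta_eigProj, neg_neg, smul_neg, map_sum] at h
  rw [← neg_inj, ← h, ← Finset.sum_neg_distrib]
  refine Finset.sum_congr rfl fun a _ => ?_
  rw [map_sum, ← Finset.sum_neg_distrib]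
  refine Finset.sum_congr rfl fun b _ => ?_
  split_ifs
  · rw [theta_mul, theta_unitSp, theta_unitSp]
  · simp

theorem tau_eq (X : Sp n) : tau n i X = ((2⁻¹ : ℂ) * (4 * (2 * n + 2) : ℂ)⁻¹) •
    ∑ a : Fin n, ∑ b : Fin n, if (a : ℕ) < i ∧ (b : ℕ) < i then
      ⁅X, ⁅X, uSp (Sum.inr b) (Sum.inl a)⁆⁆ ⊗ₜ[ℂ] uSp (Sum.inl a) (Sum.inr b) else 0 := by
  rw [tau, omega_eq, map_smul, smul_smul, map_sum]
  congr 1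
  refine Finset.sum_congr rfl fun a _ => ?_
  rw [map_sum]
  refine Finset.sum_congr rfl fun b _ => ?_
  split_ifs
  · rw [TensorProduct.map_tmul, sq]; rfl
  · rw [map_zero]

theorem isDeg_uSp_inr_inl {a b : Fin n} (ha : (a : ℕ) < i) (hb : (b : ℕ) < i) :
    IsDeg i (-2) (uSp (Sum.inr b) (Sum.inl a) : Mat n) :=
  mem_gr.1 (uSp_mem_gr (by rw [dg_inl_eq a ha, dg_inr_eq b hb]; norm_num))

theorem isDeg_uSp_inl_inr {a b : Fin n} (ha : (a : ℕ) < i) (hb : (b : ℕ) < i) :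
    IsDeg i 2 (uSp (Sum.inl a) (Sum.inr b) : Mat n) :=
  mem_gr.1 (uSp_mem_gr (by rw [dg_inl_eq a ha, dg_inr_eq b hb]; norm_num))

/-- Degree 3 is empty, so X annihilates 𝔷(𝔫) on both sides. For V in 𝔷(𝔫̄) and U in 𝔷(𝔫), only X²VU
and UVX² survive in {[X, [X, V]], U}, and the sums of VU and UV are multiples of projections that X²
absorbs. The point is that the factor, proportional to i + 1, is not zero. -/
theorem contr_tau (hin : i ≤ n) {X : Sp n} (hX : X ∈ gr n i 1) :
    contr n (tau n i X) = (((i : ℂ) + 1) / (2 * (2 * n + 2))) • ((X : Mat n) * X) := by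
  have hX' := mem_gr.1 hX
  have hn := killing_const_ne_zero n
  have hterm : ∀ a b : Fin n, contr n (if (a : ℕ) < i ∧ (b : ℕ) < i then
      ⁅X, ⁅X, uSp (Sum.inr b) (Sum.inl a)⁆⁆ ⊗ₜ[ℂ] uSp (Sum.inl a) (Sum.inr b) else 0) =
      (X : Mat n) * X * (if (a : ℕ) < i ∧ (b : ℕ) < i then
        unitSp (Sum.inr b) (Sum.inl a) * unitSp (Sum.inl a) (Sum.inr b) else 0) +
      (if (a : ℕ) < i ∧ (b : ℕ) < i then
        unitSp (Sum.inl a) (Sum.inr b) * unitSp (Sum.inr b) (Sum.inl a) else 0) *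
        ((X : Mat n) * X) := by
    intro a b
    split_ifs with h
    · have hu := isDeg_uSp_inl_inr (i := i) h.1 h.2
      rw [coe_uSp] at hu
      have z1 : (X : Mat n) * unitSp (Sum.inl a) (Sum.inr b) = 0 := hX'.mul_eq_zero hu (by norm_num)
      have z2 : unitSp (Sum.inl a) (Sum.inr b) * (X : Mat n) = 0 := hu.mul_eq_zero hX' (by norm_num)
      rw [contr_tmul, anti, coe_lie, coe_lie, coe_uSp, coe_uSp]
      simp only [mul_sub, sub_mul, mul_assoc, z1, mul_zero, sub_zero]
      simp only [← mul_assoc, z2, zero_mul, sub_zero, zero_sub, neg_neg]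
    · simp
  rw [tau_eq, map_smul, map_sum]
  simp only [map_sum, hterm, Finset.sum_add_distrib, ← Finset.mul_sum, ← Finset.sum_mul]
  rw [sum_unitSp_mul_unitSp hin, sum_unitSp_mul_unitSp' hin, Matrix.mul_smul, Matrix.smul_mul]
  have hXX := hX'.mul hX'
  have e1 : (X : Mat n) * X * eigProj n i (-1) = (X : Mat n) * X := by
    have := (hXX.eigProj_mul 0)
    have h2 := (hXX.eigProj_mul (-1))
    conv_rhs => rw [← mul_one ((X : Mat n) * X), ← eigProj_add (n := n) (i := i), mul_add, mul_add]
    have z0 : (X : Mat n) * X * eigProj n i 0 = 0 := by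
      have := hXX.eigProj_mul 2
      rw [eigProj_eq_zero (by norm_num), zero_mul] at this
      simpa using this.symm
    have z1 : (X : Mat n) * X * eigProj n i 1 = 0 := by
      have := hXX.eigProj_mul 3
      rw [eigProj_eq_zero (by norm_num), zero_mul] at this
      simpa using this.symm
    rw [z0, z1, add_zero, add_zero]
  have e2 : eigProj n i 1 * ((X : Mat n) * X) = (X : Mat n) * X := by
    rw [hXX.eigProj_mul]; simpa using e1
  rw [e1, e2, ← smul_add, ← two_smul ℂ, smul_smul, smul_smul]
  congr 1
  field_simp
  norm_num

theorem tau_mem {X : Sp n} (hX : X ∈ gr n i 1) : tau n i X ∈ grTensor n i 0 2 := by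
  have hX' := mem_gr.1 hX
  rw [tau_eq]
  refine Submodule.smul_mem _ _ (Submodule.sum_mem _ fun a _ => Submodule.sum_mem _ fun b _ => ?_)
  split_ifs with h
  · refine Submodule.apply_mem_map₂ _ (mem_gr.2 ?_) (mem_gr.2 (isDeg_uSp_inl_inr h.1 h.2))
    rw [coe_lie, coe_lie]
    exact hX'.lie (hX'.lie (isDeg_uSp_inr_inl h.1 h.2))
  · exact Submodule.zero_mem _

/-- Polarization of X ↦ tr(M X²), which is what `dual_structure` and `contr_tau` make of τ̃₂. -/
theorem tauPolar_eq (hi : 2 ≤ i) (hin : i < n)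
    {W W' : LieSubmodule ℂ (levi n i) (Sp n ⊗[ℂ] Sp n)}
    (hW : IsConstituent n i ((eps n 1 + eps n (i + 1)) + (eps n 2 - eps n (i + 1))) W)
    (hW' : IsKillingDual n i W W') :
    ∃ k : ℂ, k ≠ 0 ∧ ∀ y ∈ W', ∀ P ∈ gr n i 1, ∀ Q ∈ gr n i 1,
      tauPolar n i y P Q = k * (contr n y * anti (P : Mat n) Q).trace := by
  obtain ⟨-, -, k, hk, hpair⟩ := dual_structure hi hin hW hW'
  have hn := killing_const_ne_zero n
  have hi' : (i : ℂ) + 1 ≠ 0 := by norm_cast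
  refine ⟨k * (((i : ℂ) + 1) / (2 * (2 * n + 2))) / 2, ?_, ?_⟩
  · simp [hk, hn, hi']
  · intro y hy P hP Q hQ
    have ht : ∀ X ∈ gr n i 1, tauTilde n i y X =
        k * (((i : ℂ) + 1) / (2 * (2 * n + 2))) * (contr n y * ((X : Mat n) * X)).trace := by
      intro X hX
      rw [tauTilde, hpair y hy _ (tau_mem hX), contr_tau hin.le hX, Matrix.mul_smul, Matrix.trace_smul,
        smul_eq_mul, mul_assoc]
    rw [tauPolar, ht _ (Submodule.add_mem _ hP hQ), ht _ hP, ht _ hQ, coe_add, anti]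
    simp only [mul_add, add_mul, Matrix.trace_add]
    ring

end

/-! ### The nilradical `𝔫̄` as a set of matrices -/

section
variable {n i : ℕ} {A B C : Mat n}

/-- All components of the matrix have degree `-1` or `-2`. -/
def IsNil (i : ℕ) (A : Mat n) : Prop := prDeg i (-1) A + prDeg i (-2) A = A

theorem IsDeg.isNil_one (h : IsDeg i (-1) A) : IsNil i A := by
  rw [IsNil, h.prDeg_eq, h.prDeg_eq_zero (by norm_num), add_zero]

theorem IsDeg.isNil_two (h : IsDeg i (-2) A) : IsNil i A := by
  rw [IsNil, h.prDeg_eq, h.prDeg_eq_zero (by norm_num), zero_add]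

theorem IsNil.add (hA : IsNil i A) (hB : IsNil i B) : IsNil i (A + B) := by
  rw [IsNil] at *
  rw [map_add, map_add, add_add_add_comm, hA, hB]

theorem IsNil.smul (c : ℂ) (hA : IsNil i A) : IsNil i (c • A) := by
  rw [IsNil] at *
  rw [map_smul, map_smul, ← smul_add, hA]

theorem IsNil.neg (hA : IsNil i A) : IsNil i (-A) := by
  simpa using hA.smul (-1)

theorem IsNil.real_smul (c : ℝ) (hA : IsNil i A) : IsNil i (c • A) := by
  have := hA.smul (c : ℂ)
  rwa [Complex.coe_smul] at this

theorem IsNil.exists (hA : IsNil i A) :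
    ∃ A₁ A₂ : Mat n, IsDeg i (-1) A₁ ∧ IsDeg i (-2) A₂ ∧ A = A₁ + A₂ :=
  ⟨_, _, isDeg_prDeg _, isDeg_prDeg _, hA.symm⟩

theorem IsNil.isDeg_mul (hA : IsNil i A) (hB : IsNil i B) : IsDeg i (-2) (A * B) := by
  obtain ⟨A₁, A₂, h1, h2, rfl⟩ := hA.exists
  obtain ⟨B₁, B₂, h3, h4, rfl⟩ := hB.exists
  rw [add_mul, mul_add, mul_add, h1.mul_eq_zero h4 (by norm_num), h2.mul_eq_zero h3 (by norm_num),
    h2.mul_eq_zero h4 (by norm_num)]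
  simpa using h1.mul h3

theorem IsNil.mul_eq_zero (hA : IsNil i A) (hB : IsDeg i (-2) B) : A * B = 0 := by
  obtain ⟨A₁, A₂, h1, h2, rfl⟩ := hA.exists
  rw [add_mul, h1.mul_eq_zero hB (by norm_num), h2.mul_eq_zero hB (by norm_num), add_zero]

theorem IsDeg.mul_nil_eq_zero (hB : IsDeg i (-2) B) (hA : IsNil i A) : B * A = 0 := by
  obtain ⟨A₁, A₂, h1, h2, rfl⟩ := hA.exists
  rw [mul_add, hB.mul_eq_zero h1 (by norm_num), hB.mul_eq_zero h2 (by norm_num), add_zero]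

theorem IsNil.mul_mul (hA : IsNil i A) (hB : IsNil i B) (hC : IsNil i C) : A * B * C = 0 :=
  (hA.isDeg_mul hB).mul_nil_eq_zero hC

theorem IsNil.mul_mul' (hA : IsNil i A) (hB : IsNil i B) (hC : IsNil i C) : A * (B * C) = 0 := by
  rw [← mul_assoc, hA.mul_mul hB hC]

theorem IsNil.isDeg_lie (hA : IsNil i A) (hB : IsNil i B) : IsDeg i (-2) (A * B - B * A) :=
  (hA.isDeg_mul hB).sub (hB.isDeg_mul hA)

theorem IsNil.exp_eq (hA : IsNil i A) :
    NormedSpace.exp A = 1 + A + (2⁻¹ : ℂ) • (A * A) := by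
  rw [NormedSpace.exp_eq_tsum ℂ]
  beta_reduce
  rw [tsum_eq_sum (s := Finset.range 3)]
  · simp [Finset.sum_range_succ, sq, Nat.factorial]
  · intro k hk
    rw [Finset.mem_range, not_lt] at hk
    rw [← Nat.sub_add_cancel hk, pow_add, pow_succ A 2, sq, hA.mul_mul hA hA, mul_zero, smul_zero]

/-- The Baker–Campbell–Hausdorff series stops at the first bracket, because products of three
elements of 𝔫̄ vanish. -/
theorem IsNil.exp_mul_exp (hA : IsNil i A) (hB : IsNil i B) :
    NormedSpace.exp A * NormedSpace.exp B =
      NormedSpace.exp (A + B + (2⁻¹ : ℂ) • (A * B - B * A)) := by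
  have h := ((hA.isDeg_lie hB).smul (2⁻¹ : ℂ)).isNil_two
  rw [hA.exp_eq, hB.exp_eq, ((hA.add hB).add h).exp_eq]
  set L := (2⁻¹ : ℂ) • (A * B - B * A) with hL
  have hd : IsDeg i (-2) L := (hA.isDeg_lie hB).smul _
  simp only [add_mul, mul_add, one_mul, mul_one, Matrix.smul_mul, Matrix.mul_smul,
    hA.mul_eq_zero hd, hB.mul_eq_zero hd, hd.mul_nil_eq_zero hA, hd.mul_nil_eq_zero hB,
    h.mul_eq_zero hd, hA.mul_mul' hB hB, add_zero, smul_zero, mul_assoc, hA.mul_mul' hA hB,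
    mul_zero]
  rw [hL]
  module

theorem exp_mul_exp_neg (A : Mat n) : NormedSpace.exp A * NormedSpace.exp (-A) = 1 := by
  rw [← Matrix.exp_add_of_commute A (-A) (Commute.neg_right (Commute.refl A)), add_neg_cancel,
    NormedSpace.exp_zero]

theorem exp_neg_mul_exp (A : Mat n) : NormedSpace.exp (-A) * NormedSpace.exp A = 1 := by
  simpa using exp_mul_exp_neg (-A)

/-- `exp A` as a unit. -/
def expUnit (A : Mat n) : (Mat n)ˣ :=
  ⟨NormedSpace.exp A, NormedSpace.exp (-A), exp_mul_exp_neg A, exp_neg_mul_exp A⟩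

theorem coe_expUnit (A : Mat n) : (expUnit A : Mat n) = NormedSpace.exp A := rfl
theorem coe_expUnit_inv (A : Mat n) : ((expUnit A)⁻¹ : (Mat n)ˣ) = expUnit (-A) :=
  Units.ext rfl

theorem theta_exp (hA : theta A = A) : theta (NormedSpace.exp A) = -NormedSpace.exp (-A) := by
  have hJ := symJ_mul_symJ n
  let U : (Mat n)ˣ := ⟨symJ n, -symJ n, by rw [mul_neg, hJ, neg_neg], by rw [neg_mul, hJ, neg_neg]⟩
  have h1 : -A = (U : Mat n) * A.transpose * ((U⁻¹ : (Mat n)ˣ) : Mat n) := by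
    rw [← hA]
    nth_rw 2 [hA]
    change -theta A = symJ n * A.transpose * (-symJ n)
    rw [theta_apply, mul_neg]
  rw [h1, Matrix.exp_units_conj, Matrix.exp_transpose, theta_apply]
  change _ = -(symJ n * _ * (-symJ n))
  rw [mul_neg, neg_neg]

theorem theta_conj_exp (hA : theta A = A) (hB : theta B = B) :
    theta (NormedSpace.exp A * B * NormedSpace.exp (-A)) =
      NormedSpace.exp A * B * NormedSpace.exp (-A) := by
  rw [theta_mul, theta_mul, theta_exp hA, theta_exp (A := -A) (by rw [map_neg, hA]), hB, neg_neg]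
  noncomm_ring

theorem mem_oppNil {Z : Sp n} : Z ∈ oppNil n i ↔ IsNil i (Z : Mat n) := by
  constructor
  · intro h
    obtain ⟨A, hA, B, hB, rfl⟩ := Submodule.mem_sup.1 h
    exact (mem_gr.1 hA).isNil_one.add (mem_gr.1 hB).isNil_two
  · intro h
    have h1 : ∀ d, theta (prDeg i d (Z : Mat n)) = prDeg i d (Z : Mat n) := fun d => by
      rw [theta_prDeg, theta_coe]
    have : Z = toSp _ (h1 (-1)) + toSp _ (h1 (-2)) := Subtype.ext h.symm
    rw [this]
    exact Submodule.add_mem_sup (mem_gr.2 (isDeg_prDeg _)) (mem_gr.2 (isDeg_prDeg _))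

theorem mem_parabolic {Z : Sp n} : Z ∈ parabolic n i ↔
    prDeg i (-1) (Z : Mat n) = 0 ∧ prDeg i (-2) (Z : Mat n) = 0 := by
  constructor
  · intro h
    obtain ⟨D, hD, C, hC, rfl⟩ := Submodule.mem_sup.1 h
    obtain ⟨A, hA, B, hB, rfl⟩ := Submodule.mem_sup.1 hD
    rw [mem_gr] at hA hB hC
    simp only [coe_add, map_add]
    rw [hA.prDeg_eq_zero (by norm_num), hA.prDeg_eq_zero (by norm_num),
      hB.prDeg_eq_zero (by norm_num), hB.prDeg_eq_zero (by norm_num),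
      hC.prDeg_eq_zero (by norm_num), hC.prDeg_eq_zero (by norm_num)]
    simp
  · rintro ⟨h1, h2⟩
    have hθ : ∀ d, theta (prDeg i d (Z : Mat n)) = prDeg i d (Z : Mat n) := fun d => by
      rw [theta_prDeg, theta_coe]
    have h3 := sum_prDeg (i := i) (Z : Mat n)
    rw [h1, h2, zero_add, zero_add] at h3
    have : Z = toSp _ (hθ 0) + toSp _ (hθ 1) + toSp _ (hθ 2) := Subtype.ext h3.symm
    rw [this]
    exact Submodule.add_mem_sup (Submodule.add_mem_sup (mem_gr.2 (isDeg_prDeg _))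
      (mem_gr.2 (isDeg_prDeg _))) (mem_gr.2 (isDeg_prDeg _))

theorem exp_nil_injective (hA : IsNil i A) (hB : IsNil i B)
    (h : NormedSpace.exp A = NormedSpace.exp B) : A = B := by
  -- The truncated logarithm recovers A from exp A.
  have key : ∀ {A : Mat n}, IsNil i A → A = (NormedSpace.exp A - 1) -
      (2⁻¹ : ℂ) • ((NormedSpace.exp A - 1) * (NormedSpace.exp A - 1)) := by
    intro A hA
    have : NormedSpace.exp A - 1 = A + (2⁻¹ : ℂ) • (A * A) := by rw [hA.exp_eq]; abel
    rw [this]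
    simp only [add_mul, mul_add, Matrix.smul_mul, Matrix.mul_smul, hA.mul_mul' hA hA,
      hA.mul_mul hA hA, mul_assoc, smul_zero, mul_zero]
    module
  rw [key hA, key hB, h]

/-- The set of matrices of elements of `𝔮`. -/
def parSet (n i : ℕ) : Set (Mat n) := {A | ∃ Z ∈ parabolic n i, (Z : Mat n) = A}

theorem mem_parSet : A ∈ parSet n i ↔ theta A = A ∧ prDeg i (-1) A = 0 ∧ prDeg i (-2) A = 0 := by
  constructor
  · rintro ⟨Z, hZ, rfl⟩
    exact ⟨theta_coe Z, mem_parabolic.1 hZ⟩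
  · rintro ⟨h1, h2⟩
    exact ⟨toSp A h1, mem_parabolic.2 h2, rfl⟩

/-- Conjugation by a unit. -/
def Ad (u : (Mat n)ˣ) (A : Mat n) : Mat n := (u : Mat n) * A * ((u⁻¹ : (Mat n)ˣ) : Mat n)

theorem Ad_mul (u v : (Mat n)ˣ) (A : Mat n) : Ad (u * v) A = Ad u (Ad v A) := by
  simp [Ad, mul_assoc]

theorem Ad_one (A : Mat n) : Ad 1 A = A := by simp [Ad]

theorem Ad_mul_image (u v : (Mat n)ˣ) (s : Set (Mat n)) : Ad (u * v) '' s = Ad u '' (Ad v '' s) := by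
  rw [← Set.image_comp]
  exact Set.image_congr fun A _ => Ad_mul u v A

theorem grading_mem_parSet : (gradingElt n i : Mat n) ∈ parSet n i := by
  have h : IsDeg i 0 (gradingElt n i : Mat n) := by
    rw [← mem_gr, gr, Module.End.mem_eigenspace_iff, LieAlgebra.ad_apply, lie_self]; simp
  rw [mem_parSet]
  exact ⟨theta_coe _, h.prDeg_eq_zero (by norm_num), h.prDeg_eq_zero (by norm_num)⟩

theorem IsDeg.lie_grading {d : ℤ} (h : IsDeg i d A) :
    (gradingElt n i : Mat n) * A - A * (gradingElt n i : Mat n) = (d : ℂ) • A := by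
  rw [coe_gradingElt]
  ext p q
  rw [Matrix.sub_apply, Matrix.diagonal_mul, Matrix.mul_diagonal, Matrix.smul_apply, smul_eq_mul]
  by_cases h0 : A p q = 0
  · rw [h0]; ring
  · rw [← h p q h0]; push_cast; ring

/-- The grading element H lies in 𝔮, and its conjugate by exp(A₁ + A₂) is H + A₁ + 2A₂; membership
in 𝔮 forces both negative components to vanish. -/
theorem nil_eq_zero_of_normalizes (hA : IsNil i A)
    (h : Ad (expUnit A) '' parSet n i ⊆ parSet n i) : A = 0 := by
  obtain ⟨A₁, A₂, h1, h2, rfl⟩ := hA.exists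
  set H := (gradingElt n i : Mat n)
  have hH := h ⟨H, grading_mem_parSet, rfl⟩
  rw [mem_parSet] at hH
  obtain ⟨-, e1, e2⟩ := hH
  have c1 : H * A₁ - A₁ * H = ((-1 : ℤ) : ℂ) • A₁ := h1.lie_grading
  have c2 : H * A₂ - A₂ * H = ((-2 : ℤ) : ℂ) • A₂ := h2.lie_grading
  have hd : IsDeg i 0 H := by
    rw [← mem_gr, gr, Module.End.mem_eigenspace_iff, LieAlgebra.ad_apply, lie_self]; simp
  have c1' : H * A₁ = A₁ * H - A₁ := by rw [sub_eq_iff_eq_add.1 c1]; simp; abel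
  have c2' : H * A₂ = A₂ * H - (2 : ℂ) • A₂ := by
    rw [sub_eq_iff_eq_add.1 c2]; push_cast; module
  have key : Ad (expUnit (A₁ + A₂)) H = H + A₁ + (2 : ℂ) • A₂ := by
    rw [Ad, coe_expUnit, coe_expUnit_inv, coe_expUnit, hA.exp_eq, hA.neg.exp_eq]
    have z11 : A₁ * (A₁ * A₁) = 0 := by
      rw [← mul_assoc]; exact (h1.mul h1).mul_eq_zero h1 (by norm_num)
    have z12 : A₁ * A₂ = 0 := h1.mul_eq_zero h2 (by norm_num)
    have z21 : A₂ * A₁ = 0 := h2.mul_eq_zero h1 (by norm_num)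
    have z22 : A₂ * A₂ = 0 := h2.mul_eq_zero h2 (by norm_num)
    have w1 : ∀ B, H * (A₁ * B) = A₁ * (H * B) - A₁ * B := fun B => by
      rw [← mul_assoc, c1', sub_mul, mul_assoc]
    have w2 : ∀ B, H * (A₂ * B) = A₂ * (H * B) - (2 : ℂ) • (A₂ * B) := fun B => by
      rw [← mul_assoc, c2', sub_mul, mul_assoc, Matrix.smul_mul]
    have z12' : ∀ B, A₁ * (A₂ * B) = 0 := fun B => by rw [← mul_assoc, z12, zero_mul]
    have z21' : ∀ B, A₂ * (A₁ * B) = 0 := fun B => by rw [← mul_assoc, z21, zero_mul]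
    have z22' : ∀ B, A₂ * (A₂ * B) = 0 := fun B => by rw [← mul_assoc, z22, zero_mul]
    have z11' : ∀ B, A₁ * (A₁ * (A₁ * B)) = 0 := fun B => by
      rw [← mul_assoc A₁ A₁ B, ← mul_assoc, z11, zero_mul]
    simp only [neg_add, mul_add, add_mul, neg_mul, mul_neg, neg_neg, z12, z21, z22, add_zero,
      neg_zero, mul_assoc, one_mul, mul_one, Matrix.smul_mul, Matrix.mul_smul,
      w1, c1', c2', mul_sub, z11, z11', z12', z21', z22', smul_zero, mul_zero,
      sub_zero, smul_sub]
    module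
  rw [key] at e1 e2
  rw [map_add, map_add, map_smul, hd.prDeg_eq_zero (by norm_num), h1.prDeg_eq,
    h2.prDeg_eq_zero (by norm_num), zero_add, smul_zero, add_zero] at e1
  rw [map_add, map_add, map_smul, hd.prDeg_eq_zero (by norm_num), h1.prDeg_eq_zero (by norm_num),
    h2.prDeg_eq, zero_add, zero_add] at e2
  rw [e1, (smul_eq_zero.1 e2).resolve_left two_ne_zero, add_zero]

end

/-! ### Calculus for matrix valued functions -/

section
variable {n : ℕ}

/-- The operator norm makes the matrices a Banach algebra, which the entrywise norm does not.
Derivatives depend only on the topology, and both norms define the same one. -/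
theorem hasDerivAt_exp_smul (X : Mat n) (t : ℝ) :
    HasDerivAt (fun t : ℝ => NormedSpace.exp (t • X)) (NormedSpace.exp (t • X) * X) t := by
  open scoped Matrix.Norms.Operator in
  exact hasDerivAt_exp_smul_const X t

theorem hasDerivAt_exp_smul' (X : Mat n) (t : ℝ) :
    HasDerivAt (fun t : ℝ => NormedSpace.exp (t • X)) (X * NormedSpace.exp (t • X)) t := by
  open scoped Matrix.Norms.Operator in
  exact hasDerivAt_exp_smul_const' X t

theorem hasDerivAt_exp_neg_smul (X : Mat n) (t : ℝ) :
    HasDerivAt (fun t : ℝ => NormedSpace.exp (-(t • X))) (-(NormedSpace.exp (-(t • X)) * X)) t := by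
  have := hasDerivAt_exp_smul (-X) t
  simpa only [smul_neg, mul_neg] using this

theorem hasDerivAt_matrix_mul {f g : ℝ → Mat n} {f' g' : Mat n} {t : ℝ} (hf : HasDerivAt f f' t)
    (hg : HasDerivAt g g' t) : HasDerivAt (fun t => f t * g t) (f' * g t + f t * g') t := by
  open scoped Matrix.Norms.Operator in
  exact HasDerivAt.mul hf hg

theorem hasDerivAt_matrix_inverse {f : ℝ → Mat n} {f' : Mat n} {t : ℝ} (hf : HasDerivAt f f' t)
    (h1 : f t = 1) : HasDerivAt (fun t => Ring.inverse (f t)) (-f') t := by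
  open scoped Matrix.Norms.Operator in
  have h := hasFDerivAt_ringInverse (𝕜 := ℝ) (1 : (Mat n)ˣ)
  rw [Units.val_one, ← h1] at h
  have h2 := (h.comp_hasDerivAt t hf).congr_deriv (g' := -f') (by simp)
  exact h2

theorem eventually_isUnit {f : ℝ → Mat n} {f' : Mat n} {t : ℝ} (hf : HasDerivAt f f' t)
    (h1 : f t = 1) : ∀ᶠ t in nhds t, IsUnit (f t) := by
  open scoped Matrix.Norms.Operator in
  have h2 := hf.continuousAt
  have : IsOpen {x : Mat n | IsUnit x} := Units.isOpen
  exact h2.eventually_mem (this.mem_nhds (by simp [h1]))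

theorem hasDerivAt_linear {V : Type*} [NormedAddCommGroup V] [NormedSpace ℝ V]
    (L : Mat n →ₗ[ℝ] V) {f : ℝ → Mat n} {f' : Mat n} {t : ℝ}
    (hf : HasDerivAt f f' t) : HasDerivAt (fun t => L (f t)) (L f') t :=
  (LinearMap.toContinuousLinearMap L).hasFDerivAt.comp_hasDerivAt t hf

theorem contDiff_linear {V E : Type*} [NormedAddCommGroup V] [NormedSpace ℝ V]
    [NormedAddCommGroup E] [NormedSpace ℝ E] (L : Mat n →ₗ[ℝ] V) {f : E → Mat n}
    (hf : ContDiff ℝ ∞ f) : ContDiff ℝ ∞ fun Y => L (f Y) :=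
  (LinearMap.toContinuousLinearMap L).contDiff.comp hf

theorem contDiff_entry {E : Type*} [NormedAddCommGroup E] [NormedSpace ℝ E] {f : E → Mat n} :
    ContDiff ℝ ∞ f ↔ ∀ p q, ContDiff ℝ ∞ fun Y => f Y p q := by
  constructor
  · intro h p q
    exact contDiff_linear (V := ℂ) (Matrix.entryLinearMap ℝ ℂ p q) h
  · intro h
    exact contDiff_pi.2 fun p => contDiff_pi.2 fun q => h p q

theorem contDiff_matrix_mul {E : Type*} [NormedAddCommGroup E] [NormedSpace ℝ E] {f g : E → Mat n}
    (hf : ContDiff ℝ ∞ f) (hg : ContDiff ℝ ∞ g) : ContDiff ℝ ∞ fun Y => f Y * g Y := by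
  rw [contDiff_entry] at *
  intro p q
  simp only [Matrix.mul_apply]
  exact ContDiff.sum fun r _ => (hf p r).mul (hg r q)

theorem eq_of_hasDerivAt_zero {f : ℝ → Mat n} (hf : ∀ t, HasDerivAt f 0 t) : f 1 = f 0 :=
  is_const_of_deriv_eq_zero (fun t => (hf t).differentiableAt) (fun t => (hf t).deriv) _ _

/-- `t ↦ exp(tX) A exp(-tX)` -/
theorem hasDerivAt_exp_conj (X A : Mat n) (t : ℝ) :
    HasDerivAt (fun t : ℝ => NormedSpace.exp (t • X) * A * NormedSpace.exp (-(t • X)))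
      (X * (NormedSpace.exp (t • X) * A * NormedSpace.exp (-(t • X))) -
        (NormedSpace.exp (t • X) * A * NormedSpace.exp (-(t • X))) * X) t := by
  have h1 := hasDerivAt_matrix_mul (hasDerivAt_matrix_mul (hasDerivAt_exp_smul' X t)
    (hasDerivAt_const t A)) (hasDerivAt_exp_neg_smul X t)
  refine h1.congr_deriv ?_
  noncomm_ring

end

/-! ### The conjugation -/

section
variable {n i : ℕ} (σ : RealForm n)

/-- The conjugation, extended to all matrices. -/
def conjMat : Mat n →ₗ[ℝ] Mat n where
  toFun A := σ.conj (projSp A)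
  map_add' A B := by rw [map_add, map_add, coe_add]
  map_smul' c A := by
    have : projSp (c • A) = (c : ℂ) • projSp A := by rw [← map_smul, Complex.coe_smul]
    rw [this, LinearMap.map_smulₛₗ, Complex.conj_ofReal, coe_smul, Complex.coe_smul]; rfl

theorem conjMat_coe (Z : Sp n) : conjMat σ (Z : Mat n) = σ.conj Z := by
  change ((σ.conj (projSp (Z : Mat n)) : Sp n) : Mat n) = _
  rw [projSp_coe]

theorem theta_conjMat (A : Mat n) : theta (conjMat σ A) = conjMat σ A := theta_coe _

theorem conjMat_lie {A B : Mat n} (hA : theta A = A) (hB : theta B = B) :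
    conjMat σ (A * B - B * A) = conjMat σ A * conjMat σ B - conjMat σ B * conjMat σ A := by
  have h := conjMat_coe σ ⁅toSp A hA, toSp B hB⁆
  rw [σ.conj_lie, coe_lie, coe_lie, ← conjMat_coe, ← conjMat_coe] at h
  exact h

theorem conjMat_conjMat {A : Mat n} (hA : theta A = A) : conjMat σ (conjMat σ A) = A := by
  have h := conjMat_coe σ (σ.conj (toSp A hA))
  rw [σ.conj_conj, ← conjMat_coe] at h
  exact h

theorem conjMat_smul (c : ℂ) (A : Mat n) : conjMat σ (c • A) = (starRingEnd ℂ c) • conjMat σ A := by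
  change ((σ.conj (projSp (c • A)) : Sp n) : Mat n) = _
  rw [map_smul, LinearMap.map_smulₛₗ, coe_smul]; rfl

theorem conj_mem_gr (hσ : σ.conj (gradingElt n i) = gradingElt n i)
    {d : ℤ} {Z : Sp n} (h : Z ∈ gr n i d) : σ.conj Z ∈ gr n i d := by
  rw [gr, Module.End.mem_eigenspace_iff, LieAlgebra.ad_apply] at *
  have := congrArg σ.conj h
  rw [σ.conj_lie, hσ, LinearMap.map_smulₛₗ] at this
  rw [this]
  simp

theorem conjMat_isDeg (hσ : σ.conj (gradingElt n i) = gradingElt n i)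
    {d : ℤ} {A : Mat n} (h : IsDeg i d A) : IsDeg i d (conjMat σ A) := by
  have : projSp A ∈ gr n i d := by
    rw [mem_gr, coe_projSp]
    exact (h.add h.theta).smul _
  exact mem_gr.1 (conj_mem_gr σ hσ this)

theorem conjMat_prDeg (hσ : σ.conj (gradingElt n i) = gradingElt n i)
    (d : ℤ) (A : Mat n) : conjMat σ (prDeg i d A) = prDeg i d (conjMat σ A) := by
  have key : ∀ e, prDeg i d (conjMat σ (prDeg i e A)) =
      if e = d then conjMat σ (prDeg i d A) else 0 := by
    intro e
    split_ifs with h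
    · rw [h, (conjMat_isDeg σ hσ (isDeg_prDeg A)).prDeg_eq]
    · exact (conjMat_isDeg σ hσ (isDeg_prDeg A)).prDeg_eq_zero h
  by_cases hd : d < -2 ∨ 2 < d
  · rw [(isDeg_prDeg (i := i) A).eq_zero hd, (isDeg_prDeg (i := i) (conjMat σ A)).eq_zero hd,
      map_zero]
  · conv_rhs => rw [← sum_prDeg (i := i) A]
    simp only [map_add, key]
    have : d = -2 ∨ d = -1 ∨ d = 0 ∨ d = 1 ∨ d = 2 := by omega
    rcases this with rfl | rfl | rfl | rfl | rfl <;> simp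

theorem conjMat_isNil (hσ : σ.conj (gradingElt n i) = gradingElt n i)
    {A : Mat n} (h : IsNil i A) : IsNil i (conjMat σ A) := by
  rw [IsNil, ← conjMat_prDeg σ hσ, ← conjMat_prDeg σ hσ, ← map_add, h]

theorem conjMat_parSet (hσ : σ.conj (gradingElt n i) = gradingElt n i) :
    conjMat σ '' parSet n i = parSet n i := by
  have h1 : ∀ A ∈ parSet n i, conjMat σ A ∈ parSet n i := by
    intro A hA
    rw [mem_parSet] at *
    rw [← conjMat_prDeg σ hσ, ← conjMat_prDeg σ hσ, hA.2.1, hA.2.2, map_zero]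
    exact ⟨theta_conjMat σ A, rfl, rfl⟩
  refine Set.Subset.antisymm (Set.image_subset_iff.2 h1) fun A hA => ?_
  exact ⟨conjMat σ A, h1 A hA, conjMat_conjMat σ (mem_parSet.1 hA).1⟩

/-- The conjugation respects brackets but not products, so it cannot be applied to the exponential
series term by term. Instead, exp(tX) A exp(-tX) solves a differential equation written with
brackets; its conjugate, untwisted by exp(-tX'), has zero derivative. -/
theorem conjMat_exp_conj {X A : Mat n} (hX : theta X = X) (hA : theta A = A) :
    conjMat σ (NormedSpace.exp X * A * NormedSpace.exp (-X)) =
      NormedSpace.exp (conjMat σ X) * conjMat σ A * NormedSpace.exp (-conjMat σ X) := by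
  set X' := conjMat σ X with hX'
  let B : ℝ → Mat n := fun t => NormedSpace.exp (t • X) * A * NormedSpace.exp (-(t • X))
  have hB : ∀ t, HasDerivAt B (X * B t - B t * X) t := hasDerivAt_exp_conj X A
  have hθ : ∀ t, theta (B t) = B t := fun t => by
    refine theta_conj_exp ?_ hA
    rw [← Complex.coe_smul, map_smul, hX]
  let g : ℝ → Mat n := fun t => NormedSpace.exp (-(t • X')) * conjMat σ (B t) *
    NormedSpace.exp (t • X')
  have hg : ∀ t, HasDerivAt g 0 t := by
    intro t
    have h1 := hasDerivAt_matrix_mul (hasDerivAt_matrix_mul (hasDerivAt_exp_neg_smul X' t)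
      (hasDerivAt_linear (conjMat σ) (hB t))) (hasDerivAt_exp_smul' X' t)
    refine h1.congr_deriv ?_
    rw [conjMat_lie σ hX (hθ t)]
    noncomm_ring
  have h := eq_of_hasDerivAt_zero hg
  simp only [g, B, one_smul, zero_smul, neg_zero, NormedSpace.exp_zero, one_mul, mul_one] at h
  rw [← h]
  generalize conjMat σ (NormedSpace.exp X * A * NormedSpace.exp (-X)) = D
  simp only [← mul_assoc, exp_mul_exp_neg, one_mul]
  rw [mul_assoc, exp_mul_exp_neg, mul_one]

end

/-! ### The Killing form of real elements -/

section
variable {n i : ℕ} (σ : RealForm n)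

/-- In the conjugate of a basis, g has the complex conjugate of the matrix of f. -/
theorem trace_conj_comp (f g : Module.End ℂ (Sp n)) (h : ∀ v, g (σ.conj v) = σ.conj (f v)) :
    LinearMap.trace ℂ (Sp n) g = starRingEnd ℂ (LinearMap.trace ℂ (Sp n) f) := by
  let b := Module.finBasis ℂ (Sp n)
  let c : Fin (Module.finrank ℂ (Sp n)) → Sp n →ₗ[ℂ] ℂ := fun j =>
    { toFun := fun v => starRingEnd ℂ (b.coord j (σ.conj v))
      map_add' := fun v w => by rw [map_add, map_add, map_add]
      map_smul' := fun t v => by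
        rw [LinearMap.map_smulₛₗ, map_smul, smul_eq_mul, map_mul]; simp }
  have hg : g = ∑ j, (c j).smulRight (g (σ.conj (b j))) := by
    ext1 v
    have hv : v = ∑ j, c j v • σ.conj (b j) := by
      have := congrArg σ.conj (b.sum_repr (σ.conj v))
      rw [σ.conj_conj, map_sum] at this
      rw [← this]
      refine Finset.sum_congr rfl fun j _ => ?_
      rw [LinearMap.map_smulₛₗ, this]; rfl
    conv_lhs => rw [hv]
    simp
  rw [hg, map_sum, LinearMap.trace_eq_matrix_trace ℂ b f, Matrix.trace, map_sum]
  refine Finset.sum_congr rfl fun j _ => ?_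
  rw [LinearMap.trace_smulRight, h]
  simp only [c, LinearMap.coe_mk, AddHom.coe_mk, σ.conj_conj, Matrix.diag_apply,
    LinearMap.toMatrix_apply]
  rfl

theorem kappa_conj (X Z : Sp n) :
    kappa n (σ.conj X) (σ.conj Z) = starRingEnd ℂ (kappa n X Z) := by
  rw [kappa, killingForm_apply_apply, killingForm_apply_apply]
  refine trace_conj_comp σ _ _ fun v => ?_
  simp [σ.conj_lie]

end

/-! ### The group and the decomposition of `N̄₀Q₀` -/

section
variable {n i : ℕ}

/-- 𝔮 is the stabilizer of the isotropic subspace on which the grading element is 1. The condition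
removes the blocks that leave this subspace; the remaining block of degree -1, from 0 to -1, then
vanishes by the symmetry under `theta`. -/
theorem mem_parSet_iff {A : Mat n} (hA : theta A = A) :
    A ∈ parSet n i ↔ A * eigProj n i 1 = eigProj n i 1 * A * eigProj n i 1 := by
  rw [mem_parSet]
  constructor
  · rintro ⟨-, h1, h2⟩
    have h3 := sum_prDeg (i := i) A
    rw [h1, h2, zero_add, zero_add] at h3
    have e0 : eigProj n i 1 * prDeg i 0 A = prDeg i 0 A * eigProj n i 1 := by
      simpa using (isDeg_prDeg (i := i) (d := 0) A).eigProj_mul 1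
    have e1 : prDeg i 1 A * eigProj n i 1 = 0 := by
      have := (isDeg_prDeg (i := i) (d := 1) A).eigProj_mul 2
      rw [eigProj_eq_zero (by norm_num), zero_mul] at this
      simpa using this.symm
    have e2 : prDeg i 2 A * eigProj n i 1 = 0 := by
      have := (isDeg_prDeg (i := i) (d := 2) A).eigProj_mul 3
      rw [eigProj_eq_zero (by norm_num), zero_mul] at this
      simpa using this.symm
    have h4 : A * eigProj n i 1 = prDeg i 0 A * eigProj n i 1 := by
      conv_lhs => rw [← h3, add_mul, add_mul, e1, e2, add_zero, add_zero]
    rw [mul_assoc, h4, ← mul_assoc, e0, mul_assoc, eigProj_mul_self]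
  · intro h
    have h0 : ∀ p q, dg i p ≠ 1 → dg i q = 1 → A p q = 0 := by
      intro p q hp hq
      have := congrFun (congrFun h p) q
      rw [eigProj_mul_mul_apply, if_neg (fun h' => hp h'.1), eigProj, Matrix.mul_diagonal,
        if_pos hq, mul_one] at this
      exact this
    refine ⟨hA, ?_, ?_⟩
    · ext p q
      rw [prDeg_apply, Matrix.zero_apply]
      split_ifs with hd
      · rcases dg_mem i q with hq | hq | hq
        · exact h0 p q (by omega) hq
        · rw [← hA, theta_entry, h0 (bar q) (bar p) (by rw [dg_bar]; omega) (by rw [dg_bar]; omega)]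
          simp
        · rcases dg_mem i p with hp | hp | hp <;> omega
      · rfl
    · ext p q
      rw [prDeg_apply, Matrix.zero_apply]
      split_ifs with hd
      · refine h0 p q ?_ ?_
        · rcases dg_mem i q with hq | hq | hq <;> omega
        · rcases dg_mem i p with hp | hp | hp <;> rcases dg_mem i q with hq | hq | hq <;> omega
      · rfl

/-- Symplectic matrices. -/
def IsSymplectic (u : (Mat n)ˣ) : Prop := theta (u : Mat n) = -((u⁻¹ : (Mat n)ˣ) : Mat n)

theorem IsSymplectic.mul {u v : (Mat n)ˣ} (hu : IsSymplectic u) (hv : IsSymplectic v) :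
    IsSymplectic (u * v) := by
  rw [IsSymplectic] at *
  rw [Units.val_mul, theta_mul, hu, hv, mul_inv_rev, Units.val_mul, neg_mul_neg]

theorem IsSymplectic.inv {u : (Mat n)ˣ} (hu : IsSymplectic u) : IsSymplectic u⁻¹ := by
  rw [IsSymplectic] at *
  rw [inv_inv, eq_neg_iff_add_eq_zero, ← theta_theta (u : Mat n), hu, map_neg, add_neg_cancel]

theorem isSymplectic_expUnit {A : Mat n} (hA : theta A = A) : IsSymplectic (expUnit A) := by
  rw [IsSymplectic, coe_expUnit_inv, coe_expUnit, coe_expUnit, theta_exp hA]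

theorem IsSymplectic.theta_Ad {u : (Mat n)ˣ} (hu : IsSymplectic u) {A : Mat n} (hA : theta A = A) :
    theta (Ad u A) = Ad u A := by
  have h2 := hu.inv
  rw [IsSymplectic] at hu h2
  rw [inv_inv] at h2
  rw [Ad, theta_mul, theta_mul, hA, hu, h2]
  noncomm_ring

theorem Ad_mem_parSet {q : (Mat n)ˣ} (hq : IsSymplectic q) {a b : Mat n}
    (h1 : (q : Mat n) * eigProj n i 1 = eigProj n i 1 * a)
    (h2 : ((q⁻¹ : (Mat n)ˣ) : Mat n) * eigProj n i 1 = eigProj n i 1 * b) {A : Mat n}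
    (hA : A ∈ parSet n i) : Ad q A ∈ parSet n i := by
  have hθ := (mem_parSet.1 hA).1
  rw [mem_parSet_iff (hq.theta_Ad hθ)]
  rw [mem_parSet_iff hθ] at hA
  have : Ad q A * eigProj n i 1 = eigProj n i 1 * (a * A * eigProj n i 1 * b) := by
    rw [Ad, mul_assoc, h2, ← mul_assoc, mul_assoc _ A, hA, ← mul_assoc, ← mul_assoc, h1]
    simp only [mul_assoc]
  rw [mul_assoc (eigProj n i 1), this, ← mul_assoc (eigProj n i 1) (eigProj n i 1),
    eigProj_mul_self]

theorem Ad_image_parSet {q : (Mat n)ˣ} (hq : IsSymplectic q) {a b : Mat n}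
    (h1 : (q : Mat n) * eigProj n i 1 = eigProj n i 1 * a)
    (h2 : ((q⁻¹ : (Mat n)ˣ) : Mat n) * eigProj n i 1 = eigProj n i 1 * b) :
    Ad q '' parSet n i = parSet n i := by
  refine Set.Subset.antisymm (Set.image_subset_iff.2 fun A hA => Ad_mem_parSet hq h1 h2 hA)
    fun A hA => ⟨Ad q⁻¹ A, Ad_mem_parSet hq.inv h2 (by rwa [inv_inv]) hA, ?_⟩
  rw [← Ad_mul, mul_inv_cancel, Ad_one]

/-- Injectivity of 𝔫̄ → G/Q: the quotient exp(-B) exp(A) is again the exponential of an element of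
𝔫̄, and it normalizes 𝔮. -/
theorem nil_eq_of_Ad_image_eq {A B : Mat n} (hA : IsNil i A) (hB : IsNil i B)
    (h : Ad (expUnit A) '' parSet n i = Ad (expUnit B) '' parSet n i) : A = B := by
  set W := -B + A + (2⁻¹ : ℂ) • (-B * A - A * -B) with hW
  have hWn : IsNil i W := (hB.neg.add hA).add ((hB.neg.isDeg_lie hA).smul _).isNil_two
  have he : NormedSpace.exp (-B) * NormedSpace.exp A = NormedSpace.exp W := hB.neg.exp_mul_exp hA
  have hU : expUnit W = (expUnit B)⁻¹ * expUnit A := by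
    rw [coe_expUnit_inv]
    exact Units.ext he.symm
  have hW0 : W = 0 := by
    refine nil_eq_zero_of_normalizes hWn ?_
    rw [hU, Ad_mul_image, h, ← Ad_mul_image, inv_mul_cancel]
    simp [Ad_one]
  rw [hW0, NormedSpace.exp_zero] at he
  refine exp_nil_injective hA hB ?_
  rw [← one_mul (NormedSpace.exp A), ← exp_mul_exp_neg B, mul_assoc, he, mul_one]

/-! ### Factorization through the unipotent radical -/

/-- The element of `𝔫̄` determined by the first block column of a group element. -/
def nilOfColumn (n i : ℕ) : Mat n →ₗ[ℂ] Mat n :=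
  (LinearMap.id + theta) ∘ₗ LinearMap.mulLeft ℂ (eigProj n i 0) +
    (2⁻¹ : ℂ) • ((LinearMap.id + theta) ∘ₗ LinearMap.mulLeft ℂ (eigProj n i (-1)))

theorem nilOfColumn_apply (K : Mat n) : nilOfColumn n i K =
    (eigProj n i 0 * K + theta (eigProj n i 0 * K)) +
      (2⁻¹ : ℂ) • (eigProj n i (-1) * K + theta (eigProj n i (-1) * K)) := rfl

theorem isDeg_eigProj_mul_mul (k l : ℤ) (A : Mat n) :
    IsDeg i (k - l) (eigProj n i k * A * eigProj n i l) := by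
  intro p q h
  rw [eigProj_mul_mul_apply] at h
  split_ifs at h with h'
  · rw [h'.1, h'.2]
  · exact absurd rfl h

theorem theta_nilOfColumn (K : Mat n) : theta (nilOfColumn n i K) = nilOfColumn n i K := by
  rw [nilOfColumn_apply]
  simp only [map_add, map_smul, theta_theta]
  module

theorem isNil_nilOfColumn {K : Mat n} (hK : K * eigProj n i 1 = K) :
    IsNil i (nilOfColumn n i K) := by
  have h0 : IsDeg i (-1) (eigProj n i 0 * K) := by
    have := isDeg_eigProj_mul_mul (i := i) 0 1 K
    rwa [mul_assoc, hK] at this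
  have h1 : IsDeg i (-2) (eigProj n i (-1) * K) := by
    have := isDeg_eigProj_mul_mul (i := i) (-1) 1 K
    rwa [mul_assoc, hK] at this
  exact (h0.add h0.theta).isNil_one.add ((h1.add h1.theta).smul _).isNil_two

/-- K plays the role of the first block column of a symplectic matrix, normalized to have the
identity on top. Isotropy, theta K * K = 0, says that the difference K2 - theta K2 of the bottom
block equals theta K0 * K0. This is precisely the quadratic term of the exponential, so only the
symmetric half of K2 has to be put into `nilOfColumn`. -/
theorem exp_nilOfColumn {K : Mat n} (hK : K * eigProj n i 1 = K)
    (hK1 : eigProj n i 1 * K = eigProj n i 1) (hθ : theta K * K = 0) :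
    NormedSpace.exp (nilOfColumn n i K) * eigProj n i 1 = K := by
  set K0 := eigProj n i 0 * K with hK0
  set K2 := eigProj n i (-1) * K with hK2
  have d0 : IsDeg i (-1) K0 := by
    have := isDeg_eigProj_mul_mul (i := i) 0 1 K
    rwa [mul_assoc, hK] at this
  have d2 : IsDeg i (-2) K2 := by
    have := isDeg_eigProj_mul_mul (i := i) (-1) 1 K
    rwa [mul_assoc, hK] at this
  have hsum : K = eigProj n i 1 + K0 + K2 := by
    conv_lhs => rw [← one_mul K, ← eigProj_add (i := i), add_mul, add_mul, hK1]
    abel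
  have t0 : theta K0 = -(theta K * -eigProj n i 0) := by
    rw [hK0, theta_mul, theta_eigProj, neg_zero]
  have p01 : eigProj n i 0 * eigProj n i 1 = (0 : Mat n) := eigProj_mul_eigProj (by norm_num)
  have p10 : eigProj n i 1 * eigProj n i 0 = (0 : Mat n) := eigProj_mul_eigProj (by norm_num)
  have pm1 : eigProj n i (-1) * eigProj n i 1 = (0 : Mat n) := eigProj_mul_eigProj (by norm_num)
  have z0 : theta K0 * eigProj n i 1 = 0 := by
    rw [t0, neg_mul, mul_assoc, neg_mul, p01]; simp
  have z2 : theta K2 * eigProj n i 1 = theta K2 := by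
    rw [hK2, theta_mul, theta_eigProj, neg_neg, neg_mul, mul_assoc, neg_mul, eigProj_mul_self]
  have k0 : K0 * eigProj n i 1 = K0 := by rw [hK0, mul_assoc, hK]
  have k2 : K2 * eigProj n i 1 = K2 := by rw [hK2, mul_assoc, hK]
  have k00 : K0 * K0 = 0 := by
    nth_rw 1 [← k0]
    nth_rw 2 [hK0]
    rw [mul_assoc, ← mul_assoc (eigProj n i 1), p10]; simp
  have hquad : theta K0 * K0 = K2 - theta K2 := by
    have e1 : theta (eigProj n i 1) * K = -K2 := by rw [theta_eigProj, neg_mul]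
    have e2 : theta K0 * K = theta K0 * K0 := by
      conv_lhs => rw [hsum, mul_add, mul_add, z0, zero_add, (d0.theta).mul_eq_zero d2 (by norm_num),
        add_zero]
    have e3 : theta K2 * K = theta K2 := by
      rw [← z2, mul_assoc, hK1]
    rw [← sub_eq_zero]
    have := hθ
    nth_rw 1 [hsum] at this
    rw [map_add, map_add, add_mul, add_mul, e1, e2, e3] at this
    rw [← this]; abel
  rw [(isNil_nilOfColumn hK).exp_eq, nilOfColumn_apply, ← hK0, ← hK2]
  have dn := d0.theta
  have dn2 := d2.theta
  simp only [add_mul, mul_add, sub_mul, Matrix.smul_mul, Matrix.mul_smul, one_mul,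
    d0.mul_eq_zero d2 (by norm_num), d0.mul_eq_zero dn2 (by norm_num),
    dn.mul_eq_zero d2 (by norm_num), dn.mul_eq_zero dn2 (by norm_num),
    d2.mul_eq_zero d0 (by norm_num), d2.mul_eq_zero dn (by norm_num),
    d2.mul_eq_zero d2 (by norm_num), d2.mul_eq_zero dn2 (by norm_num),
    dn2.mul_eq_zero d0 (by norm_num), dn2.mul_eq_zero dn (by norm_num),
    dn2.mul_eq_zero d2 (by norm_num), dn2.mul_eq_zero dn2 (by norm_num), mul_assoc, z0, z2, k0, k2,
    mul_zero, smul_zero, add_zero, zero_add, k00, hquad]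
  conv_rhs => rw [hsum]
  module

/-- The projection of a matrix on its components of degree `-1` and `-2`. -/
def nilPart (n i : ℕ) : Mat n →ₗ[ℂ] Mat n := prDeg i (-1) + prDeg i (-2)

theorem nilPart_apply (A : Mat n) : nilPart n i A = prDeg i (-1) A + prDeg i (-2) A := rfl

theorem nilOfColumn_mul (A : Mat n) (hA : theta A = A) :
    nilOfColumn n i (A * eigProj n i 1) = nilPart n i A := by
  rw [nilOfColumn_apply, nilPart_apply, ← mul_assoc, ← mul_assoc]
  ext p q
  have h := congrFun (congrFun hA p) q
  rw [theta_entry] at h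
  simp only [Matrix.add_apply, Matrix.smul_apply, theta_entry, eigProj_mul_mul_apply, prDeg_apply,
    dg_bar, smul_eq_mul]
  rw [← h]
  rcases dg_mem i p with hp | hp | hp <;> rcases dg_mem i q with hq | hq | hq <;>
    rw [hp, hq] <;> norm_num
  ring

theorem nilOfColumn_eigProj_mul (A : Mat n) : nilOfColumn n i (eigProj n i 1 * A) = 0 := by
  rw [nilOfColumn_apply, ← mul_assoc, ← mul_assoc, eigProj_mul_eigProj (by norm_num),
    eigProj_mul_eigProj (by norm_num)]
  simp

/-- The upper left block, extended by the identity. -/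
def cornerBlock (n i : ℕ) (k : Mat n) : Mat n :=
  eigProj n i 1 * k * eigProj n i 1 + (1 - eigProj n i 1)

theorem cornerBlock_mul_eigProj (k : Mat n) :
    cornerBlock n i k * eigProj n i 1 = eigProj n i 1 * k * eigProj n i 1 := by
  rw [cornerBlock, add_mul, sub_mul, one_mul, mul_assoc, eigProj_mul_self, sub_self, add_zero]

theorem eigProj_mul_cornerBlock (k : Mat n) :
    eigProj n i 1 * cornerBlock n i k = eigProj n i 1 * k * eigProj n i 1 := by
  rw [cornerBlock, mul_add, mul_sub, mul_one, ← mul_assoc, ← mul_assoc, eigProj_mul_self, sub_self,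
    add_zero]

/-- The big cell. Dividing by the upper left block normalizes the first block column of k, and
`exp_nilOfColumn` realizes that column by exp Z. Then exp(-Z) k preserves the isotropic subspace and
so normalizes 𝔮, while its upper left block is that of k. The explicit Z can be differentiated in k,
and χ can be evaluated on k itself. -/
theorem exists_factorization {k : (Mat n)ˣ} (hk : IsSymplectic k)
    (ha : IsUnit (cornerBlock n i k)) {Z : Mat n}
    (hZ : Z = nilOfColumn n i (k * Ring.inverse (cornerBlock n i k) * eigProj n i 1)) :
    theta Z = Z ∧ IsNil i Z ∧
      Ad ((expUnit Z)⁻¹ * k) '' parSet n i = parSet n i ∧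
      eigProj n i 1 * (((expUnit Z)⁻¹ * k : (Mat n)ˣ) : Mat n) * eigProj n i 1 =
        eigProj n i 1 * (k : Mat n) * eigProj n i 1 := by
  set P := eigProj n i 1 with hP
  set a := cornerBlock n i (k : Mat n) with ha'
  set b := Ring.inverse a with hb
  have hab : a * b = 1 := Ring.mul_inverse_cancel a ha
  have hba : b * a = 1 := Ring.inverse_mul_cancel a ha
  have aP : a * P = P * a := by rw [ha', cornerBlock_mul_eigProj, eigProj_mul_cornerBlock]
  have bP : b * P = P * b := by
    calc b * P = b * (P * a) * b := by rw [mul_assoc, mul_assoc, hab, mul_one]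
      _ = P * b := by rw [← aP, ← mul_assoc, hba, one_mul]
  have PP : P * P = P := eigProj_mul_self 1
  have PkP : P * (k : Mat n) * P = a * P := (cornerBlock_mul_eigProj _).symm
  have hK : (k : Mat n) * b * P * P = (k : Mat n) * b * P := by rw [mul_assoc, PP]
  have hK1 : P * ((k : Mat n) * b * P) = P := by
    rw [mul_assoc (k : Mat n), bP, ← mul_assoc, ← mul_assoc]
    rw [PkP, aP, mul_assoc, hab, mul_one]
  have hθ : theta ((k : Mat n) * b * P) * ((k : Mat n) * b * P) = 0 := by
    have hk' : theta (k : Mat n) = -((k⁻¹ : (Mat n)ˣ) : Mat n) := hk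
    have hθP : theta P = -eigProj n i (-1) := theta_eigProj 1
    have hθb : theta b * eigProj n i (-1) = eigProj n i (-1) * theta b := by
      have := congrArg theta bP
      rw [theta_mul, theta_mul, hθP] at this
      simpa using this.symm
    have e : theta ((k : Mat n) * b * P) = eigProj n i (-1) * theta b * ((k⁻¹ : (Mat n)ˣ) : Mat n) := by
      rw [theta_mul, theta_mul, hθP, hk']
      simp only [neg_mul, mul_neg, neg_neg, mul_assoc]
    rw [e, ← hθb]
    have : (theta b * eigProj n i (-1) * ((k⁻¹ : (Mat n)ˣ) : Mat n)) * ((k : Mat n) * b * P) =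
        theta b * (eigProj n i (-1) * P) * b := by
      rw [mul_assoc (k : Mat n), bP, ← mul_assoc _ (k : Mat n), mul_assoc _ _ (k : Mat n),
        Units.inv_mul, mul_one]
      simp only [mul_assoc]
    rw [this, eigProj_mul_eigProj (by norm_num)]
    simp
  have hexp : NormedSpace.exp Z * P = (k : Mat n) * b * P := by
    rw [hZ]; exact exp_nilOfColumn hK hK1 hθ
  have hnil : IsNil i Z := by rw [hZ]; exact isNil_nilOfColumn hK
  have hθZ : theta Z = Z := by rw [hZ]; exact theta_nilOfColumn _
  have hinv : NormedSpace.exp (-Z) * ((k : Mat n) * b * P) = P := by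
    rw [← hexp, ← mul_assoc, exp_neg_mul_exp, one_mul]
  have hqP : NormedSpace.exp (-Z) * k * P = P * a := by
    have : k * P = (k : Mat n) * b * P * a := by
      rw [mul_assoc _ P, ← aP, ← mul_assoc, mul_assoc (k : Mat n), hba, mul_one]
    rw [mul_assoc, this, ← mul_assoc, hinv]
  refine ⟨hθZ, hnil, ?_, ?_⟩
  · refine Ad_image_parSet (a := a) (b := b) ((isSymplectic_expUnit hθZ).inv.mul hk) ?_ ?_
    · rw [coe_expUnit_inv, Units.val_mul, coe_expUnit]
      exact hqP
    · rw [mul_inv_rev, inv_inv, Units.val_mul, coe_expUnit, mul_assoc]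
      change _ * (_ * P) = P * b
      rw [hexp, mul_assoc (k : Mat n), bP, ← mul_assoc, Units.inv_mul, one_mul]
  · rw [coe_expUnit_inv, Units.val_mul, coe_expUnit, mul_assoc, hqP, ← mul_assoc, PP, PkP, aP]

end

/-! ### The real group and sections of the line bundle -/

section
variable {n i : ℕ} (σ : RealForm n)

theorem mem_oppNilReal {A : Mat n} :
    A ∈ oppNilReal σ i ↔ theta A = A ∧ IsNil i A ∧ conjMat σ A = A := by
  constructor
  · rintro ⟨Z, hZ, h, rfl⟩
    exact ⟨theta_coe Z, mem_oppNil.1 hZ, by rw [conjMat_coe, h]⟩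
  · rintro ⟨h1, h2, h3⟩
    refine ⟨toSp A h1, mem_oppNil.2 h2, Subtype.ext ?_, rfl⟩
    rw [← conjMat_coe]; exact h3

theorem theta_oppNilReal (Y : oppNilReal σ i) : theta (Y : Mat n) = Y :=
  ((mem_oppNilReal σ).1 Y.2).1

theorem isNil_oppNilReal (Y : oppNilReal σ i) : IsNil i (Y : Mat n) :=
  ((mem_oppNilReal σ).1 Y.2).2.1

theorem conjMat_oppNilReal (Y : oppNilReal σ i) : conjMat σ (Y : Mat n) = Y :=
  ((mem_oppNilReal σ).1 Y.2).2.2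

theorem mem_groupQ {u : (Mat n)ˣ} :
    u ∈ groupQ σ i ↔ u ∈ groupG σ ∧ Ad u '' parSet n i = parSet n i := Iff.rfl

theorem one_mem_groupQ : (1 : (Mat n)ˣ) ∈ groupQ σ i := by
  rw [mem_groupQ]
  exact ⟨Subgroup.one_mem _, by simp [Ad_one]⟩

theorem expUnit_mem_groupG {A : Mat n} (hA : theta A = A) (h : conjMat σ A = A) :
    expUnit A ∈ groupG σ := by
  refine Subgroup.subset_closure ⟨toSp A hA, Subtype.ext ?_, rfl⟩
  rw [← conjMat_coe]; exact h

theorem exp_mul_unique {Y Y' : oppNilReal σ i} {q q' : (Mat n)ˣ} (hq : q ∈ groupQ σ i)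
    (hq' : q' ∈ groupQ σ i)
    (h : NormedSpace.exp (Y : Mat n) * (q : Mat n) = NormedSpace.exp (Y' : Mat n) * (q' : Mat n)) :
    Y = Y' ∧ q = q' := by
  have hu : expUnit (Y : Mat n) * q = expUnit (Y' : Mat n) * q' := Units.ext h
  have hY : (Y : Mat n) = Y' := by
    refine nil_eq_of_Ad_image_eq (isNil_oppNilReal σ Y) (isNil_oppNilReal σ Y') ?_
    rw [← ((mem_groupQ σ).1 hq).2, ← Ad_mul_image, hu, Ad_mul_image, ((mem_groupQ σ).1 hq).2,
      ((mem_groupQ σ).1 hq').2]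
  refine ⟨Subtype.ext hY, ?_⟩
  rw [hY] at hu
  exact mul_left_cancel hu

/-- Uniqueness of the factorization makes the choice in the definition of `bundleSection`
immaterial. -/
theorem bundleSection_eq (s : ℂ) (φ : oppNilReal σ i → ℂ) (Y : oppNilReal σ i) {q : (Mat n)ˣ}
    (hq : q ∈ groupQ σ i) :
    bundleSection σ i s φ (NormedSpace.exp (Y : Mat n) * (q : Mat n)) =
      ((‖chi i (q : Mat n)‖ : ℝ) : ℂ) ^ (-s) * φ Y := by
  have h : ∃ p : oppNilReal σ i × (Mat n)ˣ, p.2 ∈ groupQ σ i ∧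
      NormedSpace.exp (Y : Mat n) * (q : Mat n) =
        NormedSpace.exp (p.1 : Mat n) * (p.2 : Mat n) := ⟨(Y, q), hq, rfl⟩
  rw [bundleSection, dif_pos h]
  obtain ⟨h1, h2⟩ := exp_mul_unique σ hq h.choose_spec.1 h.choose_spec.2
  rw [← h1, ← h2]

theorem chi_one : chi i (1 : Mat n) = 1 := by
  have : (1 : Mat n).submatrix (fun j : {j : Fin n // (j : ℕ) < i} => Sum.inl j.1)
      (fun j : {j : Fin n // (j : ℕ) < i} => Sum.inl j.1) = 1 := by
    ext p q
    rw [Matrix.submatrix_apply, Matrix.one_apply, Matrix.one_apply]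
    simp [Subtype.ext_iff]
  rw [chi, this, Matrix.det_one]

theorem bundleSection_exp (s : ℂ) (φ : oppNilReal σ i → ℂ) (Y : oppNilReal σ i) :
    bundleSection σ i s φ (NormedSpace.exp (Y : Mat n)) = φ Y := by
  have := bundleSection_eq σ s φ Y (one_mem_groupQ σ)
  rwa [Units.val_one, mul_one, chi_one, norm_one, Complex.ofReal_one, Complex.one_cpow,
    one_mul] at this

theorem theta_lie {A B : Mat n} (hA : theta A = A) (hB : theta B = B) :
    theta (A * B - B * A) = A * B - B * A := by
  rw [map_sub, theta_mul, theta_mul, hA, hB]; abel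

/-! ### Exponential coordinates and directional derivatives -/

/-- The left invariant vector field of `A` at `Y`, in exponential coordinates. -/
def leftInv (Y : Mat n) : Mat n →ₗ[ℂ] Mat n :=
  LinearMap.id + (2⁻¹ : ℂ) • (LinearMap.mulLeft ℂ Y - LinearMap.mulRight ℂ Y)

theorem leftInv_apply (Y A : Mat n) : leftInv Y A = A + (2⁻¹ : ℂ) • (Y * A - A * Y) := rfl

theorem leftInv_isNil {Y A : Mat n} (hY : IsNil i Y) (hA : IsNil i A) : IsNil i (leftInv Y A) :=
  hA.add ((hY.isDeg_lie hA).smul _).isNil_two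

theorem theta_leftInv {Y A : Mat n} (hY : theta Y = Y) (hA : theta A = A) :
    theta (leftInv Y A) = leftInv Y A := by
  rw [leftInv_apply, map_add, map_smul, theta_lie hY hA, hA]

theorem conjMat_leftInv {Y A : Mat n} (hY : theta Y = Y) (hA : theta A = A) :
    conjMat σ (leftInv Y A) = leftInv (conjMat σ Y) (conjMat σ A) := by
  rw [leftInv_apply, map_add, conjMat_smul, conjMat_lie σ hY hA, leftInv_apply]
  rw [map_inv₀, Complex.conj_ofNat]

theorem leftInv_mem {Y A : Mat n} (hY : Y ∈ oppNilReal σ i) (hA : A ∈ oppNilReal σ i) :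
    leftInv Y A ∈ oppNilReal σ i := by
  rw [mem_oppNilReal] at *
  exact ⟨theta_leftInv hY.1 hA.1, leftInv_isNil hY.2.1 hA.2.1, by
    rw [conjMat_leftInv σ hY.1 hA.1, hY.2.2, hA.2.2]⟩

theorem exp_mul_exp_eq {Y A : Mat n} (hY : IsNil i Y) (hA : IsNil i A) :
    NormedSpace.exp Y * NormedSpace.exp A = NormedSpace.exp (Y + leftInv Y A) := by
  rw [hY.exp_mul_exp hA, leftInv_apply, add_assoc]

/-- The differential as a linear map. -/
def dirDeriv {E : Type*} [NormedAddCommGroup E] [NormedSpace ℝ E] (φ : E → ℂ) (Y : E) :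
    E →ₗ[ℝ] ℂ := (fderiv ℝ φ Y).toLinearMap

theorem hasDerivAt_comp_dirDeriv {E : Type*} [NormedAddCommGroup E] [NormedSpace ℝ E] {φ : E → ℂ}
    {c : ℝ → E} {c' Y : E} {t : ℝ} (hφ : DifferentiableAt ℝ φ Y) (hY : c t = Y)
    (hc : HasDerivAt c c' t) : HasDerivAt (fun t => φ (c t)) (dirDeriv φ Y c') t := by
  subst hY
  exact hφ.hasFDerivAt.comp_hasDerivAt t hc

theorem hasDerivAt_line {E : Type*} [NormedAddCommGroup E] [NormedSpace ℝ E] {φ : E → ℂ} {Y V : E}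
    (hφ : DifferentiableAt ℝ φ Y) : HasDerivAt (fun t : ℝ => φ (Y + t • V)) (dirDeriv φ Y V) 0 := by
  refine hasDerivAt_comp_dirDeriv hφ (by rw [zero_smul, add_zero]) ?_
  simpa using ((hasDerivAt_id (0 : ℝ)).smul_const V).const_add Y

theorem contDiff_dirDeriv {E F : Type*} [NormedAddCommGroup E] [NormedSpace ℝ E]
    [NormedAddCommGroup F] [NormedSpace ℝ F] {φ : E → ℂ} {g v : F → E} (hφ : ContDiff ℝ ∞ φ)
    (hg : ContDiff ℝ ∞ g) (hv : ContDiff ℝ ∞ v) : ContDiff ℝ ∞ fun x => dirDeriv φ (g x) (v x) :=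
  ((hφ.fderiv_right (m := ∞) (by simp)).comp hg).clm_apply hv

section
variable {E : Type*} [NormedAddCommGroup E] [NormedSpace ℝ E] {φ ψ : E → ℂ} {Y : E}

theorem dirDeriv_add (hφ : DifferentiableAt ℝ φ Y) (hψ : DifferentiableAt ℝ ψ Y) (V : E) :
    dirDeriv (fun Y => φ Y + ψ Y) Y V = dirDeriv φ Y V + dirDeriv ψ Y V := by
  simp [dirDeriv, fderiv_fun_add hφ hψ]

theorem dirDeriv_mul (hφ : DifferentiableAt ℝ φ Y) (hψ : DifferentiableAt ℝ ψ Y) (V : E) :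
    dirDeriv (fun Y => φ Y * ψ Y) Y V = φ Y * dirDeriv ψ Y V + ψ Y * dirDeriv φ Y V := by
  simp [dirDeriv, fderiv_fun_mul hφ hψ]

theorem dirDeriv_const_mul (hφ : DifferentiableAt ℝ φ Y) (c : ℂ) (V : E) :
    dirDeriv (fun Y => c * φ Y) Y V = c * dirDeriv φ Y V := by
  simp [dirDeriv, fderiv_const_mul hφ]

theorem dirDeriv_sum {κ : Type*} (u : Finset κ) {φ : κ → E → ℂ}
    (hφ : ∀ k ∈ u, DifferentiableAt ℝ (φ k) Y) (V : E) :
    dirDeriv (fun Y => ∑ k ∈ u, φ k Y) Y V = ∑ k ∈ u, dirDeriv (φ k) Y V := by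
  simp [dirDeriv, fderiv_fun_sum hφ]

/-- The commutator of two affine vector fields. -/
theorem dirDeriv_dirDeriv_sub [FiniteDimensional ℝ E] (hφ : ContDiff ℝ ∞ φ) (a b : E)
    (L M : E →ₗ[ℝ] E) :
    dirDeriv (fun Y => dirDeriv φ Y (b + L Y)) Y (a + M Y) -
      dirDeriv (fun Y => dirDeriv φ Y (a + M Y)) Y (b + L Y) =
    dirDeriv φ Y (L (a + M Y) - M (b + L Y)) := by
  have hT : ContDiff ℝ ∞ (fderiv ℝ φ) := hφ.fderiv_right (by simp)
  have hd : ∀ (b : E) (L : E →ₗ[ℝ] E) (V : E), dirDeriv (fun Y => dirDeriv φ Y (b + L Y)) Y V =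
      fderiv ℝ (fderiv ℝ φ) Y V (b + L Y) + fderiv ℝ φ Y (L V) := by
    intro b L V
    have h2 : HasFDerivAt (fun Y => b + L Y) (LinearMap.toContinuousLinearMap L) Y :=
      (LinearMap.toContinuousLinearMap L).hasFDerivAt.const_add b
    have h3 := ((hT.differentiable (by simp)) Y).hasFDerivAt.clm_apply h2
    change fderiv ℝ (fun Y => fderiv ℝ φ Y (b + L Y)) Y V = _
    rw [h3.fderiv]
    simp [add_comm]
  have hsymm : IsSymmSndFDerivAt ℝ φ Y :=
    (contDiff_infty.1 hφ 2).contDiffAt.isSymmSndFDerivAt (by simp)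
  rw [hd, hd, hsymm.eq (a + M Y) (b + L Y), add_sub_add_left_eq_sub, map_sub]
  rfl

end

/-- The truncated Baker–Campbell–Hausdorff formula is affine in its second argument, so exp(Y)
exp(tZ) is the exponential of a straight line through Y. -/
theorem rightReal_eq (s : ℂ) {φ : oppNilReal σ i → ℂ} (Y : oppNilReal σ i)
    (hφ : DifferentiableAt ℝ φ Y) {Z : Sp n} (hZ : (Z : Mat n) ∈ oppNilReal σ i) :
    rightReal σ i s Z φ Y = dirDeriv φ Y ⟨leftInv (Y : Mat n) (Z : Mat n), leftInv_mem σ Y.2 hZ⟩ := by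
  refine Eq.trans ?_ (hasDerivAt_line hφ).deriv
  rw [rightReal]
  congr 1
  ext1 t
  rw [← bundleSection_exp σ s φ, exp_mul_exp_eq (isNil_oppNilReal σ Y)
    (((mem_oppNilReal σ).1 hZ).2.1.real_smul t)]
  congr 2
  change _ = (Y : Mat n) + t • leftInv (Y : Mat n) (Z : Mat n)
  rw [← Complex.coe_smul, map_smul, Complex.coe_smul]

end

/-! ### The complexified derivative -/

section
variable {n i : ℕ} {σ : RealForm n}

theorem theta_nilPart {A : Mat n} (hA : theta A = A) : theta (nilPart n i A) = nilPart n i A := by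
  rw [nilPart_apply, map_add, theta_prDeg, theta_prDeg, hA]

theorem isNil_nilPart (A : Mat n) : IsNil i (nilPart n i A) :=
  (isDeg_prDeg A).isNil_one.add (isDeg_prDeg A).isNil_two

theorem IsNil.nilPart_eq {A : Mat n} (hA : IsNil i A) : nilPart n i A = A := hA

/-- The projection onto `𝔫̄`. -/
def nilProj (n i : ℕ) : Mat n →ₗ[ℂ] Mat n :=
  (2⁻¹ : ℂ) • ((LinearMap.id + theta) ∘ₗ nilPart n i)

theorem nilProj_of_theta {A : Mat n} (hA : theta A = A) : nilProj n i A = nilPart n i A := by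
  change (2⁻¹ : ℂ) • (nilPart n i A + theta (nilPart n i A)) = _
  rw [theta_nilPart hA]; module

theorem theta_nilProj (A : Mat n) : theta (nilProj n i A) = nilProj n i A := by
  change theta ((2⁻¹ : ℂ) • (nilPart n i A + theta (nilPart n i A))) =
    (2⁻¹ : ℂ) • (nilPart n i A + theta (nilPart n i A))
  rw [map_smul, map_add, theta_theta, add_comm]

theorem isNil_theta {A : Mat n} (hA : IsNil i A) : IsNil i (theta A) := by
  rw [IsNil, ← theta_prDeg, ← theta_prDeg, ← map_add, hA]

theorem isNil_nilProj (A : Mat n) : IsNil i (nilProj n i A) :=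
  ((isNil_nilPart A).add (isNil_theta (isNil_nilPart A))).smul _

theorem nilProj_eq {A : Mat n} (hA : theta A = A) (h : IsNil i A) : nilProj n i A = A := by
  rw [nilProj_of_theta hA, h.nilPart_eq]

theorem nilProj_coe (Y : oppNilReal σ i) : nilProj n i (Y : Mat n) = Y :=
  nilProj_eq (theta_oppNilReal σ Y) (isNil_oppNilReal σ Y)

/-- The real part of the component in `𝔫̄`. -/
def realPart (hσ : σ.conj (gradingElt n i) = gradingElt n i) :
    Mat n →ₗ[ℝ] oppNilReal σ i where
  toFun A := ⟨(2⁻¹ : ℝ) • (nilProj n i A + conjMat σ (nilProj n i A)), by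
    rw [mem_oppNilReal]
    refine ⟨?_, ((isNil_nilProj A).add (conjMat_isNil σ hσ (isNil_nilProj A))).real_smul _, ?_⟩
    · rw [LinearMap.map_smul_of_tower, map_add, theta_nilProj, theta_conjMat]
    · rw [map_smul, map_add, conjMat_conjMat σ (theta_nilProj A), add_comm]⟩
  map_add' A B := Subtype.ext (by
    change (2⁻¹ : ℝ) • (nilProj n i (A + B) + conjMat σ (nilProj n i (A + B))) =
      (2⁻¹ : ℝ) • (nilProj n i A + conjMat σ (nilProj n i A)) +
      (2⁻¹ : ℝ) • (nilProj n i B + conjMat σ (nilProj n i B))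
    rw [map_add, map_add]; module)
  map_smul' c A := Subtype.ext (by
    change (2⁻¹ : ℝ) • (nilProj n i (c • A) + conjMat σ (nilProj n i (c • A))) =
      c • (2⁻¹ : ℝ) • (nilProj n i A + conjMat σ (nilProj n i A))
    rw [LinearMap.map_smul_of_tower, map_smul]; module)

theorem coe_realPart (hσ : σ.conj (gradingElt n i) = gradingElt n i)
    (A : Mat n) : (realPart hσ A : Mat n) =
    (2⁻¹ : ℝ) • (nilProj n i A + conjMat σ (nilProj n i A)) := rfl

theorem realPart_coe (hσ : σ.conj (gradingElt n i) = gradingElt n i)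
    (Y : oppNilReal σ i) : realPart hσ (Y : Mat n) = Y := by
  apply Subtype.ext
  rw [coe_realPart, nilProj_coe, conjMat_oppNilReal]
  module

theorem realPart_I_smul_coe (hσ : σ.conj (gradingElt n i) = gradingElt n i)
    (Y : oppNilReal σ i) : realPart hσ (Complex.I • (Y : Mat n)) = 0 := by
  apply Subtype.ext
  rw [coe_realPart, map_smul, nilProj_coe, conjMat_smul, conjMat_oppNilReal]
  simp

/-- The complex linear extension of a real linear functional on `𝔫̄₀` to `𝔫̄`, composed with the
projection onto `𝔫̄`. -/
def cext (hσ : σ.conj (gradingElt n i) = gradingElt n i)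
    (T : oppNilReal σ i →ₗ[ℝ] ℂ) : Mat n →ₗ[ℂ] ℂ where
  toFun A := T (realPart hσ A) - Complex.I * T (realPart hσ (Complex.I • A))
  map_add' A B := by rw [smul_add, map_add, map_add, map_add, map_add]; ring
  map_smul' c A := by
    have key : ∀ f : Mat n →ₗ[ℝ] ℂ, f (c • A) - Complex.I * f (Complex.I • (c • A)) =
        c * (f A - Complex.I * f (Complex.I • A)) := by
      intro f
      have h1 : c • A = c.re • A + c.im • (Complex.I • A) := by
        rw [← Complex.coe_smul, ← Complex.coe_smul, smul_smul, ← add_smul, Complex.re_add_im]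
      have h2 : Complex.I • (c • A) = c.re • (Complex.I • A) - c.im • A := by
        rw [h1, smul_add, smul_comm, smul_comm Complex.I c.im, smul_smul Complex.I Complex.I,
          Complex.I_mul_I]
        module
      rw [h2, h1, f.map_add, f.map_sub, f.map_smul, f.map_smul, f.map_smul, f.map_smul]
      simp only [Complex.real_smul]
      conv_rhs => rw [← Complex.re_add_im c]
      linear_combination ((c.im : ℂ) * f (Complex.I • A)) * Complex.I_mul_I
    exact key (T ∘ₗ realPart hσ)

theorem cext_apply (hσ : σ.conj (gradingElt n i) = gradingElt n i)
    (T : oppNilReal σ i →ₗ[ℝ] ℂ) (A : Mat n) :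
    cext hσ T A = T (realPart hσ A) - Complex.I * T (realPart hσ (Complex.I • A)) := rfl

theorem cext_coe (hσ : σ.conj (gradingElt n i) = gradingElt n i)
    (T : oppNilReal σ i →ₗ[ℝ] ℂ) (Y : oppNilReal σ i) :
    cext hσ T (Y : Mat n) = T Y := by
  rw [cext_apply, realPart_coe, realPart_I_smul_coe, map_zero, mul_zero, sub_zero]

/-- Writing Re for `realPart`, every element of 𝔫̄ satisfies A = Re(A) - √-1 Re(√-1 A). Identities
between complex linear maps thus need checking only on 𝔫̄₀, where honest derivatives are available.
-/
theorem eq_of_eq_on_real (hσ : σ.conj (gradingElt n i) = gradingElt n i)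
    {V : Type*} [AddCommGroup V] [Module ℂ V] {f g : Mat n →ₗ[ℂ] V}
    (hfg : ∀ Y : oppNilReal σ i, f (Y : Mat n) = g (Y : Mat n)) {A : Mat n}
    (hA : nilProj n i A = A) : f A = g A := by
  have hA' : A = (realPart hσ A : Mat n) - Complex.I • (realPart hσ (Complex.I • A) : Mat n) := by
    rw [coe_realPart, coe_realPart, map_smul, hA, conjMat_smul, Complex.conj_I]
    simp only [← Complex.coe_smul, smul_add, smul_smul]
    have h1 : Complex.I * (((2⁻¹ : ℝ) : ℂ) * Complex.I) = -2⁻¹ := by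
      push_cast; linear_combination (2⁻¹ : ℂ) * Complex.I_mul_I
    have h2 : Complex.I * (((2⁻¹ : ℝ) : ℂ) * -Complex.I) = 2⁻¹ := by
      push_cast; linear_combination (-2⁻¹ : ℂ) * Complex.I_mul_I
    rw [h1, h2]
    push_cast
    module
  rw [hA', f.map_sub, g.map_sub, f.map_smul, g.map_smul, hfg, hfg]

/-- Right differentiation by the component of `A` in `𝔫̄`, in exponential coordinates. -/
def R (hσ : σ.conj (gradingElt n i) = gradingElt n i)
    (φ : oppNilReal σ i → ℂ) (Y : oppNilReal σ i) : Mat n →ₗ[ℂ] ℂ :=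
  cext hσ (dirDeriv φ Y) ∘ₗ leftInv (Y : Mat n) ∘ₗ nilProj n i

theorem R_apply (hσ : σ.conj (gradingElt n i) = gradingElt n i)
    (φ : oppNilReal σ i → ℂ) (Y : oppNilReal σ i) (A : Mat n) :
    R hσ φ Y A = cext hσ (dirDeriv φ Y) (leftInv (Y : Mat n) (nilProj n i A)) := rfl

theorem R_coe (hσ : σ.conj (gradingElt n i) = gradingElt n i)
    (φ : oppNilReal σ i → ℂ) (Y A : oppNilReal σ i) :
    R hσ φ Y (A : Mat n) = dirDeriv φ Y ⟨leftInv (Y : Mat n) (A : Mat n), leftInv_mem σ Y.2 A.2⟩ := by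
  rw [R_apply, nilProj_coe]
  exact cext_coe hσ _ ⟨_, leftInv_mem σ Y.2 A.2⟩

theorem R_nilProj (hσ : σ.conj (gradingElt n i) = gradingElt n i)
    (φ : oppNilReal σ i → ℂ) (Y : oppNilReal σ i) (A : Mat n) :
    R hσ φ Y (nilProj n i A) = R hσ φ Y A := by
  rw [R_apply, nilProj_eq (theta_nilProj A) (isNil_nilProj A), R_apply]

theorem right_eq (hσ : σ.conj (gradingElt n i) = gradingElt n i)
    (s : ℂ) {φ : oppNilReal σ i → ℂ} (Y : oppNilReal σ i)
    (hφ : DifferentiableAt ℝ φ Y) {Z : Sp n} (hZ : Z ∈ oppNil n i) :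
    right σ i s Z φ Y = R hσ φ Y (Z : Mat n) := by
  have hθ := theta_coe Z
  have hn := mem_oppNil.1 hZ
  have hp : nilProj n i (Z : Mat n) = Z := nilProj_eq hθ hn
  have h1 : (((2⁻¹ : ℂ) • (Z + σ.conj Z) : Sp n) : Mat n) = realPart hσ (Z : Mat n) := by
    rw [coe_realPart, hp, conjMat_coe, coe_smul, coe_add, ← Complex.coe_smul]
    push_cast; rfl
  have h2 : (((2 * Complex.I)⁻¹ • (Z - σ.conj Z) : Sp n) : Mat n) =
      (-realPart hσ (Complex.I • (Z : Mat n)) : oppNilReal σ i) := by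
    rw [Submodule.coe_neg, coe_realPart, map_smul, hp, conjMat_smul, conjMat_coe, Complex.conj_I,
      ← Complex.coe_smul, coe_smul, mul_inv, Complex.inv_I]
    change _ • ((Z : Mat n) - (σ.conj Z : Mat n)) = _
    push_cast
    module
  change rightReal σ i s _ φ Y + Complex.I * rightReal σ i s _ φ Y = _
  rw [rightReal_eq σ s Y hφ (by rw [h1]; exact (realPart hσ (Z : Mat n)).2),
    rightReal_eq σ s Y hφ (by rw [h2]; exact Subtype.coe_prop _)]
  have key : R hσ φ Y (Z : Mat n) = R hσ φ Y (((2⁻¹ : ℂ) • (Z + σ.conj Z) : Sp n) : Mat n) +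
      Complex.I * R hσ φ Y (((2 * Complex.I)⁻¹ • (Z - σ.conj Z) : Sp n) : Mat n) := by
    rw [← smul_eq_mul, ← map_smul, ← map_add, ← coe_smul, ← coe_add]
    congr 2
    rw [smul_smul, mul_inv, mul_comm Complex.I, mul_assoc, inv_mul_cancel₀ Complex.I_ne_zero]
    module
  rw [key]
  congr 1
  · simp only [h1]; rw [R_coe]
  · simp only [h2]; rw [R_coe]

end

/-! ### The action of the Lie algebra on sections -/

/-- At the identity, a nontrivial permutation in the Leibniz formula moves at least two indices;
whichever factor is differentiated, an off-diagonal zero remains. -/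
theorem hasDerivAt_det {m : Type*} [Fintype m] [DecidableEq m] {f : ℝ → Matrix m m ℂ}
    {f' : Matrix m m ℂ} {t : ℝ} (hf : ∀ p q, HasDerivAt (fun t => f t p q) (f' p q) t)
    (h1 : f t = 1) : HasDerivAt (fun t => (f t).det) f'.trace t := by
  have h : HasDerivAt (fun t => ∑ π : Equiv.Perm m, ((Equiv.Perm.sign π : ℤ) : ℂ) *
      ∏ j, f t (π j) j) (∑ π : Equiv.Perm m, ((Equiv.Perm.sign π : ℤ) : ℂ) *
      ∑ j, (∏ k ∈ Finset.univ.erase j, f t (π k) k) • f' (π j) j) t :=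
    HasDerivAt.fun_sum fun π _ =>
      (HasDerivAt.fun_finsetProd fun j _ => hf (π j) j).const_mul _
  have h2 : (fun t => (f t).det) = fun t => ∑ π : Equiv.Perm m, ((Equiv.Perm.sign π : ℤ) : ℂ) *
      ∏ j, f t (π j) j := by
    ext t
    rw [Matrix.det_apply']
  rw [h2]
  refine h.congr_deriv ?_
  rw [Finset.sum_eq_single 1]
  · simp [h1, Matrix.trace]
  · intro π _ hπ
    rw [Finset.sum_eq_zero, mul_zero]
    intro j _
    obtain ⟨x, hx⟩ : ∃ x, π x ≠ x := by
      by_contra hcon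
      push Not at hcon
      exact hπ (Equiv.ext hcon)
    have hx2 : π (π x) ≠ π x := fun h => hx (π.injective h)
    rw [h1]
    by_cases hj : j = x
    · rw [Finset.prod_eq_zero (i := π x), zero_smul]
      · exact Finset.mem_erase.2 ⟨by rw [hj]; exact hx, Finset.mem_univ _⟩
      · exact Matrix.one_apply_ne hx2
    · rw [Finset.prod_eq_zero (i := x), zero_smul]
      · exact Finset.mem_erase.2 ⟨Ne.symm hj, Finset.mem_univ _⟩
      · exact Matrix.one_apply_ne hx
  · simp

section
variable {n i : ℕ}

/-- The differential `λ_i` of the character `χ_𝔮`, extended by the trace form. -/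
def lam (n i : ℕ) : Mat n →ₗ[ℂ] ℂ :=
  (2⁻¹ : ℂ) • (Matrix.traceLinearMap (Fin n ⊕ Fin n) ℂ ℂ ∘ₗ
    LinearMap.mulLeft ℂ (gradingElt n i : Mat n))

theorem lam_apply (A : Mat n) : lam n i A = 2⁻¹ * ((gradingElt n i : Mat n) * A).trace := rfl

theorem trace_block {A : Mat n} (hA : theta A = A) :
    (A.submatrix (fun j : {j : Fin n // (j : ℕ) < i} => Sum.inl j.1)
      (fun j : {j : Fin n // (j : ℕ) < i} => Sum.inl j.1)).trace = lam n i A := by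
  have h : ∀ j : Fin n, A (Sum.inr j) (Sum.inr j) = -A (Sum.inl j) (Sum.inl j) := by
    intro j
    have := congrFun (congrFun hA (Sum.inr j)) (Sum.inr j)
    rw [theta_entry] at this
    rw [← this]
    simp [sgn, bar]
  rw [lam_apply, Matrix.trace, Matrix.trace, coe_gradingElt]
  simp only [Matrix.diag_apply, Matrix.diagonal_mul, Fintype.sum_sum_type, h, dg, Sum.elim_inl,
    Sum.elim_inr, Matrix.submatrix_apply]
  rw [← Finset.sum_add_distrib, Finset.mul_sum,
    ← Finset.sum_subtype (Finset.univ.filter fun j : Fin n => (j : ℕ) < i) (by simp)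
      (fun j => A (Sum.inl j) (Sum.inl j)), Finset.sum_filter]
  refine Finset.sum_congr rfl fun j _ => ?_
  split_ifs
  · push_cast; ring
  · simp

/-- λ_i is a multiple of κ(H_𝔮, ·), the Killing form is compatible with the conjugation, and H_𝔮 is
real. -/
theorem lam_real (σ : RealForm n) (hσ : σ.conj (gradingElt n i) = gradingElt n i) {A : Mat n}
    (hA : theta A = A) (hA' : conjMat σ A = A) : ((lam n i A).re : ℂ) = lam n i A := by
  have h := kappa_conj σ (gradingElt n i) (toSp A hA)
  have h1 : σ.conj (toSp A hA) = toSp A hA := by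
    apply Subtype.ext
    rw [← conjMat_coe]; exact hA'
  rw [hσ, h1, kappa_eq] at h
  have h2 : ((gradingElt n i : Mat n) * (toSp A hA : Mat n)).trace = 2 * lam n i A := by
    rw [lam_apply]; ring_nf; rfl
  rw [h2] at h
  have h3 := killing_const_ne_zero n
  rw [← Complex.conj_eq_iff_re]
  have h4 : starRingEnd ℂ (2 * (n : ℂ) + 2) = 2 * n + 2 := by
    rw [map_add, map_mul, Complex.conj_ofNat, Complex.conj_natCast]
  rw [map_mul, map_mul, h4, Complex.conj_ofNat] at h
  have h5 := mul_left_cancel₀ h3 h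
  exact (mul_left_cancel₀ two_ne_zero h5).symm

theorem chi_eq_of_corner {u v : Mat n} (h : eigProj n i 1 * u * eigProj n i 1 =
    eigProj n i 1 * v * eigProj n i 1) : chi i u = chi i v := by
  rw [chi, chi]
  congr 1
  ext p q
  have := congrFun (congrFun h (Sum.inl p.1)) (Sum.inl q.1)
  rw [eigProj_mul_mul_apply, eigProj_mul_mul_apply, if_pos, if_pos] at this
  · exact this
  · simp [dg, p.2, q.2]
  · simp [dg, p.2, q.2]

/-- `Ad(exp(-Y)) X` -/
def adNeg (X Y : Mat n) : Mat n := NormedSpace.exp (-Y) * X * NormedSpace.exp Y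

theorem theta_adNeg {X Y : Mat n} (hX : theta X = X) (hY : theta Y = Y) :
    theta (adNeg X Y) = adNeg X Y := by
  have := theta_conj_exp (A := -Y) (by rw [map_neg, hY]) hX
  rwa [neg_neg] at this

theorem conjMat_adNeg (σ : RealForm n) {X Y : Mat n} (hX : theta X = X) (hY : theta Y = Y) :
    conjMat σ (adNeg X Y) = adNeg (conjMat σ X) (conjMat σ Y) := by
  have := conjMat_exp_conj σ (X := -Y) (A := X) (by rw [map_neg, hY]) hX
  rwa [neg_neg, map_neg, neg_neg] at this

theorem cornerBlock_one : cornerBlock n i 1 = 1 := by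
  rw [cornerBlock, mul_one, eigProj_mul_self]; abel

theorem hasDerivAt_cornerBlock {k : ℝ → Mat n} {k' : Mat n} {t : ℝ} (hk : HasDerivAt k k' t) :
    HasDerivAt (fun t => cornerBlock n i (k t)) (eigProj n i 1 * k' * eigProj n i 1) t := by
  have h := (hasDerivAt_matrix_mul (hasDerivAt_matrix_mul (hasDerivAt_const t (eigProj n i 1)) hk)
    (hasDerivAt_const t (eigProj n i 1))).add_const (1 - eigProj n i 1)
  refine h.congr_deriv ?_
  simp

theorem hasDerivAt_nilOfColumn {k : ℝ → Mat n} {k' : Mat n} {t : ℝ} (hk : HasDerivAt k k' t)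
    (h1 : k t = 1) (hθ : theta k' = k') :
    HasDerivAt (fun t => nilOfColumn n i (k t * Ring.inverse (cornerBlock n i (k t)) *
      eigProj n i 1)) (nilPart n i k') t := by
  have hc : cornerBlock n i (k t) = 1 := by rw [h1, cornerBlock_one]
  have hb := hasDerivAt_matrix_inverse (hasDerivAt_cornerBlock (i := i) hk) hc
  have h := hasDerivAt_linear ((nilOfColumn n i).restrictScalars ℝ)
    (hasDerivAt_matrix_mul (hasDerivAt_matrix_mul hk hb) (hasDerivAt_const t (eigProj n i 1)))
  refine h.congr_deriv ?_
  rw [hc, h1, Ring.inverse_one, mul_zero, add_zero, mul_one, one_mul]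
  change nilOfColumn n i ((k' + -(eigProj n i 1 * k' * eigProj n i 1)) * eigProj n i 1) = _
  rw [add_mul, neg_mul, map_add, map_neg, nilOfColumn_mul k' hθ, mul_assoc, mul_assoc,
    nilOfColumn_eigProj_mul, neg_zero, add_zero]

theorem Ad_conj_image (σ : RealForm n) {u v : (Mat n)ˣ} {s : Set (Mat n)}
    (hs : ∀ A ∈ s, theta A = A) (h : ∀ A, theta A = A → conjMat σ (Ad u A) = Ad v (conjMat σ A))
    (hst : conjMat σ '' s = s) : conjMat σ '' (Ad u '' s) = Ad v '' s := by
  conv_rhs => rw [← hst]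
  rw [← Set.image_comp, ← Set.image_comp]
  exact Set.image_congr fun A hA => h A (hs A hA)

/-- Write exp(-tX) exp(Y) = exp(Y) k(t), with k(t) = exp(-Y) exp(-tX) exp(Y). For small t, k(t) =
exp(Z(t)) q(t) by `exists_factorization`. The velocity of Z at 0 is the 𝔫̄ component of -X', which
gives the derivative term, and χ(q(t)) = χ(k(t)) has derivative -λ_i(X'), which gives the
multiplication term. -/
theorem leftAction_eq {σ : RealForm n} (hσ : σ.conj (gradingElt n i) = gradingElt n i) (s : ℂ)
    {φ : oppNilReal σ i → ℂ} (Y : oppNilReal σ i) (hφ : DifferentiableAt ℝ φ Y) {X : Sp n}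
    (hX : σ.conj X = X) :
    leftAction σ i s X φ Y = -R hσ φ Y (adNeg (X : Mat n) (Y : Mat n)) +
      s * lam n i (adNeg (X : Mat n) (Y : Mat n)) * φ Y := by
  set X' := adNeg (X : Mat n) (Y : Mat n) with hX'
  have hθY := theta_oppNilReal σ Y
  have hnY := isNil_oppNilReal σ Y
  have hcY := conjMat_oppNilReal σ Y
  have hθX' : theta X' = X' := theta_adNeg (theta_coe X) hθY
  have hcX : conjMat σ (X : Mat n) = X := by rw [conjMat_coe, hX]
  have hcX' : conjMat σ X' = X' := by rw [hX', conjMat_adNeg σ (theta_coe X) hθY, hcX, hcY]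
  have hθt : ∀ t : ℝ, theta (-(t • (X : Mat n))) = -(t • (X : Mat n)) := fun t => by
    rw [map_neg, LinearMap.map_smul_of_tower, theta_coe]
  have hct : ∀ t : ℝ, conjMat σ (-(t • (X : Mat n))) = -(t • (X : Mat n)) := fun t => by
    rw [map_neg, (conjMat σ).map_smul, hcX]
  let k : ℝ → (Mat n)ˣ := fun t =>
    (expUnit (Y : Mat n))⁻¹ * expUnit (-(t • (X : Mat n))) * expUnit (Y : Mat n)
  have hkc : ∀ t, (k t : Mat n) = NormedSpace.exp (-(Y : Mat n)) *
      NormedSpace.exp (-(t • (X : Mat n))) * NormedSpace.exp (Y : Mat n) := fun t => rfl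
  have hk : ∀ t, IsSymplectic (k t) := fun t =>
    ((isSymplectic_expUnit hθY).inv.mul (isSymplectic_expUnit (hθt t))).mul
      (isSymplectic_expUnit hθY)
  have hk0 : ((k 0 : (Mat n)ˣ) : Mat n) = 1 := by
    rw [hkc, zero_smul, neg_zero, NormedSpace.exp_zero, mul_one, exp_neg_mul_exp]
  have hkd : HasDerivAt (fun t => ((k t : (Mat n)ˣ) : Mat n)) (-X') 0 := by
    have h := hasDerivAt_matrix_mul (hasDerivAt_matrix_mul (hasDerivAt_const (0 : ℝ)
      (NormedSpace.exp (-(Y : Mat n)))) (hasDerivAt_exp_neg_smul (X : Mat n) 0))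
      (hasDerivAt_const (0 : ℝ) (NormedSpace.exp (Y : Mat n)))
    refine h.congr_deriv ?_
    simp [hX', adNeg]
  have hkAd : ∀ t A, theta A = A → conjMat σ (Ad (k t) A) = Ad (k t) (conjMat σ A) := by
    intro t A hA
    have e : ∀ B C : Mat n, theta B = B → conjMat σ B = B → theta C = C →
        conjMat σ (Ad (expUnit B) C) = Ad (expUnit B) (conjMat σ C) := by
      intro B C hB hB' hC
      rw [Ad, coe_expUnit_inv, coe_expUnit, coe_expUnit, conjMat_exp_conj σ hB hC, hB']; rfl
    simp only [k, Ad_mul]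
    rw [coe_expUnit_inv, e _ _ (by rw [map_neg, hθY]) (by rw [map_neg, hcY]), e _ _ (hθt t) (hct t),
      e _ _ hθY hcY hA]
    · exact (isSymplectic_expUnit hθY).theta_Ad hA
    · exact (isSymplectic_expUnit (hθt t)).theta_Ad ((isSymplectic_expUnit hθY).theta_Ad hA)
  let Z : ℝ → Mat n := fun t => nilOfColumn n i
    ((k t : Mat n) * Ring.inverse (cornerBlock n i (k t : Mat n)) * eigProj n i 1)
  have hZd : HasDerivAt Z (nilPart n i (-X')) 0 :=
    hasDerivAt_nilOfColumn hkd hk0 (by rw [map_neg, hθX'])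
  have hZ0 : Z 0 = 0 := by
    simp only [Z]
    rw [hk0, cornerBlock_one, Ring.inverse_one, mul_one, one_mul, ← mul_one (eigProj n i 1),
      nilOfColumn_eigProj_mul]
  let c : ℝ → Mat n := fun t => (Y : Mat n) + leftInv (Y : Mat n) (Z t)
  have hcd : HasDerivAt c (leftInv (Y : Mat n) (nilPart n i (-X'))) 0 :=
    (hasDerivAt_linear ((leftInv (Y : Mat n)).restrictScalars ℝ) hZd).const_add _
  have hev : ∀ᶠ t in nhds (0 : ℝ), bundleSection σ i s φ
      (NormedSpace.exp (-(t • (X : Mat n))) * NormedSpace.exp (Y : Mat n)) =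
      ((‖chi i (k t : Mat n)‖ : ℝ) : ℂ) ^ (-s) * φ (realPart hσ (c t)) := by
    have hu : ∀ᶠ t in nhds (0 : ℝ), IsUnit (cornerBlock n i (k t : Mat n)) :=
      eventually_isUnit (hasDerivAt_cornerBlock (i := i) hkd) (by rw [hk0, cornerBlock_one])
    filter_upwards [hu] with t ht
    obtain ⟨hθZ, hnZ, hq, hcor⟩ := exists_factorization (Z := Z t) (hk t) ht rfl
    -- exp(Z) and k move 𝔮 to the same subalgebra. Conjugation by k commutes with the real structure
    -- and 𝔮 is stable under it, so the conjugate of Z gives that subalgebra too, and injectivity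
    -- shows that Z is real.
    have hZc : conjMat σ (Z t) = Z t := by
      have hθcZ := theta_conjMat σ (Z t)
      refine (nil_eq_of_Ad_image_eq hnZ (conjMat_isNil σ hσ hnZ) ?_).symm
      have e1 : Ad (expUnit (Z t)) '' parSet n i = Ad (k t) '' parSet n i := by
        conv_lhs => rw [← hq, ← Ad_mul_image, mul_inv_cancel_left]
      have hs : ∀ A ∈ parSet n i, theta A = A := fun A hA => (mem_parSet.1 hA).1
      have e2 := Ad_conj_image σ hs (hkAd t) (conjMat_parSet σ hσ)
      have e3 := Ad_conj_image σ (u := expUnit (Z t)) (v := expUnit (conjMat σ (Z t))) hs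
        (fun A hA => by
          rw [Ad, coe_expUnit_inv, coe_expUnit, coe_expUnit, conjMat_exp_conj σ hθZ hA]; rfl)
        (conjMat_parSet σ hσ)
      rw [← e3, e1, e2]
    have hZm : Z t ∈ oppNilReal σ i := (mem_oppNilReal σ).2 ⟨hθZ, hnZ, hZc⟩
    have hcm : c t ∈ oppNilReal σ i := add_mem Y.2 (leftInv_mem σ Y.2 hZm)
    have hcr : realPart hσ (c t) = ⟨c t, hcm⟩ := realPart_coe hσ ⟨c t, hcm⟩
    have hqG : (expUnit (Z t))⁻¹ * k t ∈ groupQ σ i := by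
      rw [mem_groupQ]
      refine ⟨?_, hq⟩
      have hYG := expUnit_mem_groupG σ hθY hcY
      exact mul_mem (inv_mem (expUnit_mem_groupG σ hθZ hZc))
        (mul_mem (mul_mem (inv_mem hYG) (expUnit_mem_groupG σ (hθt t) (hct t))) hYG)
    have hfac : NormedSpace.exp (-(t • (X : Mat n))) * NormedSpace.exp (Y : Mat n) =
        NormedSpace.exp (c t) * (((expUnit (Z t))⁻¹ * k t : (Mat n)ˣ) : Mat n) := by
      have h1 : expUnit (-(t • (X : Mat n))) * expUnit (Y : Mat n) =
          (expUnit (Y : Mat n) * expUnit (Z t)) * ((expUnit (Z t))⁻¹ * k t) := by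
        simp only [k]; group
      have h2 := congrArg (fun u : (Mat n)ˣ => (u : Mat n)) h1
      simp only [Units.val_mul] at h2
      rw [coe_expUnit, coe_expUnit, coe_expUnit, exp_mul_exp_eq hnY hnZ] at h2
      rw [h2]; rfl
    rw [hfac, hcr, ← chi_eq_of_corner hcor]
    exact bundleSection_eq σ s φ ⟨c t, hcm⟩ hqG
  have hchi0 : chi i (k 0 : Mat n) = 1 := by rw [hk0, chi_one]
  have hchi : HasDerivAt (fun t => chi i (k t : Mat n)) (-lam n i X') 0 := by
    rw [← map_neg, ← trace_block (A := -X') (by rw [map_neg, hθX'])]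
    refine hasDerivAt_det (fun p q => ?_) ?_
    · exact hasDerivAt_linear (V := ℂ) (Matrix.entryLinearMap ℝ ℂ (Sum.inl p.1) (Sum.inl q.1)) hkd
    · rw [hk0]
      ext p q
      rw [Matrix.submatrix_apply, Matrix.one_apply, Matrix.one_apply]
      simp [Subtype.ext_iff]
  -- log |χ| is the real part of log χ, and taking real parts does not change -λ_i(X') because X' is
  -- real.
  have hlog : HasDerivAt (fun t => ((Real.log ‖chi i (k t : Mat n)‖ : ℝ) : ℂ)) (-lam n i X') 0 := by
    have h1 := hchi.clog_real (by rw [hchi0]; exact Complex.one_mem_slitPlane)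
    rw [hchi0, div_one] at h1
    have h2 := (Complex.reCLM.hasFDerivAt.comp_hasDerivAt (0 : ℝ) h1).ofReal_comp
    have h3 : ((Complex.reCLM (-lam n i X') : ℝ) : ℂ) = -lam n i X' := by
      rw [map_neg, Complex.ofReal_neg]
      exact congrArg Neg.neg (lam_real σ hσ hθX' hcX')
    rw [h3] at h2
    refine h2.congr_of_eventuallyEq (Filter.Eventually.of_forall fun t => ?_)
    change _ = ((Complex.log _).re : ℂ)
    rw [Complex.log_re]
  have hpow : HasDerivAt (fun t => ((‖chi i (k t : Mat n)‖ : ℝ) : ℂ) ^ (-s))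
      (s * lam n i X') 0 := by
    have h1 := (hlog.mul_const (-s)).cexp
    rw [hchi0, norm_one, Real.log_one, Complex.ofReal_zero, zero_mul, Complex.exp_zero,
      one_mul] at h1
    refine (h1.congr_of_eventuallyEq ?_).congr_deriv (by ring)
    have hne : ∀ᶠ t in nhds (0 : ℝ), chi i (k t : Mat n) ≠ 0 :=
      hchi.continuousAt.eventually_ne (by rw [hchi0]; exact one_ne_zero)
    filter_upwards [hne] with t ht
    rw [Complex.cpow_def_of_ne_zero (by exact_mod_cast norm_ne_zero_iff.2 ht), Complex.ofReal_log
      (norm_nonneg _)]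
  have hc0 : realPart hσ (c 0) = Y := by
    simp only [c]
    rw [hZ0, map_zero, add_zero, realPart_coe]
  have hφd : HasDerivAt (fun t => φ (realPart hσ (c t)))
      (dirDeriv φ Y (realPart hσ (leftInv (Y : Mat n) (nilPart n i (-X'))))) 0 :=
    hasDerivAt_comp_dirDeriv hφ hc0 (hasDerivAt_linear (realPart hσ) hcd)
  have hfin := (hpow.mul hφd).congr_of_eventuallyEq hev
  rw [leftAction, hfin.deriv, hc0, hchi0, norm_one, Complex.ofReal_one, Complex.one_cpow, one_mul]
  have hnm : nilPart n i X' ∈ oppNilReal σ i := by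
    rw [mem_oppNilReal]
    refine ⟨theta_nilPart hθX', isNil_nilPart _, ?_⟩
    rw [nilPart_apply, map_add, conjMat_prDeg σ hσ, conjMat_prDeg σ hσ, hcX']
  have hR : R hσ φ Y X' = dirDeriv φ Y (realPart hσ (leftInv (Y : Mat n) (nilPart n i X'))) := by
    rw [← R_nilProj, nilProj_of_theta hθX']
    rw [R_coe hσ φ Y ⟨_, hnm⟩]
    congr 1
    exact (realPart_coe hσ ⟨_, leftInv_mem σ Y.2 hnm⟩).symm
  rw [hR, map_neg, map_neg, map_neg, map_neg]
  ring

end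

/-! ### Calculus of right differentiation -/

section
variable {n i : ℕ} {σ : RealForm n} (hσ : σ.conj (gradingElt n i) = gradingElt n i)

theorem contDiff_coe : ContDiff ℝ ∞ fun Y : oppNilReal σ i => (Y : Mat n) :=
  (LinearMap.toContinuousLinearMap (oppNilReal σ i).subtype).contDiff

theorem contDiff_exp : ContDiff ℝ ∞ fun Y : oppNilReal σ i => NormedSpace.exp (Y : Mat n) := by
  have h : (fun Y : oppNilReal σ i => NormedSpace.exp (Y : Mat n)) =
      fun Y : oppNilReal σ i => 1 + (Y : Mat n) + (2⁻¹ : ℝ) • ((Y : Mat n) * (Y : Mat n)) := by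
    ext1 Y
    rw [(isNil_oppNilReal σ Y).exp_eq, ← Complex.coe_smul]
    push_cast; rfl
  rw [h]
  exact (contDiff_const.add contDiff_coe).add
    ((contDiff_matrix_mul contDiff_coe contDiff_coe).const_smul (2⁻¹ : ℝ))

theorem contDiff_adNeg (X : Mat n) :
    ContDiff ℝ ∞ fun Y : oppNilReal σ i => adNeg X (Y : Mat n) := by
  have h : ContDiff ℝ ∞ fun Y : oppNilReal σ i => NormedSpace.exp (-(Y : Mat n)) := by
    have := (contDiff_exp (σ := σ) (i := i)).comp (contDiff_neg (𝕜 := ℝ) (F := oppNilReal σ i))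
    exact this
  exact contDiff_matrix_mul (contDiff_matrix_mul h contDiff_const) contDiff_exp

theorem contDiff_linear_adNeg (X : Mat n) (ℓ : Mat n →ₗ[ℂ] ℂ) :
    ContDiff ℝ ∞ fun Y : oppNilReal σ i => ℓ (adNeg X (Y : Mat n)) :=
  contDiff_linear (ℓ.restrictScalars ℝ) (contDiff_adNeg X)

theorem contDiff_R {φ : oppNilReal σ i → ℂ} (hφ : ContDiff ℝ ∞ φ) (A : Mat n) :
    ContDiff ℝ ∞ fun Y => R hσ φ Y A := by
  have hU : ContDiff ℝ ∞ fun Y : oppNilReal σ i => leftInv (Y : Mat n) (nilProj n i A) := by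
    have : (fun Y : oppNilReal σ i => leftInv (Y : Mat n) (nilProj n i A)) =
        fun Y : oppNilReal σ i => nilProj n i A + (2⁻¹ : ℝ) • ((Y : Mat n) * nilProj n i A -
          nilProj n i A * (Y : Mat n)) := by
      ext1 Y
      rw [leftInv_apply, ← Complex.coe_smul]
      push_cast; rfl
    rw [this]
    exact contDiff_const.add (((contDiff_matrix_mul contDiff_coe contDiff_const).sub
      (contDiff_matrix_mul contDiff_const contDiff_coe)).const_smul (2⁻¹ : ℝ))
  have h1 := contDiff_dirDeriv hφ contDiff_id (contDiff_linear (realPart hσ) hU)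
  have h2 := contDiff_dirDeriv hφ contDiff_id (contDiff_linear (realPart hσ ∘ₗ
    (LinearMap.lsmul ℂ (Mat n) Complex.I).restrictScalars ℝ) hU)
  exact h1.sub (contDiff_const.mul h2)

theorem R_add {φ ψ : oppNilReal σ i → ℂ} {Y : oppNilReal σ i} (hφ : DifferentiableAt ℝ φ Y)
    (hψ : DifferentiableAt ℝ ψ Y) (A : Mat n) :
    R hσ (fun Y => φ Y + ψ Y) Y A = R hσ φ Y A + R hσ ψ Y A := by
  simp only [R_apply, cext_apply]
  simp only [dirDeriv_add hφ hψ]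
  ring

theorem R_mul {φ ψ : oppNilReal σ i → ℂ} {Y : oppNilReal σ i} (hφ : DifferentiableAt ℝ φ Y)
    (hψ : DifferentiableAt ℝ ψ Y) (A : Mat n) :
    R hσ (fun Y => φ Y * ψ Y) Y A = φ Y * R hσ ψ Y A + ψ Y * R hσ φ Y A := by
  simp only [R_apply, cext_apply]
  simp only [dirDeriv_mul hφ hψ]
  ring

theorem R_const_mul {φ : oppNilReal σ i → ℂ} {Y : oppNilReal σ i} (hφ : DifferentiableAt ℝ φ Y)
    (c : ℂ) (A : Mat n) :
    R hσ (fun Y => c * φ Y) Y A = c * R hσ φ Y A := by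
  simp only [R_apply, cext_apply]
  simp only [dirDeriv_const_mul hφ]
  ring

theorem R_sum {κ : Type*} (u : Finset κ) {φ : κ → oppNilReal σ i → ℂ} {Y : oppNilReal σ i}
    (hφ : ∀ k ∈ u, DifferentiableAt ℝ (φ k) Y) (A : Mat n) :
    R hσ (fun Y => ∑ k ∈ u, φ k Y) Y A = ∑ k ∈ u, R hσ (φ k) Y A := by
  simp only [R_apply, cext_apply]
  simp only [dirDeriv_sum u hφ]
  rw [Finset.sum_sub_distrib, Finset.mul_sum]

theorem smooth_differentiableAt {φ : oppNilReal σ i → ℂ} (hφ : ContDiff ℝ ∞ φ)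
    (Y : oppNilReal σ i) : DifferentiableAt ℝ φ Y :=
  (hφ.differentiable (by simp)) Y

/-- The second order operator `φ ↦ R(B) R(A) φ`, as a function of `A` and `B`. -/
def RR {φ : oppNilReal σ i → ℂ} (hφ : ContDiff ℝ ∞ φ) (Y : oppNilReal σ i) :
    Mat n →ₗ[ℂ] Mat n →ₗ[ℂ] ℂ where
  toFun A := R hσ (fun Y => R hσ φ Y A) Y
  map_add' A B := by
    ext1 C
    have h := fun A => smooth_differentiableAt (contDiff_R hσ hφ A) Y
    simp only [map_add]
    rw [R_add hσ (h A) (h B)]; rfl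
  map_smul' c A := by
    ext1 C
    have h := fun A => smooth_differentiableAt (contDiff_R hσ hφ A) Y
    simp only [map_smul, smul_eq_mul]
    rw [R_const_mul hσ (h A)]; rfl

theorem RR_apply {φ : oppNilReal σ i → ℂ} (hφ : ContDiff ℝ ∞ φ) (Y : oppNilReal σ i) (A B : Mat n) :
    RR hσ hφ Y A B = R hσ (fun Y => R hσ φ Y A) Y B := rfl

theorem RR_nilProj {φ : oppNilReal σ i → ℂ} (hφ : ContDiff ℝ ∞ φ) (Y : oppNilReal σ i)
    (A B : Mat n) : RR hσ hφ Y (nilProj n i A) (nilProj n i B) = RR hσ hφ Y A B := by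
  simp only [RR_apply, R_nilProj]

/-- In exponential coordinates the left invariant fields are affine, so `dirDeriv_dirDeriv_sub`
computes their commutator; two-step nilpotency identifies it with the field of the bracket. The
operator applied first is the first argument of `RR`. -/
theorem RR_real_sub {φ : oppNilReal σ i → ℂ} (hφ : ContDiff ℝ ∞ φ) (Y a b : oppNilReal σ i) :
    RR hσ hφ Y (b : Mat n) (a : Mat n) - RR hσ hφ Y (a : Mat n) (b : Mat n) =
      R hσ φ Y ((a : Mat n) * b - b * a) := by
  let L : oppNilReal σ i → oppNilReal σ i →ₗ[ℝ] oppNilReal σ i := fun b =>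
    realPart hσ ∘ₗ ((2⁻¹ : ℝ) • ((LinearMap.mulRight ℝ (b : Mat n) -
      LinearMap.mulLeft ℝ (b : Mat n)) ∘ₗ (oppNilReal σ i).subtype))
  let v : oppNilReal σ i → oppNilReal σ i → oppNilReal σ i := fun b Y => b + L b Y
  have hL : ∀ a b : oppNilReal σ i, ((L b a : oppNilReal σ i) : Mat n) =
      (2⁻¹ : ℝ) • ((a : Mat n) * b - b * a) := by
    intro a b
    have hm : (2⁻¹ : ℝ) • ((a : Mat n) * b - b * a) ∈ oppNilReal σ i := by
      refine Submodule.smul_mem _ _ ((mem_oppNilReal σ).2 ⟨theta_lie (theta_oppNilReal σ a)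
        (theta_oppNilReal σ b), ((isNil_oppNilReal σ a).isDeg_lie (isNil_oppNilReal σ b)).isNil_two,
        ?_⟩)
      rw [conjMat_lie σ (theta_oppNilReal σ a) (theta_oppNilReal σ b), conjMat_oppNilReal,
        conjMat_oppNilReal]
    exact congrArg Subtype.val (realPart_coe hσ ⟨_, hm⟩)
  have hv : ∀ b Y, ((v b Y : oppNilReal σ i) : Mat n) = leftInv (Y : Mat n) (b : Mat n) := by
    intro b Y
    change (b : Mat n) + ((L b Y : oppNilReal σ i) : Mat n) = _
    rw [hL, leftInv_apply, ← Complex.coe_smul]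
    push_cast; rfl
  have hR : ∀ (ψ : oppNilReal σ i → ℂ) (Y b : oppNilReal σ i),
      R hσ ψ Y (b : Mat n) = dirDeriv ψ Y (b + L b Y) := by
    intro ψ Y b
    rw [R_coe]
    congr 1
    exact Subtype.ext (hv b Y).symm
  have hd := dirDeriv_dirDeriv_sub (Y := Y) hφ a b (L b) (L a)
  simp only [← hR] at hd
  refine hd.trans ?_
  have h4 : ((L b (v a Y) - L a (v b Y) : oppNilReal σ i) : Mat n) =
      leftInv (Y : Mat n) ((a : Mat n) * b - b * a) := by
    have ha := isNil_oppNilReal σ a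
    have hb := isNil_oppNilReal σ b
    have hY := isNil_oppNilReal σ Y
    rw [Submodule.coe_sub, hL, hL, hv, hv, leftInv_apply, leftInv_apply, leftInv_apply,
      hY.mul_eq_zero (ha.isDeg_lie hb), (ha.isDeg_lie hb).mul_nil_eq_zero hY]
    simp only [add_mul, mul_add, Matrix.smul_mul, Matrix.mul_smul,
      (hY.isDeg_lie ha).mul_nil_eq_zero hb, hb.mul_eq_zero (hY.isDeg_lie ha),
      (hY.isDeg_lie hb).mul_nil_eq_zero ha, ha.mul_eq_zero (hY.isDeg_lie hb), smul_zero, add_zero,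
      sub_zero]
    module
  have hm : (a : Mat n) * b - b * a ∈ oppNilReal σ i := by
    refine (mem_oppNilReal σ).2 ⟨theta_lie (theta_oppNilReal σ a) (theta_oppNilReal σ b),
      ((isNil_oppNilReal σ a).isDeg_lie (isNil_oppNilReal σ b)).isNil_two, ?_⟩
    rw [conjMat_lie σ (theta_oppNilReal σ a) (theta_oppNilReal σ b), conjMat_oppNilReal,
      conjMat_oppNilReal]
  rw [show (a : Mat n) * b - b * a = ((⟨_, hm⟩ : oppNilReal σ i) : Mat n) from rfl, R_coe]
  congr 1
  exact Subtype.ext h4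

theorem RR_sub {φ : oppNilReal σ i → ℂ} (hφ : ContDiff ℝ ∞ φ) (Y : oppNilReal σ i) {A B : Mat n}
    (hA : nilProj n i A = A) (hB : nilProj n i B = B) :
    RR hσ hφ Y B A - RR hσ hφ Y A B = R hσ φ Y (A * B - B * A) := by
  have h1 : ∀ a : oppNilReal σ i, ∀ B : Mat n, nilProj n i B = B →
      RR hσ hφ Y B (a : Mat n) - RR hσ hφ Y (a : Mat n) B = R hσ φ Y ((a : Mat n) * B - B * a) := by
    intro a B hB
    exact eq_of_eq_on_real hσ (f := (RR hσ hφ Y).flip (a : Mat n) - RR hσ hφ Y (a : Mat n))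
      (g := R hσ φ Y ∘ₗ (LinearMap.mulLeft ℂ (a : Mat n) - LinearMap.mulRight ℂ (a : Mat n)))
      (fun b => RR_real_sub hσ hφ Y a b) hB
  exact eq_of_eq_on_real hσ (f := RR hσ hφ Y B - (RR hσ hφ Y).flip B)
    (g := R hσ φ Y ∘ₗ (LinearMap.mulRight ℂ B - LinearMap.mulLeft ℂ B))
    (fun a => h1 a B hB) hA

/-- Moving from exp Y to exp(Y) exp(ta) turns X' into exp(-ta) X' exp(ta), whose derivative is minus
the bracket of a with X'. -/
theorem R_linear_adNeg (X : Mat n) (ℓ : Mat n →ₗ[ℂ] ℂ) (Y : oppNilReal σ i) {A : Mat n}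
    (hA : nilProj n i A = A) :
    R hσ (fun Y => ℓ (adNeg X (Y : Mat n))) Y A =
      -ℓ (A * adNeg X (Y : Mat n) - adNeg X (Y : Mat n) * A) := by
  refine eq_of_eq_on_real hσ
    (g := -(ℓ ∘ₗ (LinearMap.mulRight ℂ (adNeg X (Y : Mat n)) -
      LinearMap.mulLeft ℂ (adNeg X (Y : Mat n))))) (fun a => ?_) hA
  change _ = -ℓ ((a : Mat n) * adNeg X (Y : Mat n) - adNeg X (Y : Mat n) * a)
  rw [R_coe]
  refine (hasDerivAt_line (smooth_differentiableAt (contDiff_linear_adNeg X ℓ) Y)).deriv.symm.trans ?_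
  have hY := isNil_oppNilReal σ Y
  have ha := isNil_oppNilReal σ a
  have hfun : (fun t : ℝ => ℓ (adNeg X ((Y + t • ⟨leftInv (Y : Mat n) (a : Mat n),
      leftInv_mem σ Y.2 a.2⟩ : oppNilReal σ i) : Mat n))) = fun t : ℝ =>
      ℓ (NormedSpace.exp (-(t • (a : Mat n))) * adNeg X (Y : Mat n) *
        NormedSpace.exp (t • (a : Mat n))) := by
    ext1 t
    congr 1
    have e1 : ((Y + t • ⟨leftInv (Y : Mat n) (a : Mat n),
        leftInv_mem σ Y.2 a.2⟩ : oppNilReal σ i) : Mat n) =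
        (Y : Mat n) + leftInv (Y : Mat n) (t • (a : Mat n)) := by
      rw [LinearMap.map_smul_of_tower]; rfl
    have e2 := exp_mul_exp_eq hY (ha.real_smul t)
    have e3 : NormedSpace.exp (-((Y : Mat n) + leftInv (Y : Mat n) (t • (a : Mat n)))) =
        NormedSpace.exp (-(t • (a : Mat n))) * NormedSpace.exp (-(Y : Mat n)) := by
      have : NormedSpace.exp (-(t • (a : Mat n))) * NormedSpace.exp (-(Y : Mat n)) *
          NormedSpace.exp ((Y : Mat n) + leftInv (Y : Mat n) (t • (a : Mat n))) = 1 := by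
        rw [← e2, mul_assoc, ← mul_assoc (NormedSpace.exp (-(Y : Mat n))), exp_neg_mul_exp, one_mul,
          exp_neg_mul_exp]
      rw [← mul_one (NormedSpace.exp (-(t • (a : Mat n))) * NormedSpace.exp (-(Y : Mat n))),
        ← exp_mul_exp_neg ((Y : Mat n) + leftInv (Y : Mat n) (t • (a : Mat n))), ← mul_assoc, this,
        one_mul]
    rw [e1, adNeg, e3, ← e2, adNeg]
    simp only [mul_assoc]
  rw [hfun]
  have h := hasDerivAt_linear (ℓ.restrictScalars ℝ) (hasDerivAt_matrix_mul (hasDerivAt_matrix_mul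
    (hasDerivAt_exp_neg_smul (a : Mat n) 0) (hasDerivAt_const (0 : ℝ) (adNeg X (Y : Mat n))))
    (hasDerivAt_exp_smul (a : Mat n) 0))
  refine h.deriv.trans ?_
  rw [← map_neg]
  change ℓ _ = _
  congr 1
  simp only [zero_smul, neg_zero, NormedSpace.exp_zero, one_mul, mul_one, mul_zero, add_zero]
  noncomm_ring

theorem R_eq_sum (φ : oppNilReal σ i → ℂ) (Y : oppNilReal σ i) (A : Mat n) :
    R hσ φ Y A = ∑ p, ∑ q, A p q * R hσ φ Y (Matrix.single p q 1) := by
  conv_lhs => rw [Matrix.matrix_eq_sum_single A]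
  simp only [map_sum]
  refine Finset.sum_congr rfl fun p _ => Finset.sum_congr rfl fun q _ => ?_
  rw [← smul_eq_mul, ← map_smul, Matrix.smul_single, smul_eq_mul, mul_one]

theorem contDiff_R_adNeg {φ : oppNilReal σ i → ℂ} (hφ : ContDiff ℝ ∞ φ) (X : Mat n)
    (N : Mat n →ₗ[ℂ] Mat n) :
    ContDiff ℝ ∞ fun Y : oppNilReal σ i => R hσ φ Y (N (adNeg X (Y : Mat n))) := by
  simp only [R_eq_sum hσ _ _ (N _)]
  exact ContDiff.sum fun p _ => ContDiff.sum fun q _ =>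
    (contDiff_linear_adNeg X (Matrix.entryLinearMap ℂ ℂ p q ∘ₗ N)).mul (contDiff_R hσ hφ _)

/-- The product rule: the vector being differentiated along depends on Y through X', and expanding
it in matrix units separates its coefficients from the operators. -/
theorem R_R_adNeg {φ : oppNilReal σ i → ℂ} (hφ : ContDiff ℝ ∞ φ) (X : Mat n)
    (N : Mat n →ₗ[ℂ] Mat n) (Y : oppNilReal σ i) {A : Mat n} (hA : nilProj n i A = A) :
    R hσ (fun Y => R hσ φ Y (N (adNeg X (Y : Mat n)))) Y A =
      RR hσ hφ Y (N (adNeg X (Y : Mat n))) A -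
        R hσ φ Y (N (A * adNeg X (Y : Mat n) - adNeg X (Y : Mat n) * A)) := by
  have h1 : (fun Y : oppNilReal σ i => R hσ φ Y (N (adNeg X (Y : Mat n)))) =
      fun Y : oppNilReal σ i =>
      ∑ p, ∑ q, (Matrix.entryLinearMap ℂ ℂ p q ∘ₗ N) (adNeg X (Y : Mat n)) *
        R hσ φ Y (Matrix.single p q 1) := by
    ext1 Y
    rw [R_eq_sum]; rfl
  have d1 := fun p q => smooth_differentiableAt (contDiff_linear_adNeg (σ := σ) (i := i) X
    (Matrix.entryLinearMap ℂ ℂ p q ∘ₗ N)) Y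
  have d2 := fun p q => smooth_differentiableAt (contDiff_R hσ hφ (Matrix.single p q 1)) Y
  rw [h1, R_sum hσ _ (fun p _ => DifferentiableAt.fun_sum fun q _ => (d1 p q).fun_mul (d2 p q))]
  have h2 : RR hσ hφ Y (N (adNeg X (Y : Mat n))) A = ∑ p, ∑ q, N (adNeg X (Y : Mat n)) p q *
      RR hσ hφ Y (Matrix.single p q 1) A := by
    conv_lhs => rw [Matrix.matrix_eq_sum_single (N (adNeg X (Y : Mat n)))]
    simp only [map_sum, LinearMap.sum_apply]
    refine Finset.sum_congr rfl fun p _ => Finset.sum_congr rfl fun q _ => ?_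
    rw [← smul_eq_mul, ← LinearMap.smul_apply, ← map_smul, Matrix.smul_single, smul_eq_mul, mul_one]
  rw [h2, R_eq_sum hσ φ Y (N _), ← Finset.sum_sub_distrib]
  refine Finset.sum_congr rfl fun p _ => ?_
  rw [R_sum hσ _ (fun q _ => (d1 p q).fun_mul (d2 p q)), ← Finset.sum_sub_distrib]
  refine Finset.sum_congr rfl fun q _ => ?_
  rw [R_mul hσ (d1 p q) (d2 p q), R_linear_adNeg hσ X _ Y hA, RR_apply]
  change N (adNeg X (Y : Mat n)) p q * _ + R hσ φ Y (Matrix.single p q 1) *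
    -(N _ p q) = _
  ring

end

/-! ### Commutators with the action of the Lie algebra -/

section
variable {n i : ℕ} {σ : RealForm n} (hσ : σ.conj (gradingElt n i) = gradingElt n i)

theorem nilProj_isDeg {d : ℤ} {A : Mat n} (hA : IsDeg i d A) (hd : 0 ≤ d) : nilProj n i A = 0 := by
  change (2⁻¹ : ℂ) • (nilPart n i A + theta (nilPart n i A)) = 0
  rw [nilPart_apply, hA.prDeg_eq_zero (by omega), hA.prDeg_eq_zero (by omega)]
  simp

theorem R_eq_zero {d : ℤ} {A : Mat n} (hA : IsDeg i d A) (hd : 0 ≤ d) (φ : oppNilReal σ i → ℂ)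
    (Y : oppNilReal σ i) : R hσ φ Y A = 0 := by
  rw [← R_nilProj, nilProj_isDeg hA hd, map_zero]

theorem lam_eq_zero {d : ℤ} {A : Mat n} (hA : IsDeg i d A) (hd : d ≠ 0) : lam n i A = 0 := by
  have h : IsDeg i 0 (gradingElt n i : Mat n) := by
    rw [← mem_gr, gr, Module.End.mem_eigenspace_iff, LieAlgebra.ad_apply, lie_self]; simp
  rw [lam_apply, (h.mul hA).trace_eq_zero (by omega), mul_zero]

/-- Bracket with `B`. -/
def brk (B : Mat n) : Mat n →ₗ[ℂ] Mat n := LinearMap.mulLeft ℂ B - LinearMap.mulRight ℂ B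

theorem brk_apply (B A : Mat n) : brk B A = B * A - A * B := rfl

theorem lam_brk {A B : Mat n} (hB : IsDeg i 1 B) : lam n i (brk A B) = -2⁻¹ * (A * B).trace := by
  have h : (gradingElt n i : Mat n) * B = B + B * (gradingElt n i : Mat n) := by
    have := hB.lie_grading
    rwa [Int.cast_one, one_smul, sub_eq_iff_eq_add] at this
  have e : ((gradingElt n i : Mat n) * brk A B).trace =
      (A * (B * (gradingElt n i : Mat n) - (gradingElt n i : Mat n) * B)).trace := by
    rw [brk_apply, mul_sub, mul_sub, Matrix.trace_sub, Matrix.trace_sub,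
      Matrix.trace_mul_comm _ (A * B), mul_assoc A, ← mul_assoc _ B A, Matrix.trace_mul_comm _ A]
  rw [lam_apply, e, h, sub_add_cancel_right, mul_neg, Matrix.trace_neg]
  ring

/-- The formula for the action of `X` on sections. -/
def act (s : ℂ) (X : Mat n) (φ : oppNilReal σ i → ℂ) (Y : oppNilReal σ i) : ℂ :=
  -R hσ φ Y (adNeg X (Y : Mat n)) + s * lam n i (adNeg X (Y : Mat n)) * φ Y

theorem contDiff_act {φ : oppNilReal σ i → ℂ} (hφ : ContDiff ℝ ∞ φ) (s : ℂ) (X : Mat n) :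
    ContDiff ℝ ∞ (act hσ s X φ) :=
  (contDiff_R_adNeg hσ hφ X LinearMap.id).neg.add
    ((contDiff_const.mul (contDiff_linear_adNeg X (lam n i))).mul hφ)

/-- The component of nonnegative degree. -/
def parPart (n i : ℕ) : Mat n →ₗ[ℂ] Mat n := LinearMap.id - nilPart n i

/-- The second order terms leave the bracket of A with the 𝔫̄ component of X'. It cancels the 𝔫̄
part of the derivative of X' along A, as it must because left and right translations commute; only
the component of X' in 𝔮 remains. -/
theorem act_R_sub {φ : oppNilReal σ i → ℂ} (hφ : ContDiff ℝ ∞ φ) (s : ℂ) {X : Mat n}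
    (hX : theta X = X) (Y : oppNilReal σ i) {A : Mat n} (hA : nilProj n i A = A) :
    act hσ s X (fun Y => R hσ φ Y A) Y - R hσ (act hσ s X φ) Y A =
      -R hσ φ Y (brk A (parPart n i (adNeg X (Y : Mat n)))) +
        s * lam n i (brk A (adNeg X (Y : Mat n))) * φ Y := by
  have d1 := smooth_differentiableAt (contDiff_R_adNeg hσ hφ X LinearMap.id) Y
  have d2 := smooth_differentiableAt (contDiff_linear_adNeg (σ := σ) X (lam n i)) Y
  have d3 := smooth_differentiableAt hφ Y
  have h1 : R hσ (act hσ s X φ) Y A =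
      -(RR hσ hφ Y (adNeg X (Y : Mat n)) A - R hσ φ Y (brk A (adNeg X (Y : Mat n)))) +
      s * (lam n i (adNeg X (Y : Mat n)) * R hσ φ Y A -
        φ Y * lam n i (brk A (adNeg X (Y : Mat n)))) := by
    have e : act hσ s X φ = fun Y : oppNilReal σ i =>
        (-1 : ℂ) * R hσ φ Y ((LinearMap.id : Mat n →ₗ[ℂ] Mat n) (adNeg X (Y : Mat n))) +
        s * (lam n i (adNeg X (Y : Mat n)) * φ Y) := by
      ext1 Y
      rw [act, LinearMap.id_apply]; ring
    rw [e, R_add hσ (d1.const_mul (-1 : ℂ)) ((d2.fun_mul d3).const_mul s), R_const_mul hσ d1,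
      R_const_mul hσ (d2.fun_mul d3), R_mul hσ d2 d3, R_R_adNeg hσ hφ X LinearMap.id Y hA,
      R_linear_adNeg hσ X (lam n i) Y hA]
    simp only [LinearMap.id_apply, brk_apply]
    ring
  have h2 : RR hσ hφ Y A (adNeg X (Y : Mat n)) - RR hσ hφ Y (adNeg X (Y : Mat n)) A =
      -R hσ φ Y (brk A (nilPart n i (adNeg X (Y : Mat n)))) := by
    have hθ := theta_adNeg hX (theta_oppNilReal σ Y)
    rw [← RR_nilProj, ← RR_nilProj hσ hφ Y (adNeg X (Y : Mat n)),
      RR_sub hσ hφ Y (nilProj_eq (theta_nilProj _) (isNil_nilProj _))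
      (nilProj_eq (theta_nilProj _) (isNil_nilProj _)), hA, nilProj_of_theta hθ, brk_apply,
      ← map_neg, neg_sub]
  have h3 : R hσ φ Y (brk A (parPart n i (adNeg X (Y : Mat n)))) =
      R hσ φ Y (brk A (adNeg X (Y : Mat n))) -
        R hσ φ Y (brk A (nilPart n i (adNeg X (Y : Mat n)))) := by
    rw [← map_sub, ← map_sub]; rfl
  rw [h1, h3, act]
  rw [RR_apply] at h2
  linear_combination -h2

/-- The homogeneous component of `Ad(exp(-Y)) X` of degree `d`. -/
def comp (i : ℕ) (d : ℤ) (X : Mat n) (Y : oppNilReal σ i) : Mat n := prDeg i d (adNeg X (Y : Mat n))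

theorem isDeg_comp (d : ℤ) (X : Mat n) (Y : oppNilReal σ i) : IsDeg i d (comp i d X Y) :=
  isDeg_prDeg _

theorem parPart_adNeg (X : Mat n) (Y : oppNilReal σ i) :
    parPart n i (adNeg X (Y : Mat n)) = comp i 0 X Y + comp i 1 X Y + comp i 2 X Y := by
  change adNeg X (Y : Mat n) - nilPart n i _ = _
  rw [sub_eq_iff_eq_add]
  conv_lhs => rw [← sum_prDeg (i := i) (adNeg X (Y : Mat n))]
  rw [nilPart_apply, comp, comp, comp]
  abel

theorem adNeg_eq (X : Mat n) (Y : oppNilReal σ i) : adNeg X (Y : Mat n) =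
    comp i (-2) X Y + comp i (-1) X Y + comp i 0 X Y + comp i 1 X Y + comp i 2 X Y :=
  (sum_prDeg (i := i) (adNeg X (Y : Mat n))).symm

theorem IsDeg.brk {d e : ℤ} {A B : Mat n} (hA : IsDeg i d A) (hB : IsDeg i e B) :
    IsDeg i (d + e) (brk A B) := hA.lie hB

/-- `R` sees only negative degrees and λ_i only degree 0, so for A of degree -1 just X_0 and X_1
contribute. -/
theorem act_R_sub' {φ : oppNilReal σ i → ℂ} (hφ : ContDiff ℝ ∞ φ) (s : ℂ) {X : Mat n}
    (hX : theta X = X) (Y : oppNilReal σ i) {A : Mat n} (hA : IsDeg i (-1) A) (hA' : theta A = A) :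
    act hσ s X (fun Y => R hσ φ Y A) Y - R hσ (act hσ s X φ) Y A =
      -R hσ φ Y (brk A (comp i 0 X Y)) + s * lam n i (brk A (comp i 1 X Y)) * φ Y := by
  rw [act_R_sub hσ hφ s hX Y (nilProj_eq hA' hA.isNil_one), parPart_adNeg, adNeg_eq]
  simp only [map_add]
  rw [R_eq_zero hσ (hA.brk (isDeg_comp 1 X Y)) (by norm_num),
    R_eq_zero hσ (hA.brk (isDeg_comp 2 X Y)) (by norm_num),
    lam_eq_zero (hA.brk (isDeg_comp (-2) X Y)) (by norm_num),
    lam_eq_zero (hA.brk (isDeg_comp (-1) X Y)) (by norm_num),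
    lam_eq_zero (hA.brk (isDeg_comp 0 X Y)) (by norm_num),
    lam_eq_zero (hA.brk (isDeg_comp 2 X Y)) (by norm_num)]
  ring

/-- The first order formula is used twice. Differentiating its coefficients along A replaces X_d by
-[A, X_{d+1}]; this is where the double brackets with X_1 and X_2 arise. -/
theorem act_RR_sub {φ : oppNilReal σ i → ℂ} (hφ : ContDiff ℝ ∞ φ) (s : ℂ) {X : Mat n}
    (hX : theta X = X) (Y : oppNilReal σ i) {A B : Mat n} (hA : IsDeg i (-1) A)
    (hA' : theta A = A) (hB : IsDeg i (-1) B) (hB' : theta B = B) :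
    act hσ s X (fun Y => RR hσ hφ Y B A) Y - RR hσ (contDiff_act hσ hφ s X) Y B A =
      -RR hσ hφ Y B (brk A (comp i 0 X Y)) - RR hσ hφ Y (brk B (comp i 0 X Y)) A
      + s * lam n i (brk A (comp i 1 X Y)) * R hσ φ Y B
      + s * lam n i (brk B (comp i 1 X Y)) * R hσ φ Y A
      + R hσ φ Y (brk B (brk A (comp i 1 X Y)))
      - s * lam n i (brk B (brk A (comp i 2 X Y))) * φ Y := by
  have hAn := nilProj_eq hA' hA.isNil_one
  have h1 := act_R_sub' hσ (contDiff_R hσ hφ B) s hX Y hA hA'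
  have e : (fun Y => act hσ s X (fun Y => R hσ φ Y B) Y - R hσ (act hσ s X φ) Y B) =
      fun Y : oppNilReal σ i =>
        (-1 : ℂ) * R hσ φ Y ((brk B ∘ₗ prDeg i 0) (adNeg X (Y : Mat n))) +
        s * ((lam n i ∘ₗ brk B ∘ₗ prDeg i 1) (adNeg X (Y : Mat n)) * φ Y) := by
    ext1 Y
    rw [act_R_sub' hσ hφ s hX Y hB hB']
    simp only [LinearMap.comp_apply, comp]
    ring
  have d0 := smooth_differentiableAt (contDiff_act hσ (contDiff_R hσ hφ B) s X) Y
  have d0' := smooth_differentiableAt (contDiff_R hσ (contDiff_act hσ hφ s X) B) Y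
  have d1 := smooth_differentiableAt (contDiff_R_adNeg hσ hφ X (brk B ∘ₗ prDeg i 0)) Y
  have d2 := smooth_differentiableAt
    (contDiff_linear_adNeg (σ := σ) X (lam n i ∘ₗ brk B ∘ₗ prDeg i 1)) Y
  have d3 := smooth_differentiableAt hφ Y
  have h2 : R hσ (fun Y => act hσ s X (fun Y => R hσ φ Y B) Y) Y A -
      RR hσ (contDiff_act hσ hφ s X) Y B A =
      R hσ (fun Y => act hσ s X (fun Y => R hσ φ Y B) Y - R hσ (act hσ s X φ) Y B) Y A := by
    have e2 : (fun Y => act hσ s X (fun Y => R hσ φ Y B) Y - R hσ (act hσ s X φ) Y B) =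
        fun Y => act hσ s X (fun Y => R hσ φ Y B) Y + (-1 : ℂ) * R hσ (act hσ s X φ) Y B := by
      ext1 Y; ring
    rw [e2, R_add hσ d0 (d0'.const_mul _), R_const_mul hσ d0', RR_apply]
    ring
  have hp0 : prDeg i 0 (brk A (adNeg X (Y : Mat n))) = brk A (comp i 1 X Y) := by
    rw [adNeg_eq]
    simp only [map_add]
    rw [(hA.brk (isDeg_comp (-2) X Y)).prDeg_eq_zero (by norm_num),
      (hA.brk (isDeg_comp (-1) X Y)).prDeg_eq_zero (by norm_num),
      (hA.brk (isDeg_comp 0 X Y)).prDeg_eq_zero (by norm_num),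
      (hA.brk (isDeg_comp 2 X Y)).prDeg_eq_zero (by norm_num)]
    have := (hA.brk (isDeg_comp 1 X Y)).prDeg_eq
    norm_num at this
    rw [this]; abel
  have hp1 : prDeg i 1 (brk A (adNeg X (Y : Mat n))) = brk A (comp i 2 X Y) := by
    rw [adNeg_eq]
    simp only [map_add]
    rw [(hA.brk (isDeg_comp (-2) X Y)).prDeg_eq_zero (by norm_num),
      (hA.brk (isDeg_comp (-1) X Y)).prDeg_eq_zero (by norm_num),
      (hA.brk (isDeg_comp 0 X Y)).prDeg_eq_zero (by norm_num),
      (hA.brk (isDeg_comp 1 X Y)).prDeg_eq_zero (by norm_num)]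
    have := (hA.brk (isDeg_comp 2 X Y)).prDeg_eq
    norm_num at this
    rw [this]; abel
  rw [e, R_add hσ (d1.const_mul (-1 : ℂ)) ((d2.fun_mul d3).const_mul s), R_const_mul hσ d1,
    R_const_mul hσ (d2.fun_mul d3), R_mul hσ d2 d3, R_R_adNeg hσ hφ X _ Y hAn,
    R_linear_adNeg hσ X _ Y hAn, ← brk_apply] at h2
  simp only [LinearMap.comp_apply, hp0, hp1] at h2
  simp only [RR_apply, comp] at *
  linear_combination h1 + h2

end

/-! ### The second order operators attached to skew matrices -/

section
variable {n i : ℕ} {σ : RealForm n} (hσ : σ.conj (gradingElt n i) = gradingElt n i)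

theorem anti_comm (A B : Mat n) : anti A B = anti B A := add_comm _ _

theorem trace_anti_mul (A M B : Mat n) : (anti A M * B).trace = (M * anti A B).trace := by
  rw [anti, anti, add_mul, mul_add, Matrix.trace_add, Matrix.trace_add, ← mul_assoc M B A,
    Matrix.trace_mul_comm (M * B) A, ← mul_assoc, ← mul_assoc, add_comm]

theorem trace_anti_symm (A M B : Mat n) : (anti A M * B).trace = (anti B M * A).trace := by
  rw [trace_anti_mul, trace_anti_mul, anti_comm A B]

theorem anti_eq_sum {M : Mat n} (hM : M ∈ antiSub n i) (β : RootOne n i) :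
    anti (xv β) M = ∑ γ : RootOne n i, (anti (xv β) M * xv γ).trace • fv γ :=
  (sum_trace_mul_xv (theta_anti hM.1 (theta_xv β)) (isDeg_anti hM.2 (isDeg_xv β))).symm

/-- In the basis f_β ⊗ f_γ, the tensor ∑ f_β ⊗ {x_β, M} has the coefficients tr({x_β, M} x_γ), which
are symmetric in β and γ. -/
theorem sum_bilin_symm {V : Type*} [AddCommGroup V] [Module ℂ V] (G : Mat n →ₗ[ℂ] Mat n →ₗ[ℂ] V)
    {M : Mat n} (hM : M ∈ antiSub n i) :
    ∑ β : RootOne n i, G (fv β) (anti (xv β) M) = ∑ β : RootOne n i, G (anti (xv β) M) (fv β) := by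
  have h1 : ∀ β : RootOne n i, G (fv β) (anti (xv β) M) =
      ∑ γ : RootOne n i, (anti (xv β) M * xv γ).trace • G (fv β) (fv γ) := fun β => by
    conv_lhs => rw [anti_eq_sum hM β]
    simp only [map_sum, map_smul]
  have h2 : ∀ β : RootOne n i, G (anti (xv β) M) (fv β) =
      ∑ γ : RootOne n i, (anti (xv β) M * xv γ).trace • G (fv γ) (fv β) := fun β => by
    conv_lhs => rw [anti_eq_sum hM β]
    simp only [map_sum, map_smul, LinearMap.sum_apply, LinearMap.smul_apply]
  rw [Finset.sum_congr rfl fun β _ => h1 β, Finset.sum_congr rfl fun β _ => h2 β,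
    Finset.sum_comm]
  refine Finset.sum_congr rfl fun β _ => Finset.sum_congr rfl fun γ _ => ?_
  rw [trace_anti_symm]

/-- A bilinear form contracted with `[fᵦ, X] ⊗ xᵦ`. -/
theorem sum_bilin_brk {V : Type*} [AddCommGroup V] [Module ℂ V]
    (G : Mat n →ₗ[ℂ] Mat n →ₗ[ℂ] V) {X : Mat n} (hX : theta X = X) (hd : IsDeg i 0 X) :
    ∑ β : RootOne n i, G (brk (fv β) X) (xv β) = ∑ β : RootOne n i, G (fv β) (brk X (xv β)) := by
  have h1 : ∀ β : RootOne n i, G (brk (fv β) X) (xv β) =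
      ∑ γ : RootOne n i, (brk (fv β) X * xv γ).trace • G (fv γ) (xv β) := fun β => by
    have h := sum_trace_mul_xv (theta_lie (theta_fv β) hX) ((isDeg_fv β).brk hd)
    conv_lhs => rw [brk_apply, ← h]
    simp only [map_sum, map_smul, LinearMap.sum_apply, LinearMap.smul_apply]
    rfl
  have h2 : ∀ γ : RootOne n i, G (fv γ) (brk X (xv γ)) =
      ∑ β : RootOne n i, (fv β * brk X (xv γ)).trace • G (fv γ) (xv β) := fun γ => by
    have h := sum_trace_fv_mul (theta_lie hX (theta_xv γ)) (hd.brk (isDeg_xv γ))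
    conv_lhs => rw [brk_apply, ← h]
    simp only [map_sum, map_smul]
    rfl
  rw [Finset.sum_congr rfl fun β _ => h1 β, Finset.sum_congr rfl fun β _ => h2 β,
    Finset.sum_comm]
  refine Finset.sum_congr rfl fun β _ => Finset.sum_congr rfl fun γ _ => ?_
  congr 1
  rw [brk_apply, brk_apply, sub_mul, mul_sub, Matrix.trace_sub, Matrix.trace_sub,
    mul_assoc X (fv _), Matrix.trace_mul_comm X, mul_assoc, mul_assoc]

theorem brk_mem_antiSub {M X : Mat n} (hM : M ∈ antiSub n i) (hX : theta X = X)
    (hd : IsDeg i 0 X) : brk X M ∈ antiSub n i := by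
  refine ⟨?_, ?_⟩
  · rw [brk_apply, map_sub, theta_mul, theta_mul, hX, hM.1]; noncomm_ring
  · have := hd.brk hM.2
    rwa [zero_add] at this

/-- Right multiplication by a matrix in the anticommutator. -/
def antiMap (M : Mat n) : Mat n →ₗ[ℂ] Mat n := LinearMap.mulRight ℂ M + LinearMap.mulLeft ℂ M

theorem antiMap_apply (M A : Mat n) : antiMap M A = anti A M := rfl

/-- The second order operator attached to `M`. -/
def Dop {φ : oppNilReal σ i → ℂ} (hφ : ContDiff ℝ ∞ φ) (Y : oppNilReal σ i) : Mat n →ₗ[ℂ] ℂ where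
  toFun M := ∑ β : RootOne n i, RR hσ hφ Y (fv β) (anti (xv β) M)
  map_add' M M' := by
    rw [← Finset.sum_add_distrib]
    refine Finset.sum_congr rfl fun β _ => ?_
    rw [← map_add, anti, anti, anti]; congr 1; noncomm_ring
  map_smul' c M := by
    rw [RingHom.id_apply, Finset.smul_sum]
    refine Finset.sum_congr rfl fun β _ => ?_
    rw [← map_smul, anti, anti, smul_add, mul_smul_comm, smul_mul_assoc]

theorem Dop_apply {φ : oppNilReal σ i → ℂ} (hφ : ContDiff ℝ ∞ φ) (Y : oppNilReal σ i) (M : Mat n) :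
    Dop hσ hφ Y M = ∑ β : RootOne n i, RR hσ hφ Y (fv β) (anti (xv β) M) := rfl

theorem act_sum {ι : Type*} [Fintype ι] (s : ℂ) (X : Mat n) {F : ι → oppNilReal σ i → ℂ}
    (Y : oppNilReal σ i) (hF : ∀ k, DifferentiableAt ℝ (F k) Y) :
    act hσ s X (fun Y => ∑ k, F k Y) Y = ∑ k, act hσ s X (F k) Y := by
  simp only [act]
  rw [R_sum hσ _ (fun k _ => hF k), Finset.sum_add_distrib, Finset.sum_neg_distrib, Finset.mul_sum]

/-- Invariance of ∑ f_β ⊗ x_β under 𝔩 transfers the bracket with X from the two operators to M. -/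
theorem sum_RR_levi {φ : oppNilReal σ i → ℂ} (hφ : ContDiff ℝ ∞ φ) (Y : oppNilReal σ i)
    (M : Mat n) {X : Mat n} (hX : theta X = X) (hd : IsDeg i 0 X) :
    ∑ β : RootOne n i, (-RR hσ hφ Y (fv β) (brk (anti (xv β) M) X) -
      RR hσ hφ Y (brk (fv β) X) (anti (xv β) M)) = Dop hσ hφ Y (brk X M) := by
  have h := sum_bilin_brk ((RR hσ hφ Y).compl₂ (antiMap M)) hX hd
  simp only [LinearMap.compl₂_apply, antiMap_apply] at h
  rw [Finset.sum_sub_distrib, h, ← Finset.sum_sub_distrib, Dop_apply]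
  refine Finset.sum_congr rfl fun β _ => ?_
  rw [← map_neg, ← map_sub]
  congr 1
  simp only [brk_apply, anti]
  noncomm_ring

theorem sum_R_brk_brk (hin : i ≤ n) (φ : oppNilReal σ i → ℂ) (Y : oppNilReal σ i)
    {M X : Mat n} (hM : M ∈ antiSub n i) (hX : theta X = X) (hd : IsDeg i 1 X) :
    ∑ β : RootOne n i, R hσ φ Y (brk (fv β) (brk (anti (xv β) M) X)) =
      ((n : ℂ) - i + 1) * R hσ φ Y (anti X M) := by
  rw [← map_sum, ← smul_eq_mul, ← map_smul, ← sum_lie_lie hin hM hX hd]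
  rfl

theorem sum_lam_fv (M : Mat n) {X : Mat n} (hX : theta X = X) (hd : IsDeg i 1 X)
    (φ : oppNilReal σ i → ℂ) (Y : oppNilReal σ i) :
    ∑ β : RootOne n i, lam n i (brk (fv β) X) * R hσ φ Y (anti (xv β) M) =
      -2⁻¹ * R hσ φ Y (anti X M) := by
  conv_rhs => rw [← sum_trace_fv_mul hX hd]
  rw [← antiMap_apply, map_sum, map_sum, Finset.mul_sum]
  refine Finset.sum_congr rfl fun β _ => ?_
  rw [lam_brk hd, map_smul, map_smul, antiMap_apply, smul_eq_mul, mul_assoc]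

theorem sum_lam_anti {M X : Mat n} (hM : M ∈ antiSub n i) (hX : theta X = X) (hd : IsDeg i 1 X)
    (φ : oppNilReal σ i → ℂ) (Y : oppNilReal σ i) :
    ∑ β : RootOne n i, lam n i (brk (anti (xv β) M) X) * R hσ φ Y (fv β) =
      -2⁻¹ * R hσ φ Y (anti X M) := by
  rw [← sum_trace_mul_xv (theta_anti hM.1 hX) (isDeg_anti hM.2 hd), map_sum, Finset.mul_sum]
  refine Finset.sum_congr rfl fun β _ => ?_
  rw [lam_brk hd, map_smul, smul_eq_mul, trace_anti_symm, mul_assoc]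

/-- By `lam_brk` the sum is a difference between the two orders of multiplication of f_β and {x_β,
M}, and these agree after summation by symmetry of the tensor. -/
theorem sum_lam_brk_brk {M X : Mat n} (hM : M ∈ antiSub n i) (hd : IsDeg i 2 X) :
    ∑ β : RootOne n i, lam n i (brk (fv β) (brk (anti (xv β) M) X)) = 0 := by
  have h : ∀ β : RootOne n i, lam n i (brk (fv β) (brk (anti (xv β) M) X)) =
      -2⁻¹ * ((fv β * anti (xv β) M) * X).trace - -2⁻¹ * ((anti (xv β) M * fv β) * X).trace := by
    intro β
    have hB : IsDeg i 1 (brk (anti (xv β) M) X) := (isDeg_anti hM.2 (isDeg_xv β)).brk hd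
    rw [lam_brk hB, brk_apply, mul_sub, Matrix.trace_sub, ← mul_assoc, ← mul_assoc,
      Matrix.trace_mul_comm (fv β * X), mul_assoc (anti _ _), mul_sub]
  rw [Finset.sum_congr rfl fun β _ => h β, Finset.sum_sub_distrib, ← Finset.mul_sum,
    ← Finset.mul_sum, ← Matrix.trace_sum, ← Matrix.trace_sum, ← Finset.sum_mul, ← Finset.sum_mul]
  have h2 := sum_bilin_symm (LinearMap.mul ℂ (Mat n)) hM
  simp only [LinearMap.mul_apply'] at h2
  rw [h2, sub_self]

/-- The six terms of `act_RR_sub`, summed against the tensor of M: the first two combine to D_{[X_0,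
M]}, the two with λ_i give -s/2 each, the double bracket with X_1 gives n - i + 1, and the one with
X_2 vanishes. -/
theorem act_Dop_sub (hin : i ≤ n) {φ : oppNilReal σ i → ℂ} (hφ : ContDiff ℝ ∞ φ) (s : ℂ)
    {X M : Mat n} (hX : theta X = X) (hM : M ∈ antiSub n i) (Y : oppNilReal σ i) :
    act hσ s X (fun Y => Dop hσ hφ Y M) Y - Dop hσ (contDiff_act hσ hφ s X) Y M =
      Dop hσ hφ Y (brk (comp i 0 X Y) M) +
        ((n : ℂ) - i + 1 - s) * R hσ φ Y (anti (comp i 1 X Y) M) := by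
  have hθ : ∀ d, theta (comp i d X Y) = comp i d X Y := fun d => by
    rw [comp, theta_prDeg, theta_adNeg hX (theta_oppNilReal σ Y)]
  have hd : ∀ β : RootOne n i, DifferentiableAt ℝ
      (fun Y => RR hσ hφ Y (fv β) (anti (xv β) M)) Y := fun β =>
    smooth_differentiableAt (contDiff_R hσ (contDiff_R hσ hφ (fv β)) (anti (xv β) M)) Y
  have e : act hσ s X (fun Y => Dop hσ hφ Y M) Y = ∑ β : RootOne n i,
    act hσ s X (fun Y => RR hσ hφ Y (fv β) (anti (xv β) M)) Y := act_sum hσ s X Y hd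
  rw [e, Dop_apply, ← Finset.sum_sub_distrib,
    Finset.sum_congr rfl fun β _ => act_RR_sub hσ hφ s hX Y (isDeg_anti hM.2 (isDeg_xv β))
      (theta_anti hM.1 (theta_xv β)) (isDeg_fv β) (theta_fv β)]
  have s1 := sum_RR_levi hσ hφ Y M (hθ 0) (isDeg_comp 0 X Y)
  have s2 := sum_R_brk_brk hσ hin φ Y hM (hθ 1) (isDeg_comp 1 X Y)
  have s3 := sum_lam_fv hσ M (hθ 1) (isDeg_comp 1 X Y) φ Y
  have s4 := sum_lam_anti hσ hM (hθ 1) (isDeg_comp 1 X Y) φ Y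
  have s5 := sum_lam_brk_brk hM (isDeg_comp 2 X Y)
  simp only [Finset.sum_sub_distrib, Finset.sum_add_distrib, mul_assoc, ← Finset.mul_sum] at *
  rw [← Finset.sum_mul, s2, s3, s4, s5, s1]
  ring

end

/-! ### The operators `Ω₂` and test functions -/

section
variable {n i : ℕ} {σ : RealForm n} (hσ : σ.conj (gradingElt n i) = gradingElt n i)

/-- Since i < n there is an index of eigenvalue 0. Taking for Q the root vector of ε_a - ε_k, with k
that index, one column of {Q, M} reproduces column a of M. -/
theorem eq_zero_of_anti_eq_zero (hin : i < n) {M : Mat n} (hM : M ∈ antiSub n i)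
    (h : ∀ Q : Mat n, theta Q = Q → IsDeg i 1 Q → anti Q M = 0) : M = 0 := by
  ext p q
  by_contra hne
  have hd := hM.2 p q hne
  have hq : ∃ a : Fin n, q = Sum.inl a ∧ (a : ℕ) < i := by
    rcases q with a | a
    · refine ⟨a, rfl, ?_⟩
      by_contra ha
      rcases p with b | b <;> simp only [dg, Sum.elim_inl, Sum.elim_inr, ha] at hd <;>
        split_ifs at hd <;> omega
    · rcases p with b | b <;> simp only [dg, Sum.elim_inl, Sum.elim_inr] at hd <;>
        split_ifs at hd <;> omega
  obtain ⟨a, rfl, ha⟩ := hq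
  have hk : dg i (Sum.inl ⟨i, hin⟩ : Fin n ⊕ Fin n) = 0 := by simp [dg]
  have hdeg : IsDeg i 1 (unitSp (Sum.inl a) (Sum.inl ⟨i, hin⟩) : Mat n) := by
    have := isDeg_unitSp (i := i) (Sum.inl a : Fin n ⊕ Fin n) (Sum.inl ⟨i, hin⟩)
    rwa [dg_inl_eq a ha, hk, sub_zero] at this
  have h0 := congrFun (congrFun (h _ (theta_unitSp (Sum.inl a) (Sum.inl ⟨i, hin⟩)) hdeg) p)
    (Sum.inl ⟨i, hin⟩)
  have hz : (unitSp (Sum.inl a) (Sum.inl ⟨i, hin⟩) * M) p (Sum.inl ⟨i, hin⟩) = 0 := by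
    rw [Matrix.mul_apply]
    refine Finset.sum_eq_zero fun r _ => ?_
    have hr : M r (Sum.inl ⟨i, hin⟩) = 0 := by
      by_contra hne'
      have h1 := hM.2 _ _ hne'
      rw [hk] at h1
      rcases r with b | b <;> simp only [dg, Sum.elim_inl, Sum.elim_inr] at h1 <;>
        split_ifs at h1 <;> omega
    rw [hr, mul_zero]
  rw [anti, Matrix.add_apply, hz, zero_add, unitSp, mul_add, Matrix.add_apply, theta_single,
    mul_smul_comm, Matrix.smul_apply] at h0
  apply hne
  simpa [bar] using h0

/-- The linear function `Y ↦ tr(Y P)`. -/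
def lin (σ : RealForm n) (i : ℕ) (P : Mat n) : oppNilReal σ i → ℂ := fun Y => ((Y : Mat n) * P).trace

/-- The trace form. -/
def trMul (P : Mat n) : Mat n →ₗ[ℂ] ℂ := Matrix.traceLinearMap _ ℂ ℂ ∘ₗ LinearMap.mulRight ℂ P

theorem trMul_apply (P A : Mat n) : trMul P A = (A * P).trace := rfl

theorem contDiff_lin (P : Mat n) : ContDiff ℝ ∞ (lin σ i P) :=
  contDiff_linear ((trMul P).restrictScalars ℝ) contDiff_coe

theorem dirDeriv_lin (P : Mat n) (Y V : oppNilReal σ i) :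
    dirDeriv (lin σ i P) Y V = ((V : Mat n) * P).trace := by
  have h1 := hasDerivAt_line (V := V) (smooth_differentiableAt (contDiff_lin (σ := σ) P) Y)
  have h2 : HasDerivAt (fun t : ℝ => lin σ i P (Y + t • V)) ((V : Mat n) * P).trace 0 := by
    have := hasDerivAt_linear ((trMul P).restrictScalars ℝ)
      (((hasDerivAt_id (0 : ℝ)).smul_const (V : Mat n)).const_add (Y : Mat n))
    have e : (fun t : ℝ => lin σ i P (Y + t • V)) = fun t : ℝ =>
        (trMul P).restrictScalars ℝ ((Y : Mat n) + id t • (V : Mat n)) := rfl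
    rw [e]
    refine this.congr_deriv ?_
    rw [one_smul]; rfl
  exact h1.unique h2

/-- The correction ½[Y, A] has degree -2 and is trace-orthogonal to P of degree 1, so the derivative
does not depend on the point. In particular second derivatives vanish. -/
theorem R_lin {P : Mat n} (hP : IsDeg i 1 P) (Y : oppNilReal σ i) {A : Mat n}
    (hA : theta A = A) (hA' : IsDeg i (-1) A) : R hσ (lin σ i P) Y A = (A * P).trace := by
  have hY := isNil_oppNilReal σ Y
  have h : ∀ B : Mat n, nilProj n i B = B → cext hσ (dirDeriv (lin σ i P) Y) B = trMul P B :=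
    fun B hB => eq_of_eq_on_real hσ (fun V => by rw [cext_coe, dirDeriv_lin]; rfl) hB
  have hn := nilProj_eq hA hA'.isNil_one
  have hL : nilProj n i (leftInv (Y : Mat n) A) = leftInv (Y : Mat n) A := by
    exact nilProj_eq (theta_leftInv (theta_oppNilReal σ Y) hA) (leftInv_isNil hY hA'.isNil_one)
  have h2 := (hY.isDeg_lie hA'.isNil_one).mul hP
  rw [R_apply, hn, h _ hL, trMul_apply, leftInv_apply, add_mul, Matrix.trace_add, smul_mul_assoc,
    Matrix.trace_smul, h2.trace_eq_zero (by norm_num), smul_zero, add_zero]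

theorem R_const (c : ℂ) (Y : oppNilReal σ i) (A : Mat n) : R hσ (fun _ => c) Y A = 0 := by
  have h0 : ∀ V, dirDeriv (fun _ : oppNilReal σ i => c) Y V = 0 := fun V => by
    change fderiv ℝ (fun _ => c) Y V = 0
    simp
  rw [R_apply, cext_apply, h0, h0]
  ring

theorem Dop_lin {P M : Mat n} (hP : IsDeg i 1 P) (Y : oppNilReal σ i) :
    Dop hσ (contDiff_lin (σ := σ) (i := i) P) Y M = 0 := by
  rw [Dop_apply]
  refine Finset.sum_eq_zero fun β _ => ?_
  rw [RR_apply]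
  have : (fun Y => R hσ (lin σ i P) Y (fv β)) = fun _ => (fv β * P).trace := by
    ext1 Y
    rw [R_lin hσ hP Y (theta_fv β) (isDeg_fv β)]
  rw [this, R_const]

theorem contDiff_lin_mul (P Q : Mat n) : ContDiff ℝ ∞ fun Y => lin σ i P Y * lin σ i Q Y :=
  (contDiff_lin P).mul (contDiff_lin Q)

/-- A product of two linear functions reads off the polarized symbol of D_M, with the same value at
every point. -/
theorem Dop_lin_mul {P Q M : Mat n} (hM : M ∈ antiSub n i) (hP : IsDeg i 1 P) (hQ : IsDeg i 1 Q)
    (hP' : theta P = P) (hQ' : theta Q = Q) (Y : oppNilReal σ i) :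
    Dop hσ (contDiff_lin_mul (σ := σ) (i := i) P Q) Y M = 2 * (anti Q M * P).trace := by
  have dP := fun Y => smooth_differentiableAt (contDiff_lin (σ := σ) (i := i) P) Y
  have dQ := fun Y => smooth_differentiableAt (contDiff_lin (σ := σ) (i := i) Q) Y
  have h : ∀ β : RootOne n i, RR hσ (contDiff_lin_mul (σ := σ) (i := i) P Q) Y (fv β) (anti (xv β) M) =
      (fv β * Q).trace * (anti (xv β) M * P).trace +
        (fv β * P).trace * (anti (xv β) M * Q).trace := by
    intro β
    rw [RR_apply]
    have : (fun Y => R hσ (fun Y => lin σ i P Y * lin σ i Q Y) Y (fv β)) =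
        fun Y => (fv β * Q).trace * lin σ i P Y + (fv β * P).trace * lin σ i Q Y := by
      ext1 Y
      rw [R_mul hσ (dP Y) (dQ Y), R_lin hσ hP Y (theta_fv β) (isDeg_fv β),
        R_lin hσ hQ Y (theta_fv β) (isDeg_fv β)]
      ring
    rw [this, R_add hσ ((dP Y).const_mul _) ((dQ Y).const_mul _), R_const_mul hσ (dP Y),
      R_const_mul hσ (dQ Y),
      R_lin hσ hP Y (theta_anti hM.1 (theta_xv β)) (isDeg_anti hM.2 (isDeg_xv β)),
      R_lin hσ hQ Y (theta_anti hM.1 (theta_xv β)) (isDeg_anti hM.2 (isDeg_xv β))]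
  have hs : ∀ {P Q : Mat n}, theta Q = Q → IsDeg i 1 Q →
      ∑ β : RootOne n i, (fv β * Q).trace * (anti (xv β) M * P).trace = (anti Q M * P).trace := by
    intro P Q h1 h2
    conv_rhs => rw [← sum_trace_fv_mul h1 h2]
    rw [← antiMap_apply, ← trMul_apply, map_sum, map_sum]
    refine Finset.sum_congr rfl fun β _ => ?_
    rw [map_smul, map_smul, smul_eq_mul]; rfl
  rw [Dop_apply, Finset.sum_congr rfl fun β _ => h β, Finset.sum_add_distrib, hs hQ' hQ, hs hP' hP,
    trace_anti_symm P M Q]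
  ring

/-! ### Ω₂ as a multiple of D_M, and its commutators -/

theorem contDiff_Dop {φ : oppNilReal σ i → ℂ} (hφ : ContDiff ℝ ∞ φ) (M : Mat n) :
    ContDiff ℝ ∞ fun Y => Dop hσ hφ Y M := by
  simp only [Dop_apply]
  exact ContDiff.sum fun β _ => contDiff_R hσ (contDiff_R hσ hφ (fv β)) (anti (xv β) M)

theorem dualOne_mem_oppNil (α : RootOne n i) : dualOne α ∈ oppNil n i := by
  rw [mem_oppNil, coe_dualOne]
  exact ((isDeg_fv α).smul _).isNil_one

theorem vecOne_mem_gr (α : RootOne n i) : vecOne α ∈ gr n i 1 := by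
  rw [mem_gr, coe_vecOne]
  exact isDeg_xv α

theorem rightSym_dualOne (s : ℂ) {φ : oppNilReal σ i → ℂ} (hφ : ContDiff ℝ ∞ φ)
    (Y : oppNilReal σ i) (α β : RootOne n i) :
    rightSym σ i s (dualOne α) (dualOne β) φ Y = ((2 * n + 2 : ℂ)⁻¹ * (2 * n + 2 : ℂ)⁻¹ * 2⁻¹) *
      (RR hσ hφ Y (fv β) (fv α) + RR hσ hφ Y (fv α) (fv β)) := by
  have h1 : ∀ α : RootOne n i, right σ i s (dualOne α) φ = fun Y => R hσ φ Y (dualOne α : Mat n) :=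
    fun α => funext fun Y => right_eq hσ s Y (smooth_differentiableAt hφ Y) (dualOne_mem_oppNil α)
  have h2 : ∀ α β : RootOne n i, right σ i s (dualOne α) (right σ i s (dualOne β) φ) Y =
      (2 * n + 2 : ℂ)⁻¹ * (2 * n + 2 : ℂ)⁻¹ * RR hσ hφ Y (fv β) (fv α) := by
    intro α β
    rw [h1, right_eq hσ s Y (smooth_differentiableAt (contDiff_R hσ hφ _) Y) (dualOne_mem_oppNil α),
      ← RR_apply hσ hφ, coe_dualOne, coe_dualOne, map_smul, map_smul, LinearMap.smul_apply,
      smul_eq_mul, smul_eq_mul]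
    ring
  rw [rightSym, Pi.smul_apply, Pi.add_apply, h2, h2, smul_eq_mul]
  ring

/-- The coefficients are symmetric in the two roots, so both orders in the symmetrization sum to
D_M. The factor (2n + 2)⁻² converts Killing-dual vectors into trace-dual ones. -/
theorem Omega_eq (s : ℂ) {φ : oppNilReal σ i → ℂ} (hφ : ContDiff ℝ ∞ φ)
    {y : Sp n ⊗[ℂ] Sp n} {k : ℂ} {M : Mat n} (hM : M ∈ antiSub n i)
    (hk : ∀ P ∈ gr n i 1, ∀ Q ∈ gr n i 1,
      tauPolar n i y P Q = k * (M * anti (P : Mat n) Q).trace) :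
    Omega σ i s y φ = fun Y => k * ((2 * n + 2 : ℂ)⁻¹ * (2 * n + 2 : ℂ)⁻¹) * Dop hσ hφ Y M := by
  ext1 Y
  have h1 : Dop hσ hφ Y M = ∑ α : RootOne n i, ∑ β : RootOne n i,
      (anti (xv α) M * xv β).trace * RR hσ hφ Y (fv α) (fv β) := by
    rw [Dop_apply]
    refine Finset.sum_congr rfl fun α _ => ?_
    conv_lhs => rw [anti_eq_sum hM α]
    simp only [map_sum, map_smul, smul_eq_mul]
  have h2 : Dop hσ hφ Y M = ∑ α : RootOne n i, ∑ β : RootOne n i,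
      (anti (xv α) M * xv β).trace * RR hσ hφ Y (fv β) (fv α) := by
    rw [h1, Finset.sum_comm]
    refine Finset.sum_congr rfl fun α _ => Finset.sum_congr rfl fun β _ => ?_
    rw [trace_anti_symm]
  have h3 : Omega σ i s y φ Y = k * ((2 * n + 2 : ℂ)⁻¹ * (2 * n + 2 : ℂ)⁻¹) * 2⁻¹ *
      ∑ α : RootOne n i, ∑ β : RootOne n i, ((anti (xv α) M * xv β).trace *
        RR hσ hφ Y (fv β) (fv α) + (anti (xv α) M * xv β).trace * RR hσ hφ Y (fv α) (fv β)) := by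
    rw [Omega, Finset.sum_apply, Finset.mul_sum]
    refine Finset.sum_congr rfl fun α _ => ?_
    rw [Finset.sum_apply, Finset.mul_sum]
    refine Finset.sum_congr rfl fun β _ => ?_
    rw [Pi.smul_apply, rightSym_dualOne hσ s hφ, hk _ (vecOne_mem_gr α) _ (vecOne_mem_gr β),
      coe_vecOne, coe_vecOne, smul_eq_mul, trace_anti_mul]
    change k * (M * anti (xv α) (xv β)).trace * _ = _
    ring
  simp only [Finset.sum_add_distrib] at h3
  rw [h3, ← h1, ← h2]
  ring

theorem leftAction_eq_act (s : ℂ) {φ : oppNilReal σ i → ℂ} (hφ : ContDiff ℝ ∞ φ) {X : Sp n}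
    (hX : σ.conj X = X) : leftAction σ i s X φ = act hσ s (X : Mat n) φ :=
  funext fun Y => leftAction_eq hσ s Y (smooth_differentiableAt hφ Y) hX

theorem commutator_Omega (hin : i ≤ n) (s : ℂ) {φ : oppNilReal σ i → ℂ} (hφ : ContDiff ℝ ∞ φ)
    {y : Sp n ⊗[ℂ] Sp n} {k : ℂ} {M : Mat n} (hM : M ∈ antiSub n i)
    (hk : ∀ P ∈ gr n i 1, ∀ Q ∈ gr n i 1,
      tauPolar n i y P Q = k * (M * anti (P : Mat n) Q).trace) {X : Sp n} (hX : σ.conj X = X)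
    (Y : oppNilReal σ i) :
    (leftAction σ i s X (Omega σ i s y φ) - Omega σ i s y (leftAction σ i s X φ)) Y =
      k * ((2 * n + 2 : ℂ)⁻¹ * (2 * n + 2 : ℂ)⁻¹) * (Dop hσ hφ Y (brk (comp i 0 (X : Mat n) Y) M) +
        ((n : ℂ) - i + 1 - s) * R hσ φ Y (anti (comp i 1 (X : Mat n) Y) M)) := by
  have hD := contDiff_Dop hσ hφ M
  rw [Pi.sub_apply, leftAction_eq_act hσ s hφ hX, Omega_eq hσ s hφ hM hk,
    Omega_eq hσ s (contDiff_act hσ hφ s X) hM hk, leftAction_eq_act hσ s (contDiff_const.mul hD) hX,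
    ← act_Dop_sub hσ hin hφ s (theta_coe X) hM Y, act, act,
    R_const_mul hσ (smooth_differentiableAt hD Y)]
  ring

end

/-! ### Conformal invariance -/

section
variable {n i : ℕ}

/-- A complex linear functional vanishing on the real form vanishes. -/
theorem eq_zero_of_eq_zero_on_real (σ : RealForm n) {f : Sp n →ₗ[ℂ] ℂ}
    (h : ∀ X, σ.conj X = X → f X = 0) (X : Sp n) : f X = 0 := by
  have h1 : f (X + σ.conj X) = 0 := h _ (by rw [map_add, σ.conj_conj, add_comm])
  have h2 : f (Complex.I • (X - σ.conj X)) = 0 := h _ (by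
    rw [LinearMap.map_smulₛₗ, map_sub, σ.conj_conj, Complex.conj_I, neg_smul, ← smul_neg, neg_sub])
  rw [map_smul, smul_eq_mul] at h2
  have h3 := (mul_eq_zero.1 h2).resolve_left Complex.I_ne_zero
  rw [map_add] at h1
  rw [map_sub] at h3
  linear_combination (2⁻¹ : ℂ) * h1 + (2⁻¹ : ℂ) * h3

theorem trace_mul_eq_zero {A : Mat n} (hA : theta A = A) (hA' : IsDeg i (-1) A)
    (h : ∀ P : Mat n, theta P = P → IsDeg i 1 P → (A * P).trace = 0) : A = 0 := by
  rw [← sum_trace_mul_xv hA hA']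
  refine Finset.sum_eq_zero fun α _ => ?_
  rw [h _ (theta_xv α) (isDeg_xv α), zero_smul]

theorem eq_zero_of_trace (hin : i < n) {M : Mat n} (hM : M ∈ antiSub n i)
    (h : ∀ P Q : Mat n, theta P = P → IsDeg i 1 P → theta Q = Q → IsDeg i 1 Q →
      (anti Q M * P).trace = 0) : M = 0 :=
  eq_zero_of_anti_eq_zero hin hM fun Q hQ hQ' =>
    trace_mul_eq_zero (theta_anti hM.1 hQ) (isDeg_anti hM.2 hQ')
      fun P hP hP' => h P Q hP hP' hQ hQ'

end

/-! ### Independence, invariance at s = n - i + 1, and necessity of this value -/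

section
variable {n i : ℕ} {W W' : LieSubmodule ℂ (levi n i) (Sp n ⊗[ℂ] Sp n)}

/-- The inclusion of `𝔤` into the matrices. -/
def coeLin (n : ℕ) : Sp n →ₗ[ℂ] Mat n where
  toFun X := X
  map_add' := coe_add
  map_smul' := coe_smul

/-- The contraction on `W'`. -/
def contrW (W' : LieSubmodule ℂ (levi n i) (Sp n ⊗[ℂ] Sp n)) : W' →ₗ[ℂ] Mat n :=
  contr n ∘ₗ W'.toSubmodule.subtype

/-- Products of two linear functions detect the symbol of ∑ c_j D_{M_j}. Its vanishing at one point
gives ∑ c_j M_j = 0, and the contraction is injective on W'. -/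
theorem independent_Omega (hin : i < n) (hW' : IsKillingDual n i W W')
    (hinj : Function.Injective (contrW W')) {k : ℂ} (hk0 : k ≠ 0)
    (hk : ∀ y : W', ∀ P ∈ gr n i 1, ∀ Q ∈ gr n i 1, tauPolar n i (y : Sp n ⊗[ℂ] Sp n) P Q =
      k * (contrW W' y * anti (P : Mat n) Q).trace)
    {σ : RealForm n} (hσ : σ.conj (gradingElt n i) = gradingElt n i) {ι : Type*} [Fintype ι]
    (Y : Module.Basis ι ℂ W') (s : ℂ) (Z : oppNilReal σ i) (c : ι → ℂ)
    (h : ∀ φ : oppNilReal σ i → ℂ, ContDiff ℝ ∞ φ →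
      ∑ j, c j * Omega σ i s (Y j : Sp n ⊗[ℂ] Sp n) φ Z = 0) : c = 0 := by
  have hM : ∀ y : W', contrW W' y ∈ antiSub n i := fun y => contr_mem_antiSub (hW'.le y.2)
  have hc := killing_const_ne_zero n
  have h0 : contrW W' (∑ j, c j • Y j) = 0 := by
    refine eq_zero_of_trace hin (hM _) fun P Q hP hP' hQ hQ' => ?_
    have h1 := h _ (contDiff_lin_mul P Q)
    have h2 : ∀ j, c j * Omega σ i s (Y j : Sp n ⊗[ℂ] Sp n) (fun Y => lin σ i P Y * lin σ i Q Y) Z =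
        k * ((2 * n + 2 : ℂ)⁻¹ * (2 * n + 2 : ℂ)⁻¹) * 2 *
          (c j * (anti Q (contrW W' (Y j)) * P).trace) := by
      intro j
      rw [Omega_eq hσ s (contDiff_lin_mul P Q) (hM (Y j)) (hk (Y j))]
      beta_reduce
      rw [Dop_lin_mul hσ (hM (Y j)) hP' hQ' hP hQ]
      ring
    rw [Finset.sum_congr rfl fun j _ => h2 j, ← Finset.mul_sum] at h1
    have h3 := (mul_eq_zero.1 h1).resolve_left (by
      exact mul_ne_zero (mul_ne_zero hk0 (mul_ne_zero (inv_ne_zero hc) (inv_ne_zero hc))) two_ne_zero)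
    have h4 : (anti Q (contrW W' (∑ j, c j • Y j)) * P).trace =
        (trMul P ∘ₗ antiMap Q ∘ₗ contrW W') (∑ j, c j • Y j) := by
      rw [anti_comm]; rfl
    rw [h4, map_sum, ← h3]
    refine Finset.sum_congr rfl fun j _ => ?_
    rw [map_smul, smul_eq_mul, anti_comm]; rfl
  have h5 := hinj (h0.trans (map_zero _).symm)
  exact funext fun j => Fintype.linearIndependent_iff.1 Y.linearIndependent c h5 j

/-- At this s the first order term is gone, and [X_0, M_j] is again the contraction of an element of
W', whose coordinates in the basis are the required coefficients. -/
theorem commutator_mem (hin : i < n) (hW' : IsKillingDual n i W W')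
    (hinj : Function.Injective (contrW W'))
    (hsurj : ∀ M ∈ antiSub n i, ∃ y : W', contrW W' y = M) {k : ℂ}
    (hk : ∀ y : W', ∀ P ∈ gr n i 1, ∀ Q ∈ gr n i 1, tauPolar n i (y : Sp n ⊗[ℂ] Sp n) P Q =
      k * (contrW W' y * anti (P : Mat n) Q).trace)
    {σ : RealForm n} (hσ : σ.conj (gradingElt n i) = gradingElt n i) {ι : Type*} [Fintype ι]
    (Y : Module.Basis ι ℂ W') {X : Sp n} (hX : σ.conj X = X) (j : ι) :
    ∃ C : ι → oppNilReal σ i → ℂ, (∀ k, ContDiff ℝ ∞ (C k)) ∧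
      ∀ φ : oppNilReal σ i → ℂ, ContDiff ℝ ∞ φ →
        leftAction σ i ((n : ℂ) - i + 1) X (Omega σ i ((n : ℂ) - i + 1) (Y j : Sp n ⊗[ℂ] Sp n) φ) -
          Omega σ i ((n : ℂ) - i + 1) (Y j : Sp n ⊗[ℂ] Sp n)
            (leftAction σ i ((n : ℂ) - i + 1) X φ) =
        ∑ k, C k * Omega σ i ((n : ℂ) - i + 1) (Y k : Sp n ⊗[ℂ] Sp n) φ := by
  have hM : ∀ y : W', contrW W' y ∈ antiSub n i := fun y => contr_mem_antiSub (hW'.le y.2)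
  -- A left inverse of the contraction defined on all matrices makes each coordinate of [X_0, M_j] a
  -- fixed linear functional of Ad(exp(-Z)) X, hence smooth in Z. The minus sign in `ℓ` appears
  -- because `brk` has M_j in its first slot.
  obtain ⟨g, hg⟩ := LinearMap.exists_leftInverse_of_injective (contrW W')
    (LinearMap.ker_eq_bot.2 hinj)
  let ℓ : ι → Mat n →ₗ[ℂ] ℂ := fun k =>
    -(Y.coord k ∘ₗ g ∘ₗ brk (contrW W' (Y j)) ∘ₗ prDeg i 0)
  refine ⟨fun k Z => ℓ k (adNeg (X : Mat n) (Z : Mat n)),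
    fun k => contDiff_linear_adNeg (X : Mat n) (ℓ k), fun φ hφ => ?_⟩
  ext1 Z
  rw [commutator_Omega hσ hin.le _ hφ (hM (Y j)) (hk (Y j)) hX Z, sub_self, zero_mul, add_zero,
    Finset.sum_apply]
  have hθ : theta (comp i 0 (X : Mat n) Z) = comp i 0 (X : Mat n) Z := by
    rw [comp, theta_prDeg, theta_adNeg (theta_coe X) (theta_oppNilReal σ Z)]
  obtain ⟨y, hy⟩ := hsurj _ (brk_mem_antiSub (hM (Y j)) hθ (isDeg_comp 0 _ Z))
  have hℓ : ∀ k, ℓ k (adNeg (X : Mat n) (Z : Mat n)) = Y.repr y k := by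
    intro k
    have h1 : brk (contrW W' (Y j)) (comp i 0 (X : Mat n) Z) = -contrW W' y := by
      rw [hy, brk_apply, brk_apply, neg_sub]
    change -(Y.coord k (g (brk (contrW W' (Y j)) (comp i 0 (X : Mat n) Z)))) = _
    rw [h1, map_neg, map_neg, neg_neg, Module.Basis.coord_apply]
    congr 2
    exact LinearMap.congr_fun hg y
  rw [← hy]
  have hsum : Dop hσ hφ Z (contrW W' y) = ∑ k, Y.repr y k * Dop hσ hφ Z (contrW W' (Y k)) := by
    conv_lhs => rw [← Y.sum_repr y]
    simp only [map_sum, map_smul, smul_eq_mul]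
  rw [hsum, Finset.mul_sum]
  refine Finset.sum_congr rfl fun m _ => ?_
  rw [Pi.mul_apply, Omega_eq hσ _ hφ (hM (Y m)) (hk (Y m))]
  beta_reduce
  rw [hℓ]
  ring

/-- Evaluate the commutator relation on a linear function at the origin. All terms D_M vanish, on
both sides, leaving (n - i + 1 - s) tr({X_1, M_j} P) = 0. If the scalar were nonzero, every M_j
would vanish, although they span `antiSub`. -/
theorem special_value (hi : 2 ≤ i) (hin : i < n) (hW' : IsKillingDual n i W W')
    (hsurj : ∀ M ∈ antiSub n i, ∃ y : W', contrW W' y = M) {k : ℂ} (hk0 : k ≠ 0)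
    (hk : ∀ y : W', ∀ P ∈ gr n i 1, ∀ Q ∈ gr n i 1, tauPolar n i (y : Sp n ⊗[ℂ] Sp n) P Q =
      k * (contrW W' y * anti (P : Mat n) Q).trace)
    {σ : RealForm n} (hσ : σ.conj (gradingElt n i) = gradingElt n i) {ι : Type*} [Fintype ι]
    (Y : Module.Basis ι ℂ W') {s : ℂ}
    (h : ∀ X : Sp n, σ.conj X = X → ∀ j : ι, ∃ C : ι → oppNilReal σ i → ℂ,
      ∀ φ : oppNilReal σ i → ℂ, ContDiff ℝ ∞ φ →
        leftAction σ i s X (Omega σ i s (Y j : Sp n ⊗[ℂ] Sp n) φ) -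
          Omega σ i s (Y j : Sp n ⊗[ℂ] Sp n) (leftAction σ i s X φ) =
        ∑ k, C k * Omega σ i s (Y k : Sp n ⊗[ℂ] Sp n) φ) :
    s = (n : ℂ) - i + 1 := by
  by_contra hs
  have hM : ∀ y : W', contrW W' y ∈ antiSub n i := fun y => contr_mem_antiSub (hW'.le y.2)
  have hc := killing_const_ne_zero n
  have key : ∀ X : Sp n, σ.conj X = X → ∀ j : ι, ∀ P : Mat n, IsDeg i 1 P →
      (anti (prDeg i 1 (X : Mat n)) (contrW W' (Y j)) * P).trace = 0 := by
    intro X hX j P hP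
    obtain ⟨C, hC⟩ := h X hX j
    have h1 := congrFun (hC (lin σ i P) (contDiff_lin P)) 0
    have hθ : theta (prDeg i 1 (X : Mat n)) = prDeg i 1 (X : Mat n) := by
      rw [theta_prDeg, theta_coe]
    have hcomp : comp i 1 (X : Mat n) (0 : oppNilReal σ i) = prDeg i 1 (X : Mat n) := by
      rw [comp, adNeg, Submodule.coe_zero, neg_zero, NormedSpace.exp_zero, one_mul, mul_one]
    rw [commutator_Omega hσ hin.le s (contDiff_lin P) (hM (Y j)) (hk (Y j)) hX, Dop_lin hσ hP,
      zero_add, hcomp, R_lin hσ hP 0 (theta_anti (hM (Y j)).1 hθ)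
      (isDeg_anti (hM (Y j)).2 (isDeg_prDeg _)), Finset.sum_apply, Finset.sum_eq_zero] at h1
    · refine ((mul_eq_zero.1 ((mul_eq_zero.1 h1).resolve_left ?_)).resolve_left ?_)
      · exact mul_ne_zero hk0 (mul_ne_zero (inv_ne_zero hc) (inv_ne_zero hc))
      · exact sub_ne_zero.2 (Ne.symm hs)
    · intro m _
      rw [Pi.mul_apply, Omega_eq hσ s (contDiff_lin P) (hM (Y m)) (hk (Y m))]
      beta_reduce
      rw [Dop_lin hσ hP, mul_zero, mul_zero]
  have hzero : ∀ j, contrW W' (Y j) = 0 := by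
    refine fun j => eq_zero_of_trace hin (hM (Y j)) fun P Q hP hP' hQ hQ' => ?_
    -- The relation is complex linear in X, so it passes from 𝔤₀ to 𝔤, and X_1 can be any element of
    -- 𝔤(1).
    have := eq_zero_of_eq_zero_on_real σ (f := trMul P ∘ₗ antiMap (contrW W' (Y j)) ∘ₗ prDeg i 1 ∘ₗ
      coeLin n) (fun X hX => key X hX j P hP')
      (toSp Q hQ)
    change (anti (prDeg i 1 Q) (contrW W' (Y j)) * P).trace = 0 at this
    rwa [hQ'.prDeg_eq] at this
  -- Two distinct indices below i exist because 2 ≤ i, so the space of skew matrices is not zero.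
  obtain ⟨y, hy⟩ := hsurj _ (antiUnit_mem (n := n) (i := i) (a := ⟨0, by omega⟩)
    (b := ⟨1, by omega⟩) (by simp; omega) (by simp; omega))
  rw [← Y.sum_repr y, map_sum, Finset.sum_eq_zero fun j _ => by rw [map_smul, hzero, smul_zero]] at hy
  have := congrFun (congrFun hy (Sum.inr ⟨1, by omega⟩)) (Sum.inl ⟨0, by omega⟩)
  simp [antiUnit, Matrix.single] at this

end

end OmegaTwo

end

open OmegaTwo in
theorem theorem4p9 (n i : ℕ) (hi : 2 ≤ i) (hin : i < n)
    (σ : RealForm n) (hσ : σ.conj (gradingElt n i) = gradingElt n i)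
    (W W' : LieSubmodule ℂ (levi n i) (TensorProduct ℂ (Sp n) (Sp n)))
    (hW : IsConstituent n i ((eps n 1 + eps n (i + 1)) + (eps n 2 - eps n (i + 1))) W)
    (hW' : IsKillingDual n i W W')
    {ι : Type*} [Fintype ι] (Y : Module.Basis ι ℂ W') (s : ℂ) :
    IsConformallyInvariant σ i s
        (fun j => Omega σ i s (Y j : TensorProduct ℂ (Sp n) (Sp n))) ↔
      s = (n : ℂ) - (i : ℂ) + 1 := by
  obtain ⟨hinj', hsurj', -⟩ := dual_structure hi hin hW hW'
  obtain ⟨k, hk0, hk'⟩ := tauPolar_eq hi hin hW hW'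
  have hk := fun y : W' => hk' y y.2
  have hinj : Function.Injective (contrW W') := by
    refine (injective_iff_map_eq_zero _).2 fun y hy => ?_
    exact Subtype.ext (hinj' y y.2 hy)
  have hsurj : ∀ M ∈ antiSub n i, ∃ y : W', contrW W' y = M := fun M hM => by
    obtain ⟨y, hy, e⟩ := hsurj' M hM
    exact ⟨⟨y, hy⟩, e⟩
  constructor
  · intro h
    refine special_value hi hin hW' hsurj hk0 hk hσ Y fun X hX j => ?_
    obtain ⟨C, -, hC⟩ := h.commutator X hX j
    exact ⟨C, hC⟩
  · rintro rfl
    exact ⟨fun Z c h => independent_Omega hin hW' hinj hk0 hk hσ Y _ Z c h,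
      fun X hX j => commutator_mem hin hW' hinj hsurj hk hσ Y hX j⟩
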